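/- Let $k$ be a field and let $H$ be a finite quantum groupoid over $k$, i.e. a finite-dimensional weak Hopf algebra: a finite-dimensional $k$-vector space with a (unital, associative) algebra structure and a (counital, coassociative) coalgebra structure $(\Delta,\varepsilon)$, written $\Delta(h)=h_{(1)}\otimes h_{(2)}$, such that $$\Delta(hg)=\Delta(h)\Delta(g),\qquad \varepsilon(hgf)=\varepsilon(hg_{(1)})\,\varepsilon(g_{(2)}f)=\varepsilon(hg_{(2)})\,\varepsilon(g_{(1)}f),$$ $$(\Delta\otimes\mathrm{id})\Delta(1)=(\Delta(1)\otimes 1)(1\otimes\Delta(1))=(1\otimes\Delta(1))(\Delta(1)\otimes 1),$$ with a linear map $S:H\to H$ (the antipode) such that $h_{(1)}S(h_{(2)})=\varepsilon_t(h)$, $S(h_{(1)})h_{(2)}=\varepsilon_s(h)$ and $S(h_{(1)})h_{(2)}S(h_{(3)})=S(h)$, where $\varepsilon_t(h)=(\varepsilon\otimes\mathrm{id})(\Delta(1)(h\otimes 1))$ and $\varepsilon_s(h)=(\mathrm{id}\otimes\varepsilon)((1\otimes h)\Delta(1))$. Let $H_t=\{h\in H:\varepsilon_t(h)=h\}$ be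 the target counital subalgebra. The dual space $H^*$ is a quantum groupoid with the structure dual to that of $H$: $(\phi\psi)(h)=\phi(h_{(1)})\psi(h_{(2)})$, $\langle\Delta(\phi),h\otimes g\rangle=\phi(hg)$, unit $\varepsilon$, counit $\phi\mapsto\phi(1)$, antipode $\phi\mapsto\phi\circ S$. The algebra $H$ is a left $H^*$-module algebra via $\phi\rightharpoonup h=h_{(1)}\phi(h_{(2)})$. The smash product $H\#H^*$ is the relative tensor product $H\otimes_{(H^*)_t}H^*$, where $H^*$ is a left $(H^*)_t$-module by multiplication and $H$ is a right $(H^*)_t$-module via $x\cdot\xi=x(\xi\rightharpoonup 1)$, with multiplication $(x\#\phi)(y\#\psi)=x(\phi_{(1)}\rightharpoonup y)\#\phi_{(2)}\psi$ and unit $1\#\varepsilon$. Then there is an isomorphism of $k$-algebras $$H\#H^*\;\cong\;\mathrm{End}(H)_{H_t},$$ where $\mathrm{End}(H)_{H_t}$ is the algebra (under composition) of endomorphisms of $H$ as a right $H_t$-module via right multiplication. Moreover, $H\#H^*$ is a semisimple algebra. -/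

import Mathlib

open TensorProduct Coalgebra

set_option linter.unusedSectionVars false

/-! ### Weak Hopf algebras (quantum groupoids) -/

section WeakHopf

variable (k : Type*) {H : Type*} [Field k] [Ring H] [Algebra k H] [Coalgebra k H]

/-- The target counital map `ε_t(h) = (ε ⊗ id)(Δ(1)(h ⊗ 1))`. -/
noncomputable def targetCounit : H →ₗ[k] H :=
  (TensorProduct.lid k H).toLinearMap ∘ₗ LinearMap.rTensor H counit ∘ₗ
    LinearMap.mulLeft k (comul (R := k) (1 : H)) ∘ₗ (TensorProduct.mk k H H).flip 1

/-- The source counital map `ε_s(h) = (id ⊗ ε)((1 ⊗ h)Δ(1))`. -/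
noncomputable def sourceCounit : H →ₗ[k] H :=
  (TensorProduct.rid k H).toLinearMap ∘ₗ LinearMap.lTensor H counit ∘ₗ
    LinearMap.mulRight k (comul (R := k) (1 : H)) ∘ₗ TensorProduct.mk k H H 1

theorem targetCounit_apply (h : H) :
    targetCounit k h =
      TensorProduct.lid k H (LinearMap.rTensor H counit (comul (R := k) (1 : H) * h ⊗ₜ 1)) := rfl

theorem sourceCounit_apply (h : H) :
    sourceCounit k h =
      TensorProduct.rid k H (LinearMap.lTensor H counit (1 ⊗ₜ h * comul (R := k) (1 : H))) := rfl

variable (H) in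
/-- A weak Hopf algebra structure on an algebra and coalgebra `H` over a field `k`. A finite quantum
groupoid is a weak Hopf algebra which is finite-dimensional over `k`. -/
class WeakHopfAlgebra where
  /-- `Δ(hg) = Δ(h)Δ(g)` -/
  comul_mul : ∀ h g : H, comul (R := k) (h * g) = comul h * comul g
  /-- `ε(hgf) = ε(h g₁) ε(g₂ f)` -/
  counit_mul_mul : ∀ h g f : H, counit (R := k) (h * g * f) =
    LinearMap.mul' k k (TensorProduct.map (counit ∘ₗ LinearMap.mulLeft k h)
      (counit ∘ₗ LinearMap.mulRight k f) (comul g))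
  /-- `ε(hgf) = ε(h g₂) ε(g₁ f)` -/
  counit_mul_mul' : ∀ h g f : H, counit (R := k) (h * g * f) =
    LinearMap.mul' k k (TensorProduct.map (counit ∘ₗ LinearMap.mulRight k f)
      (counit ∘ₗ LinearMap.mulLeft k h) (comul g))
  /-- `(Δ ⊗ id)Δ(1) = (Δ(1) ⊗ 1)(1 ⊗ Δ(1))` -/
  comul_one : LinearMap.rTensor H comul (comul (R := k) (1 : H)) =
    (comul (R := k) (1 : H) ⊗ₜ[k] (1 : H)) *
      (TensorProduct.assoc k H H H).symm ((1 : H) ⊗ₜ[k] comul (R := k) (1 : H))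
  /-- `(Δ ⊗ id)Δ(1) = (1 ⊗ Δ(1))(Δ(1) ⊗ 1)` -/
  comul_one' : LinearMap.rTensor H comul (comul (R := k) (1 : H)) =
    (TensorProduct.assoc k H H H).symm ((1 : H) ⊗ₜ[k] comul (R := k) (1 : H)) *
      (comul (R := k) (1 : H) ⊗ₜ[k] (1 : H))
  /-- The antipode `S`. -/
  antipode : H →ₗ[k] H
  /-- `h₁ S(h₂) = ε_t(h)` -/
  mul_lTensor_antipode : ∀ h : H,
    LinearMap.mul' k H (LinearMap.lTensor H antipode (comul h)) = targetCounit k h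
  /-- `S(h₁) h₂ = ε_s(h)` -/
  mul_rTensor_antipode : ∀ h : H,
    LinearMap.mul' k H (LinearMap.rTensor H antipode (comul h)) = sourceCounit k h
  /-- `S(h₁) h₂ S(h₃) = S(h)` -/
  antipode_mul_antipode : ∀ h : H,
    LinearMap.mul' k H (TensorProduct.map
      (LinearMap.mul' k H ∘ₗ LinearMap.rTensor H antipode) antipode
      (LinearMap.rTensor H comul (comul h))) = antipode h

end WeakHopf

namespace WeakHopfAlgebra

variable {k H : Type*} [Field k] [Ring H] [Algebra k H] [Coalgebra k H]

section basic

variable (k) in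
/-- `ε_t(h₁) h₂ = h` -/
theorem targetCounit_mul [WeakHopfAlgebra k H] (h : H) :
    LinearMap.mul' k H (TensorProduct.map (targetCounit k) LinearMap.id (comul h)) = h := by
  have key : ∀ t : H ⊗[k] H, LinearMap.mul' k H (TensorProduct.map (targetCounit k) LinearMap.id t)
      = TensorProduct.lid k H (LinearMap.rTensor H counit (comul (R := k) (1 : H) * t)) := by
    intro t
    induction t with
    | zero => simp
    | add x y hx hy => simp only [map_add, hx, hy, mul_add]
    | tmul a b =>
      rw [TensorProduct.map_tmul, LinearMap.mul'_apply, targetCounit_apply]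
      generalize comul (R := k) (1 : H) = s
      induction s with
      | zero => simp
      | add x y hx hy => simp only [map_add, ← hx, ← hy, add_mul]
      | tmul c d => simp
  rw [key, ← comul_mul, one_mul]
  simp

variable (k) in
/-- `1₁ ⊗ ε_t(1₂) = 1₁ ⊗ 1₂` -/
theorem lTensor_targetCounit_comul_one [WeakHopfAlgebra k H] :
    LinearMap.lTensor H (targetCounit k) (comul (R := k) (1 : H)) = comul (R := k) (1 : H) := by
  have h1 := congrArg (LinearMap.rTensor H ((TensorProduct.rid k H).toLinearMap ∘ₗ
    LinearMap.lTensor H counit)) (comul_one' (k := k) (H := H))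
  have h2 : ∀ t : H ⊗[k] H, LinearMap.rTensor H ((TensorProduct.rid k H).toLinearMap ∘ₗ
    LinearMap.lTensor H counit) (LinearMap.rTensor H comul t) = t := by
    intro t
    induction t with
    | zero => simp
    | add x y hx hy => simp only [map_add, hx, hy]
    | tmul a b => simp
  rw [h2] at h1
  have h3 : ∀ s t : H ⊗[k] H, LinearMap.rTensor H ((TensorProduct.rid k H).toLinearMap ∘ₗ
      LinearMap.lTensor H counit) ((TensorProduct.assoc k H H H).symm (1 ⊗ₜ s) * t ⊗ₜ[k] (1 : H)) =
      LinearMap.lTensor H ((TensorProduct.lid k H).toLinearMap ∘ₗ LinearMap.rTensor H counit ∘ₗ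
        LinearMap.mulLeft k s ∘ₗ (TensorProduct.mk k H H).flip 1) t := by
    intro s t
    induction t with
    | zero => simp
    | add x y hx hy => simp only [map_add, TensorProduct.add_tmul, mul_add, hx, hy]
    | tmul a b =>
      induction s with
      | zero => simp
      | add x y hx hy =>
        rw [TensorProduct.tmul_add, map_add, add_mul, map_add, hx, hy]
        simp [add_mul, TensorProduct.tmul_add]
      | tmul c d => simp [TensorProduct.smul_tmul']
  have h4 := h3 (comul (R := k) (1 : H)) (comul (R := k) (1 : H))
  exact (h1.trans h4).symm

variable (k) in
theorem targetCounit_idem [WeakHopfAlgebra k H] (h : H) :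
    targetCounit k (targetCounit k h) = targetCounit k h := by
  have h1 : ∀ x g : H, counit (R := k) (x * targetCounit k g) = counit (R := k) (x * g) := by
    intro x g
    have h2 := counit_mul_mul' (k := k) x 1 g
    rw [mul_one] at h2
    rw [h2, targetCounit_apply]
    generalize comul (R := k) (1 : H) = s
    induction s with
    | zero => simp
    | add x y hx hy => simp only [map_add, hx, hy, add_mul, mul_add]
    | tmul c d => simp
  have h2 : ∀ s : H ⊗[k] H, LinearMap.rTensor H (counit (R := k)) (s * targetCounit k h ⊗ₜ 1) =
      LinearMap.rTensor H counit (s * h ⊗ₜ 1) := by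
    intro s
    induction s with
    | zero => simp
    | add x y hx hy => simp only [map_add, hx, hy, add_mul]
    | tmul c d => simp [h1]
  rw [targetCounit_apply, h2, ← targetCounit_apply]

theorem comul_of_target_aux [WeakHopfAlgebra k H] {z : H} (hz : targetCounit k z = z) :
    comul (R := k) z = TensorProduct.lid k (H ⊗[k] H) (LinearMap.rTensor (H ⊗[k] H)
        (counit ∘ₗ LinearMap.mulRight k z)
        (TensorProduct.assoc k H H H (LinearMap.rTensor H comul (comul (R := k) (1 : H))))) := by
  have key : ∀ t : H ⊗[k] H,
    comul (R := k) (TensorProduct.lid k H (LinearMap.rTensor H counit (t * z ⊗ₜ 1))) =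
      TensorProduct.lid k (H ⊗[k] H) (LinearMap.rTensor (H ⊗[k] H)
        (counit ∘ₗ LinearMap.mulRight k z) (LinearMap.lTensor H comul t)) := by
    intro t
    induction t with
    | zero => simp
    | add x y hx hy => simp only [map_add, add_mul, hx, hy]
    | tmul a b => simp
  rw [coassoc_apply, ← key, ← targetCounit_apply, hz]

theorem comul_of_target [WeakHopfAlgebra k H] {z : H} (hz : targetCounit k z = z) :
    comul (R := k) z = comul (R := k) (1 : H) * z ⊗ₜ 1 := by
  have key : ∀ s t : H ⊗[k] H, TensorProduct.lid k (H ⊗[k] H) (LinearMap.rTensor (H ⊗[k] H)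
      (counit ∘ₗ LinearMap.mulRight k z) (TensorProduct.assoc k H H H
        ((TensorProduct.assoc k H H H).symm (1 ⊗ₜ s) * t ⊗ₜ[k] (1 : H)))) =
      s * (TensorProduct.lid k H (LinearMap.rTensor H counit (t * z ⊗ₜ 1))) ⊗ₜ 1 := by
    intro s t
    induction t with
    | zero => simp
    | add x y hx hy => simp only [map_add, TensorProduct.add_tmul, mul_add, add_mul, hx, hy]
    | tmul a b =>
      induction s with
      | zero => simp
      | add x y hx hy => simp only [map_add, TensorProduct.tmul_add, add_mul, hx, hy]
      | tmul c d => simp [TensorProduct.smul_tmul']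
  rw [comul_of_target_aux hz, comul_one', key, ← targetCounit_apply, hz]

theorem comul_of_target' [WeakHopfAlgebra k H] {z : H} (hz : targetCounit k z = z) :
    comul (R := k) z = z ⊗ₜ 1 * comul (R := k) (1 : H) := by
  have key : ∀ s t : H ⊗[k] H, TensorProduct.lid k (H ⊗[k] H) (LinearMap.rTensor (H ⊗[k] H)
      (counit ∘ₗ LinearMap.mulRight k z) (TensorProduct.assoc k H H H
        (t ⊗ₜ[k] (1 : H) * (TensorProduct.assoc k H H H).symm (1 ⊗ₜ s)))) =
      (TensorProduct.lid k H (LinearMap.rTensor H counit (t * z ⊗ₜ 1))) ⊗ₜ 1 * s := by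
    intro s t
    induction t with
    | zero => simp
    | add x y hx hy => simp only [map_add, TensorProduct.add_tmul, add_mul, hx, hy]
    | tmul a b =>
      induction s with
      | zero => simp
      | add x y hx hy => simp only [map_add, TensorProduct.tmul_add, mul_add, hx, hy]
      | tmul c d => simp [TensorProduct.smul_tmul']
  rw [comul_of_target_aux hz, comul_one, key, ← targetCounit_apply, hz]

theorem comul_mul_target [WeakHopfAlgebra k H] (h : H) {z : H} (hz : targetCounit k z = z) :
    comul (R := k) (h * z) = comul (R := k) h * z ⊗ₜ 1 := by
  rw [comul_mul, comul_of_target hz, ← mul_assoc, ← comul_mul, mul_one]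

theorem comul_target_mul [WeakHopfAlgebra k H] (h : H) {z : H} (hz : targetCounit k z = z) :
    comul (R := k) (z * h) = z ⊗ₜ 1 * comul (R := k) h := by
  rw [comul_mul, comul_of_target' hz, mul_assoc, ← comul_mul, one_mul]

end basic

variable (k H) in
/-- The target counital subalgebra `H_t = {h ∈ H | ε_t(h) = h}`. -/
noncomputable def targetSubalgebra [WeakHopfAlgebra k H] : Subalgebra k H where
  carrier := {h | targetCounit k h = h}
  mul_mem' := by
    intro z w hz hw
    have h1 : comul (R := k) (z * w) = comul (R := k) (1 : H) * (z * w) ⊗ₜ 1 := by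
      rw [comul_mul_target z hw, comul_of_target hz, mul_assoc]
      simp
    change targetCounit k (z * w) = z * w
    rw [targetCounit_apply, ← h1]
    simp
  add_mem' := by
    intro z w hz hw
    change targetCounit k (z + w) = z + w
    rw [map_add, hz, hw]
  algebraMap_mem' := by
    intro r
    change targetCounit k (algebraMap k H r) = algebraMap k H r
    rw [Algebra.algebraMap_eq_smul_one, map_smul, targetCounit_apply,
      ← Algebra.TensorProduct.one_def, mul_one]
    simp

theorem mem_targetSubalgebra [WeakHopfAlgebra k H] {h : H} :
    h ∈ targetSubalgebra k H ↔ targetCounit k h = h := Iff.rfl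

/-- `H` is a right `H_t`-module by right multiplication, that is, a left module over the opposite
algebra `(targetSubalgebra k H).op`; its endomorphisms `T` are the additive maps with
`T(hz) = T(h)z` for `z ∈ H_t`. -/
theorem end_apply_mul [WeakHopfAlgebra k H] (T : Module.End (targetSubalgebra k H).op H) (h z : H)
    (hz : z ∈ targetSubalgebra k H) : T (h * z) = T h * z :=
  T.map_smul ⟨MulOpposite.op z, hz⟩ h

end WeakHopfAlgebra

/-! ### Module algebras and smash products -/

section ModuleAlgebra

variable (k H A : Type*) [Field k] [Ring H] [Algebra k H] [Coalgebra k H] [Ring A] [Algebra k A]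

/-- A left `H`-module algebra over a weak Hopf algebra `H`: an algebra `A` which is a left `H`-module
such that `h • (xy) = (h₁ • x)(h₂ • y)` and `h • 1 = ε_t(h) • 1`. -/
class WeakModuleAlgebra [Module H A] [IsScalarTower k H A] : Prop where
  smul_mul : ∀ (h : H) (x y : A), h • (x * y) =
    LinearMap.mul' k A (TensorProduct.map
      ((LinearMap.toSpanSingleton H A x).restrictScalars k)
      ((LinearMap.toSpanSingleton H A y).restrictScalars k) (comul h))
  smul_one : ∀ h : H, h • (1 : A) = targetCounit k h • (1 : A)

end ModuleAlgebra

section SmashProduct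

variable (k : Type*) {H A : Type*} [Field k] [Ring H] [Algebra k H] [Coalgebra k H]
  [Ring A] [Algebra k A] [Module H A] [IsScalarTower k H A]

namespace WeakModuleAlgebra

/-- The map `h ↦ h • x`. -/
def orbit (x : A) : H →ₗ[k] A := (LinearMap.toSpanSingleton H A x).restrictScalars k

@[simp] theorem orbit_apply (x : A) (h : H) : orbit k x h = h • x := rfl

theorem orbit_add (x y : A) : orbit (H := H) k (x + y) = orbit k x + orbit k y := by
  ext h; simp

theorem smul_mul_eq [WeakModuleAlgebra k H A] (h : H) (x y : A) : h • (x * y) =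
    LinearMap.mul' k A (TensorProduct.map (orbit k x) (orbit k y) (comul h)) :=
  smul_mul h x y

/-- `z • y = (z • 1) y` for `z ∈ H_t`. -/
theorem target_smul [WeakHopfAlgebra k H] [WeakModuleAlgebra k H A] {z : H}
    (hz : targetCounit k z = z) (y : A) : z • y = (z • (1 : A)) * y := by
  have h1 := smul_mul_eq k z (1 : A) y
  have h2 := smul_mul_eq k (1 : H) (z • (1 : A)) y
  rw [one_mul, WeakHopfAlgebra.comul_of_target hz] at h1
  rw [one_smul] at h2
  rw [h1, h2]
  generalize comul (R := k) (1 : H) = s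
  induction s with
  | zero => simp
  | add x y hx hy => simp only [map_add, hx, hy, add_mul]
  | tmul c d => simp [mul_smul]

theorem smul_smul_one [WeakModuleAlgebra k H A] (h z : H) :
    h • z • (1 : A) = targetCounit k (h * z) • (1 : A) := by
  rw [smul_smul, WeakModuleAlgebra.smul_one (k := k)]

end WeakModuleAlgebra

namespace SmashProduct

open WeakModuleAlgebra

/-- The action `h ↦ (y ⊗ g ↦ h₁ • y ⊗ h₂ g)` of `H` on `A ⊗ H`. -/
noncomputable def diag : H →ₗ[k] Module.End k (A ⊗[k] H) :=
  TensorProduct.homTensorHomMap (RingHom.id k) A H A H ∘ₗ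
    TensorProduct.map (Algebra.lsmul k k A).toLinearMap (LinearMap.mul k H) ∘ₗ comul

theorem diag_tmul (h : H) (y : A) (g : H) :
    diag k h (y ⊗ₜ[k] g) =
      TensorProduct.map (orbit k y) (LinearMap.mulRight k g) (comul (R := k) h) := by
  simp only [diag, LinearMap.comp_apply]
  generalize comul (R := k) h = s
  induction s with
  | zero => simp
  | add x y hx hy => simp only [map_add, LinearMap.add_apply, hx, hy]
  | tmul c d => simp

/-- Left multiplication by `x` on the first factor of `A ⊗ H`. -/
noncomputable def left : A →ₗ[k] Module.End k (A ⊗[k] H) :=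
  LinearMap.rTensorHom H ∘ₗ LinearMap.mul k A

@[simp] theorem left_tmul (x y : A) (g : H) : left k x (y ⊗ₜ[k] g) = (x * y) ⊗ₜ g := rfl

theorem left_mul (x y : A) : left (H := H) k (x * y) = left k x * left k y := by
  ext; simp [mul_assoc]

theorem diag_mul [WeakHopfAlgebra k H] (h g : H) :
    diag (A := A) k (h * g) = diag k h * diag k g := by
  simp only [diag, LinearMap.comp_apply, WeakHopfAlgebra.comul_mul]
  generalize comul (R := k) h = s
  generalize comul (R := k) g = t
  induction s with
  | zero => simp
  | add x y hx hy => simp only [map_add, add_mul, hx, hy]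
  | tmul a b =>
    induction t with
    | zero => simp
    | add x y hx hy => simp only [map_add, mul_add, hx, hy]
    | tmul c d => ext; simp [mul_assoc]

theorem diag_left [WeakModuleAlgebra k H A] (h : H) (y : A) :
    diag k h * left k y = LinearMap.mul' k (Module.End k (A ⊗[k] H))
      (TensorProduct.map (left k ∘ₗ orbit k y) (diag k) (comul (R := k) h)) := by
  ext w f
  simp only [TensorProduct.AlgebraTensorModule.curry_apply, TensorProduct.curry_apply,
    LinearMap.restrictScalars_self, Module.End.mul_apply, left_tmul, diag_tmul]
  have h1 : ∀ t : H ⊗[k] H, TensorProduct.map (orbit k (y * w)) (LinearMap.mulRight k f) t =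
      TensorProduct.map (LinearMap.mul' k A ∘ₗ TensorProduct.map (orbit k y) (orbit k w))
        (LinearMap.mulRight k f) (LinearMap.rTensor H comul t) := by
    intro t
    induction t with
    | zero => simp
    | add x y hx hy => simp only [map_add, hx, hy]
    | tmul a b => simp [smul_mul_eq k a]
  have h2 : ∀ t : H ⊗[k] H, LinearMap.mul' k (Module.End k (A ⊗[k] H))
      (TensorProduct.map (left k ∘ₗ orbit k y) (diag k) t) (w ⊗ₜ f) =
      (TensorProduct.map (LinearMap.mul' k A) LinearMap.id ∘ₗ
        (TensorProduct.assoc k A A H).symm.toLinearMap)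
      (TensorProduct.map (orbit k y) (TensorProduct.map (orbit k w) (LinearMap.mulRight k f))
        (LinearMap.lTensor H comul t)) := by
    intro t
    induction t with
    | zero => simp
    | add x y hx hy => simp only [map_add, LinearMap.add_apply, hx, hy]
    | tmul a b =>
      simp only [TensorProduct.map_tmul, LinearMap.mul'_apply, LinearMap.comp_apply,
        Module.End.mul_apply, diag_tmul, LinearMap.lTensor_tmul, orbit_apply]
      generalize comul (R := k) b = s
      induction s with
      | zero => simp
      | add x y hx hy => simp only [map_add, TensorProduct.tmul_add, hx, hy]
      | tmul c d => simp
  rw [h1, h2, ← coassoc_apply]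
  generalize LinearMap.rTensor H comul (comul (R := k) h) = u
  induction u with
  | zero => simp
  | add x y hx hy => simp only [map_add, hx, hy]
  | tmul s b =>
    induction s with
    | zero => simp
    | add x y hx hy => simp only [map_add, TensorProduct.add_tmul, hx, hy]
    | tmul c d => simp

theorem diag_target_mul [WeakHopfAlgebra k H] [WeakModuleAlgebra k H A] {z : H}
    (hz : targetCounit k z = z) (h : H) :
    diag (A := A) k (z * h) = left k (z • 1) * diag k h := by
  simp only [diag, LinearMap.comp_apply, WeakHopfAlgebra.comul_target_mul h hz]
  generalize comul (R := k) h = s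
  induction s with
  | zero => simp
  | add x y hx hy => simp only [map_add, mul_add, hx, hy]
  | tmul a b =>
    ext y g
    simp [target_smul k hz (a • y)]

/-- The map `a ↦ (b ↦ ab)` on `A ⊗ H`, where `(x ⊗ h)(y ⊗ g) = x(h₁ • y) ⊗ h₂ g`. -/
noncomputable def mulAux : A ⊗[k] H →ₗ[k] Module.End k (A ⊗[k] H) :=
  LinearMap.mul' k (Module.End k (A ⊗[k] H)) ∘ₗ TensorProduct.map (left k) (diag k)

theorem mulAux_tmul (x : A) (h : H) : mulAux k (x ⊗ₜ[k] h) = left k x * diag k h := rfl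

theorem mulAux_left (x : A) (a : A ⊗[k] H) : mulAux k (left k x a) = left k x * mulAux k a := by
  induction a with
  | zero => simp
  | add a b ha hb => simp only [map_add, mul_add, ha, hb]
  | tmul y h => rw [left_tmul, mulAux_tmul, mulAux_tmul, left_mul, mul_assoc]

theorem mulAux_diag [WeakHopfAlgebra k H] [WeakModuleAlgebra k H A] (h : H) (a : A ⊗[k] H) :
    mulAux k (diag k h a) = diag k h * mulAux k a := by
  induction a with
  | zero => simp
  | add a b ha hb => simp only [map_add, mul_add, ha, hb]
  | tmul y g =>
    rw [mulAux_tmul, ← mul_assoc, diag_left, diag_tmul]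
    generalize comul (R := k) h = s
    induction s with
    | zero => simp
    | add a b ha hb => simp only [map_add, add_mul, ha, hb]
    | tmul c d => simp [mulAux_tmul, diag_mul, mul_assoc]

theorem mulAux_mulAux [WeakHopfAlgebra k H] [WeakModuleAlgebra k H A] (a b : A ⊗[k] H) :
    mulAux k (mulAux k a b) = mulAux k a * mulAux k b := by
  induction a with
  | zero => simp
  | add a b ha hb => simp only [map_add, LinearMap.add_apply, add_mul, ha, hb]
  | tmul x h =>
    rw [mulAux_tmul, Module.End.mul_apply, mulAux_left, mulAux_diag, mul_assoc]

variable (H A) in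
/-- The subspace of `A ⊗ H` spanned by the elements `x(z • 1) ⊗ h - x ⊗ zh` with `z ∈ H_t`. -/
def relations [WeakHopfAlgebra k H] : Submodule k (A ⊗[k] H) :=
  Submodule.span k {t | ∃ (x : A) (z : H) (h : H), z ∈ WeakHopfAlgebra.targetSubalgebra k H ∧
    t = (x * z • (1 : A)) ⊗ₜ[k] h - x ⊗ₜ[k] (z * h)}

theorem relations_le_ker_mulAux [WeakHopfAlgebra k H] [WeakModuleAlgebra k H A] :
    relations k H A ≤ LinearMap.ker (mulAux k) := by
  refine Submodule.span_le.2 ?_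
  rintro _ ⟨x, z, h, hz, rfl⟩
  rw [SetLike.mem_coe, LinearMap.mem_ker, map_sub, mulAux_tmul, mulAux_tmul, diag_target_mul k hz,
    left_mul, mul_assoc, sub_self]

theorem left_relations [WeakHopfAlgebra k H] (x : A) :
    relations k H A ≤ (relations k H A).comap (left k x) := by
  refine Submodule.span_le.2 ?_
  rintro _ ⟨y, z, h, hz, rfl⟩
  refine Submodule.subset_span ⟨x * y, z, h, hz, ?_⟩
  simp [mul_assoc]

theorem mkQ_relations [WeakHopfAlgebra k H] (x : A) {z : H} (hz : targetCounit k z = z) (h : H) :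
    (relations k H A).mkQ ((x * z • (1 : A)) ⊗ₜ[k] h) =
      (relations k H A).mkQ (x ⊗ₜ[k] (z * h)) := by
  rw [← sub_eq_zero, ← map_sub]
  exact (Submodule.Quotient.mk_eq_zero _).2 (Submodule.subset_span ⟨x, z, h, hz, rfl⟩)

theorem diag_relations [WeakHopfAlgebra k H] [WeakModuleAlgebra k H A] (h : H) :
    relations k H A ≤ (relations k H A).comap (diag k h) := by
  refine Submodule.span_le.2 ?_
  rintro _ ⟨y, z, g, hz, rfl⟩
  change diag k h _ ∈ relations k H A
  rw [← Submodule.Quotient.mk_eq_zero, ← Submodule.mkQ_apply, map_sub, map_sub, sub_eq_zero]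
  have hl : diag k h ((y * z • (1 : A)) ⊗ₜ[k] g) =
      (diag k h * left k y : Module.End k (A ⊗[k] H)) ((z • (1 : A)) ⊗ₜ[k] g) :=
    rfl
  have key : ∀ t : H ⊗[k] H, (relations k H A).mkQ (LinearMap.mul' k (Module.End k (A ⊗[k] H))
      (TensorProduct.map (left k ∘ₗ orbit k y) (diag k) t) ((z • (1 : A)) ⊗ₜ g)) =
      (relations k H A).mkQ (TensorProduct.map (orbit k y) (LinearMap.mulRight k (z * g)) t) := by
    intro t
    induction t with
    | zero => simp
    | add a b ha hb => simp only [map_add, LinearMap.add_apply, ha, hb]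
    | tmul a b =>
      have h1 : ∀ s : H ⊗[k] H, (relations k H A).mkQ (left k (a • y)
          (TensorProduct.map (orbit k (z • (1 : A))) (LinearMap.mulRight k g) s)) =
          (relations k H A).mkQ ((a • y) ⊗ₜ[k] (LinearMap.mul' k H
            (TensorProduct.map (targetCounit k) LinearMap.id (s * z ⊗ₜ 1)) * g)) := by
        intro s
        induction s with
        | zero => simp
        | add a b ha hb => simp only [map_add, add_mul, TensorProduct.tmul_add, ha, hb]
        | tmul c d =>
          simp only [TensorProduct.map_tmul, orbit_apply, LinearMap.mulRight_apply, left_tmul,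
            Algebra.TensorProduct.tmul_mul_tmul, mul_one, LinearMap.mul'_apply, LinearMap.id_apply]
          rw [smul_smul_one k, mkQ_relations k _ (WeakHopfAlgebra.targetCounit_idem k _), mul_assoc]
      simp only [TensorProduct.map_tmul, LinearMap.mul'_apply, LinearMap.comp_apply,
        Module.End.mul_apply, diag_tmul, orbit_apply]
      rw [h1, ← WeakHopfAlgebra.comul_mul_target b hz, WeakHopfAlgebra.targetCounit_mul]
      simp [mul_assoc]
  rw [hl, diag_left, key, ← diag_tmul]

theorem mulAux_relations [WeakHopfAlgebra k H] [WeakModuleAlgebra k H A] (a : A ⊗[k] H) :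
    relations k H A ≤ (relations k H A).comap (mulAux k a) := by
  induction a with
  | zero => intro t _; simp
  | add a b ha hb =>
    intro t ht
    have h1 : mulAux k (a + b) t = mulAux k a t + mulAux k b t := by
      rw [map_add, LinearMap.add_apply]
    rw [Submodule.mem_comap, h1]
    exact Submodule.add_mem _ (ha ht) (hb ht)
  | tmul x h => exact fun t ht => left_relations k x (diag_relations k h ht)

theorem mkQ_mulAux_one [WeakHopfAlgebra k H] [WeakModuleAlgebra k H A] (a : A ⊗[k] H) :
    (relations k H A).mkQ (mulAux k (1 ⊗ₜ 1) a) = (relations k H A).mkQ a := by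
  induction a with
  | zero => simp
  | add a b ha hb => simp only [map_add, ha, hb]
  | tmul y g =>
    have h1 : ∀ t : H ⊗[k] H, (relations k H A).mkQ (TensorProduct.map (orbit k y)
        (LinearMap.mulRight k g) (LinearMap.lTensor H (targetCounit k) t)) =
        (relations k H A).mkQ (LinearMap.mul' k A (TensorProduct.map (orbit k y) (orbit k 1) t)
          ⊗ₜ g) := by
      intro t
      induction t with
      | zero => simp
      | add a b ha hb => simp only [map_add, TensorProduct.add_tmul, ha, hb]
      | tmul c d =>
        simp only [TensorProduct.map_tmul, orbit_apply, LinearMap.mulRight_apply,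
          LinearMap.mul'_apply, LinearMap.lTensor_tmul]
        rw [← mkQ_relations k _ (WeakHopfAlgebra.targetCounit_idem k _), ← WeakModuleAlgebra.smul_one (k := k)]
    have h2 := h1 (comul (R := k) (1 : H))
    rw [WeakHopfAlgebra.lTensor_targetCounit_comul_one, ← smul_mul_eq, ← diag_tmul, one_smul,
      mul_one] at h2
    have h3 : left (H := H) k (1 : A) = 1 := by ext; simp
    rw [← h2, mulAux_tmul, h3, one_mul]

theorem mkQ_mulAux_apply_one [WeakHopfAlgebra k H] [WeakModuleAlgebra k H A] (a : A ⊗[k] H) :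
    (relations k H A).mkQ (mulAux k a (1 ⊗ₜ 1)) = (relations k H A).mkQ a := by
  induction a with
  | zero => simp
  | add a b ha hb => simp only [map_add, LinearMap.add_apply, ha, hb]
  | tmul x h =>
    have h1 : ∀ t : H ⊗[k] H, (relations k H A).mkQ (left k x (TensorProduct.map (orbit k 1)
        (LinearMap.mulRight k 1) t)) =
        (relations k H A).mkQ (x ⊗ₜ LinearMap.mul' k H
          (TensorProduct.map (targetCounit k) LinearMap.id t)) := by
      intro t
      induction t with
      | zero => simp
      | add a b ha hb => simp only [map_add, TensorProduct.tmul_add, ha, hb]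
      | tmul c d =>
        simp only [TensorProduct.map_tmul, orbit_apply, LinearMap.mulRight_apply, mul_one,
          LinearMap.mul'_apply, left_tmul, LinearMap.id_apply]
        rw [WeakModuleAlgebra.smul_one (k := k), mkQ_relations k _ (WeakHopfAlgebra.targetCounit_idem k _)]
    have h2 := h1 (comul (R := k) h)
    rw [WeakHopfAlgebra.targetCounit_mul, ← diag_tmul] at h2
    rw [mulAux_tmul, Module.End.mul_apply, h2]

end SmashProduct

variable (H A) in
/-- The smash product `A # H`: the relative tensor product `A ⊗_{H_t} H`, where `A` is the right
`H_t`-module with `x · z = x(z • 1)`, with the multiplication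
`(x # h)(y # g) = x(h₁ • y) # h₂ g` and the unit `1 # 1`. -/
def SmashProduct [WeakHopfAlgebra k H] : Type _ := (A ⊗[k] H) ⧸ SmashProduct.relations k H A

namespace SmashProduct

variable [WeakHopfAlgebra k H]

noncomputable instance : AddCommGroup (SmashProduct k H A) :=
  inferInstanceAs (AddCommGroup ((A ⊗[k] H) ⧸ relations k H A))

noncomputable instance : Module k (SmashProduct k H A) :=
  inferInstanceAs (Module k ((A ⊗[k] H) ⧸ relations k H A))

variable (H A) in
/-- The canonical projection `A ⊗ H → A # H`. -/
noncomputable def proj : A ⊗[k] H →ₗ[k] SmashProduct k H A := (relations k H A).mkQ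

/-- The element `x # h` of `A # H`. -/
noncomputable def mk (x : A) (h : H) : SmashProduct k H A := proj k H A (x ⊗ₜ h)

theorem proj_surjective : Function.Surjective (proj k H A) := Submodule.mkQ_surjective _

variable [WeakModuleAlgebra k H A]

variable (H A) in
/-- The multiplication of `A # H` as a bilinear map. -/
noncomputable def mulMap : SmashProduct k H A →ₗ[k] SmashProduct k H A →ₗ[k] SmashProduct k H A :=
  (relations k H A).liftQ
    { toFun := fun a => (relations k H A).mapQ (relations k H A) (mulAux k a) (mulAux_relations k a)
      map_add' := fun a b => by
        refine Submodule.linearMap_qext _ (LinearMap.ext fun t => ?_)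
        change (relations k H A).mkQ (mulAux k (a + b) t) =
          (relations k H A).mkQ (mulAux k a t) + (relations k H A).mkQ (mulAux k b t)
        rw [map_add, LinearMap.add_apply, map_add]
      map_smul' := fun c a => by
        refine Submodule.linearMap_qext _ (LinearMap.ext fun t => ?_)
        change (relations k H A).mkQ (mulAux k (c • a) t) =
          c • (relations k H A).mkQ (mulAux k a t)
        rw [map_smul, LinearMap.smul_apply, map_smul] }
    (fun a ha => by
      have h1 : mulAux k a = 0 := relations_le_ker_mulAux k ha
      refine Submodule.linearMap_qext _ (LinearMap.ext fun t => ?_)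
      change (relations k H A).mkQ (mulAux k a t) = 0
      rw [h1, LinearMap.zero_apply, map_zero])

theorem mulMap_proj (a b : A ⊗[k] H) :
    mulMap k H A (proj k H A a) (proj k H A b) = proj k H A (mulAux k a b) := rfl

noncomputable instance : Mul (SmashProduct k H A) := ⟨fun a b => mulMap k H A a b⟩

noncomputable instance : One (SmashProduct k H A) := ⟨mk k 1 1⟩

theorem mul_def (a b : SmashProduct k H A) : a * b = mulMap k H A a b := rfl

theorem one_def : (1 : SmashProduct k H A) = mk k 1 1 := rfl

noncomputable instance : Ring (SmashProduct k H A) :=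
  { (inferInstance : AddCommGroup (SmashProduct k H A)),
    (inferInstance : Mul (SmashProduct k H A)),
    (inferInstance : One (SmashProduct k H A)) with
    left_distrib := fun a b c => by simp only [mul_def, map_add]
    right_distrib := fun a b c => by simp only [mul_def, map_add, LinearMap.add_apply]
    zero_mul := fun a => by simp only [mul_def, map_zero, LinearMap.zero_apply]
    mul_zero := fun a => by simp only [mul_def, map_zero]
    mul_assoc := fun a b c => by
      obtain ⟨a, rfl⟩ := proj_surjective k a
      obtain ⟨b, rfl⟩ := proj_surjective k b
      obtain ⟨c, rfl⟩ := proj_surjective k c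
      simp only [mul_def, mulMap_proj, mulAux_mulAux, Module.End.mul_apply]
    one_mul := fun a => by
      obtain ⟨a, rfl⟩ := proj_surjective k a
      rw [mul_def, one_def, mk, mulMap_proj]
      exact mkQ_mulAux_one k a
    mul_one := fun a => by
      obtain ⟨a, rfl⟩ := proj_surjective k a
      rw [mul_def, one_def, mk, mulMap_proj]
      exact mkQ_mulAux_apply_one k a }

noncomputable instance : Algebra k (SmashProduct k H A) :=
  Algebra.ofModule (fun c a b => by simp only [mul_def, map_smul, LinearMap.smul_apply])
    (fun c a b => by simp only [mul_def, map_smul])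

/-- `(x # h)(y # g) = x(h₁ • y) # h₂ g` -/
theorem mk_mul_mk (x y : A) (h g : H) : mk k x h * mk k y g =
    proj k H A (TensorProduct.map (LinearMap.mulLeft k x ∘ₗ WeakModuleAlgebra.orbit k y) (LinearMap.mulRight k g)
      (comul (R := k) h)) := by
  rw [mul_def, mk, mk, mulMap_proj, mulAux_tmul, Module.End.mul_apply, diag_tmul]
  generalize comul (R := k) h = s
  induction s with
  | zero => simp
  | add a b ha hb => simp only [map_add, ha, hb]
  | tmul c d => simp

/-- `x(z • 1) # h = x # zh` for `z ∈ H_t` -/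
theorem mk_target_mul (x : A) {z : H} (hz : z ∈ WeakHopfAlgebra.targetSubalgebra k H) (h : H) :
    mk k (x * z • (1 : A)) h = mk k x (z * h) :=
  mkQ_relations k x hz h

end SmashProduct

end SmashProduct

/-! ### The dual quantum groupoid -/

section Dual

variable (k H : Type*) [Field k] [Ring H] [Algebra k H] [Coalgebra k H]

/-- The dual `H*` of `H`, with the convolution product `(φψ)(h) = φ(h₁) ψ(h₂)`, the unit of which is
the counit `ε` of `H`. -/
def DualGroupoid : Type _ := WithConv (H →ₗ[k] k)

end Dual

namespace DualGroupoid

variable {k H : Type*} [Field k] [Ring H] [Algebra k H] [Coalgebra k H]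

noncomputable instance : Ring (DualGroupoid k H) := inferInstanceAs (Ring (WithConv (H →ₗ[k] k)))

noncomputable instance : Algebra k (DualGroupoid k H) :=
  inferInstanceAs (Algebra k (WithConv (H →ₗ[k] k)))

/-- An element of `H*` as a linear form on `H`. -/
def toDual : DualGroupoid k H ≃ₗ[k] Module.Dual k H where
  toFun φ := WithConv.ofConv φ
  invFun f := WithConv.toConv f
  map_add' _ _ := rfl
  map_smul' _ _ := rfl

@[ext] theorem ext {φ ψ : DualGroupoid k H} (hφ : ∀ h, toDual φ h = toDual ψ h) : φ = ψ :=
  toDual.injective (LinearMap.ext hφ)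

theorem mul_apply (φ ψ : DualGroupoid k H) (h : H) : toDual (φ * ψ) h =
    LinearMap.mul' k k (TensorProduct.map (toDual φ) (toDual ψ) (comul h)) := rfl

theorem one_apply (h : H) : toDual (1 : DualGroupoid k H) h = counit h := rfl

/-- The left action `φ ⇀ h = h₁ φ(h₂)` of `H*` on `H`. -/
noncomputable def act : DualGroupoid k H →ₗ[k] H →ₗ[k] H :=
  LinearMap.mk₂ k (fun φ h => TensorProduct.rid k H (LinearMap.lTensor H (toDual φ) (comul h)))
    (fun φ ψ h => by simp [LinearMap.lTensor_add])
    (fun c φ h => by simp [LinearMap.lTensor_smul])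
    (fun φ h g => by simp)
    (fun c φ h => by simp)

theorem act_apply (φ : DualGroupoid k H) (h : H) :
    act φ h = TensorProduct.rid k H (LinearMap.lTensor H (toDual φ) (comul h)) := rfl

theorem mul_act (φ ψ : DualGroupoid k H) (h : H) : act (φ * ψ) h = act φ (act ψ h) := by
  have h1 : ∀ t : H ⊗[k] H, TensorProduct.rid k H (LinearMap.lTensor H (toDual (φ * ψ)) t) =
      TensorProduct.rid k H (LinearMap.lTensor H
        (LinearMap.mul' k k ∘ₗ TensorProduct.map (toDual φ) (toDual ψ))
        (LinearMap.lTensor H comul t)) := by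
    intro t
    rw [← LinearMap.lTensor_comp_apply]
    rfl
  have h2 : ∀ t : H ⊗[k] H, act φ (TensorProduct.rid k H (LinearMap.lTensor H (toDual ψ) t)) =
      TensorProduct.rid k H (TensorProduct.map
        ((TensorProduct.rid k H).toLinearMap ∘ₗ LinearMap.lTensor H (toDual φ)) (toDual ψ)
        (LinearMap.rTensor H comul t)) := by
    intro t
    induction t with
    | zero => simp
    | add x y hx hy => simp only [map_add, hx, hy]
    | tmul a b => simp [act_apply]
  rw [act_apply, h1, act_apply ψ, h2, ← coassoc_apply]
  generalize LinearMap.rTensor H comul (comul (R := k) h) = u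
  induction u with
  | zero => simp
  | add x y hx hy => simp only [map_add, hx, hy]
  | tmul s b =>
    induction s with
    | zero => simp
    | add x y hx hy => simp only [map_add, TensorProduct.add_tmul, hx, hy]
    | tmul c d => simp [smul_smul, mul_comm]

theorem one_act (h : H) : act (1 : DualGroupoid k H) h = h := by
  rw [act_apply]
  have h1 : toDual (1 : DualGroupoid k H) = counit := rfl
  simp [h1]

/-- `H` is a left `H*`-module via `φ ⇀ h = h₁ φ(h₂)`. -/
noncomputable instance : Module (DualGroupoid k H) H where
  smul φ h := act φ h
  one_smul h := one_act h
  mul_smul φ ψ h := mul_act φ ψ h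
  smul_zero φ := map_zero _
  smul_add φ h g := map_add _ _ _
  add_smul φ ψ h := by
    change act (φ + ψ) h = act φ h + act ψ h
    rw [map_add, LinearMap.add_apply]
  zero_smul h := by
    change act 0 h = 0
    rw [map_zero, LinearMap.zero_apply]

/-- `φ ⇀ h = h₁ φ(h₂)` -/
theorem smul_def (φ : DualGroupoid k H) (h : H) :
    φ • h = TensorProduct.rid k H (LinearMap.lTensor H (toDual φ) (comul h)) := rfl

instance : IsScalarTower k (DualGroupoid k H) H where
  smul_assoc c φ h := by
    change act (c • φ) h = c • act φ h
    rw [map_smul, LinearMap.smul_apply]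

section finite

variable [FiniteDimensional k H]

instance : FiniteDimensional k (DualGroupoid k H) :=
  Module.Finite.equiv toDual.symm

/-- The identification of `H* ⊗ H*` with the dual of `H ⊗ H`. -/
noncomputable def pair : DualGroupoid k H ⊗[k] DualGroupoid k H ≃ₗ[k] Module.Dual k (H ⊗[k] H) :=
  TensorProduct.congr toDual toDual ≪≫ₗ
    TensorProduct.dualDistribEquiv k H H

@[simp] theorem pair_tmul (φ ψ : DualGroupoid k H) (h g : H) :
    pair (φ ⊗ₜ[k] ψ) (h ⊗ₜ[k] g) = toDual φ h * toDual ψ g := rfl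

/-- The identification of `(H* ⊗ H*) ⊗ H*` with the dual of `(H ⊗ H) ⊗ H`. -/
noncomputable def pair₃ : (DualGroupoid k H ⊗[k] DualGroupoid k H) ⊗[k] DualGroupoid k H ≃ₗ[k]
    Module.Dual k ((H ⊗[k] H) ⊗[k] H) :=
  TensorProduct.congr pair toDual ≪≫ₗ
    TensorProduct.dualDistribEquiv k (H ⊗[k] H) H

@[simp] theorem pair₃_tmul (t : DualGroupoid k H ⊗[k] DualGroupoid k H) (ψ : DualGroupoid k H)
    (s : H ⊗[k] H) (g : H) : pair₃ (t ⊗ₜ[k] ψ) (s ⊗ₜ[k] g) = pair t s * toDual ψ g := rfl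

/-- The comultiplication of `H*`, determined by `⟨Δ(φ), h ⊗ g⟩ = φ(hg)`. -/
noncomputable def comulMap : DualGroupoid k H →ₗ[k] DualGroupoid k H ⊗[k] DualGroupoid k H :=
  pair.symm.toLinearMap ∘ₗ (LinearMap.mul' k H).dualMap ∘ₗ
    toDual.toLinearMap

@[simp] theorem pair_comulMap (φ : DualGroupoid k H) (s : H ⊗[k] H) :
    pair (comulMap φ) s = toDual φ (LinearMap.mul' k H s) := by
  simp [comulMap]

/-- The counit `φ ↦ φ(1)` of `H*`. -/
noncomputable def counitMap : DualGroupoid k H →ₗ[k] k :=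
  LinearMap.applyₗ (1 : H) ∘ₗ toDual.toLinearMap

@[simp] theorem counitMap_apply (φ : DualGroupoid k H) : counitMap φ = toDual φ 1 := rfl

theorem pair_ext {s t : DualGroupoid k H ⊗[k] DualGroupoid k H}
    (hst : ∀ h g : H, pair s (h ⊗ₜ g) = pair t (h ⊗ₜ g)) : s = t :=
  pair.injective (TensorProduct.ext' hst)

theorem pair₃_ext {s t : (DualGroupoid k H ⊗[k] DualGroupoid k H) ⊗[k] DualGroupoid k H}
    (hst : ∀ h g f : H, pair₃ s ((h ⊗ₜ g) ⊗ₜ f) = pair₃ t ((h ⊗ₜ g) ⊗ₜ f)) : s = t :=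
  pair₃.injective (TensorProduct.ext_threefold hst)

theorem pair₃_rTensor (t : DualGroupoid k H ⊗[k] DualGroupoid k H) (s : H ⊗[k] H) (f : H) :
    pair₃ (LinearMap.rTensor _ comulMap t) (s ⊗ₜ f) =
      pair t (LinearMap.mul' k H s ⊗ₜ f) := by
  induction t with
  | zero => simp
  | add x y hx hy => simp only [map_add, LinearMap.add_apply, hx, hy]
  | tmul φ ψ => simp

theorem pair₃_assoc_symm (φ : DualGroupoid k H) (t : DualGroupoid k H ⊗[k] DualGroupoid k H)
    (h g f : H) :
    pair₃ ((TensorProduct.assoc k _ _ _).symm (φ ⊗ₜ t)) ((h ⊗ₜ g) ⊗ₜ f) =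
      (toDual φ) h * pair t (g ⊗ₜ f) := by
  induction t with
  | zero => simp
  | add x y hx hy => simp only [map_add, LinearMap.add_apply, TensorProduct.tmul_add, hx, hy,
      mul_add]
  | tmul χ ψ => simp [mul_assoc]

theorem pair₃_lTensor (t : DualGroupoid k H ⊗[k] DualGroupoid k H) (h g f : H) :
    pair₃ ((TensorProduct.assoc k _ _ _).symm (LinearMap.lTensor _ comulMap t))
      ((h ⊗ₜ g) ⊗ₜ f) = pair t (h ⊗ₜ (g * f)) := by
  induction t with
  | zero => simp
  | add x y hx hy => simp only [map_add, LinearMap.add_apply, hx, hy]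
  | tmul φ ψ => simp [pair₃_assoc_symm]

theorem lid_counit (t : DualGroupoid k H ⊗[k] DualGroupoid k H) (h : H) :
    toDual (TensorProduct.lid k _ (LinearMap.rTensor _ counitMap t)) h = pair t (1 ⊗ₜ h) := by
  induction t with
  | zero => simp
  | add x y hx hy => simp only [map_add, LinearMap.add_apply, hx, hy]
  | tmul φ ψ => simp

theorem rid_counit (t : DualGroupoid k H ⊗[k] DualGroupoid k H) (h : H) :
    toDual (TensorProduct.rid k _ (LinearMap.lTensor _ counitMap t)) h = pair t (h ⊗ₜ 1) := by
  induction t with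
  | zero => simp
  | add x y hx hy => simp only [map_add, LinearMap.add_apply, hx, hy]
  | tmul φ ψ => simp [mul_comm]

noncomputable instance : Coalgebra k (DualGroupoid k H) where
  comul := comulMap
  counit := counitMap
  coassoc := by
    ext1 φ
    rw [LinearMap.comp_apply, LinearMap.comp_apply, LinearMap.comp_apply, LinearEquiv.coe_coe,
      ← LinearEquiv.eq_symm_apply]
    refine pair₃_ext fun h g f => ?_
    rw [pair₃_rTensor, pair₃_lTensor]
    simp [mul_assoc]
  rTensor_counit_comp_comul := by
    ext1 φ
    apply (TensorProduct.lid k _).injective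
    ext h
    rw [LinearMap.comp_apply, lid_counit]
    simp
  lTensor_counit_comp_comul := by
    ext1 φ
    apply (TensorProduct.rid k _).injective
    ext h
    rw [LinearMap.comp_apply, rid_counit]
    simp

/-- `⟨Δ(φ), h ⊗ g⟩ = φ(hg)` -/
theorem pair_comul (φ : DualGroupoid k H) (s : H ⊗[k] H) :
    pair (comul (R := k) φ) s = toDual φ (LinearMap.mul' k H s) := pair_comulMap φ s

theorem counit_apply (φ : DualGroupoid k H) : counit (R := k) φ = toDual φ 1 := rfl

theorem pair_mul (s t : DualGroupoid k H ⊗[k] DualGroupoid k H) (h g : H) :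
    pair (s * t) (h ⊗ₜ g) = LinearMap.mul' k k (TensorProduct.map (pair s) (pair t)
      (TensorProduct.tensorTensorTensorComm k H H H H (comul h ⊗ₜ[k] comul g))) := by
  induction s with
  | zero => simp
  | add x y hx hy => simp only [map_add, LinearMap.add_apply, add_mul, hx, hy,
      TensorProduct.map_add_left]
  | tmul φ ψ =>
    induction t with
    | zero => simp
    | add x y hx hy => simp only [map_add, LinearMap.add_apply, mul_add, hx, hy,
        TensorProduct.map_add_right]
    | tmul φ' ψ' =>
      rw [Algebra.TensorProduct.tmul_mul_tmul, pair_tmul, mul_apply, mul_apply]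
      generalize comul (R := k) h = u
      generalize comul (R := k) g = v
      induction u with
      | zero => simp
      | add x y hx hy => simp only [map_add, TensorProduct.add_tmul, add_mul, hx, hy]
      | tmul a b =>
        induction v with
        | zero => simp
        | add x y hx hy => simp only [map_add, TensorProduct.tmul_add, mul_add, hx, hy]
        | tmul c d =>
          simp
          ring

end finite

section weak

variable [FiniteDimensional k H]

theorem targetCounit_apply (φ : DualGroupoid k H) (h : H) :
    toDual (targetCounit k φ) h = toDual φ (targetCounit k h) := by
  have key : ∀ s : DualGroupoid k H ⊗[k] DualGroupoid k H,
      toDual (TensorProduct.lid k _ (LinearMap.rTensor _ counit (s * φ ⊗ₜ 1))) h =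
        LinearMap.mul' k k (TensorProduct.map
          (pair s ∘ₗ (TensorProduct.mk k H H).flip h) (toDual φ) (comul (R := k) (1 : H))) := by
    intro s
    induction s with
    | zero => simp
    | add x y hx hy => simp only [map_add, add_mul, hx, hy,
        LinearMap.add_apply, LinearMap.add_comp, TensorProduct.map_add_left]
    | tmul α β =>
      simp only [Algebra.TensorProduct.tmul_mul_tmul, LinearMap.rTensor_tmul,
        TensorProduct.lid_tmul, counit_apply, mul_apply, mul_one,
        map_smul,
        LinearMap.smul_apply, smul_eq_mul]
      generalize comul (R := k) (1 : H) = u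
      induction u with
      | zero => simp
      | add x y hx hy => simp only [map_add, add_mul, hx, hy]
      | tmul a b => simp; ring
  rw [_root_.targetCounit_apply, key, _root_.targetCounit_apply]
  generalize comul (R := k) (1 : H) = u
  induction u with
  | zero => simp
  | add x y hx hy => simp only [map_add, add_mul, hx, hy]
  | tmul a b => simp [pair_comul, one_apply]

theorem sourceCounit_apply (φ : DualGroupoid k H) (h : H) :
    toDual (sourceCounit k φ) h = toDual φ (sourceCounit k h) := by
  have key : ∀ s : DualGroupoid k H ⊗[k] DualGroupoid k H,
      toDual (TensorProduct.rid k _ (LinearMap.lTensor _ counit (1 ⊗ₜ φ * s))) h =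
        LinearMap.mul' k k (TensorProduct.map (toDual φ)
          (pair s ∘ₗ TensorProduct.mk k H H h) (comul (R := k) (1 : H))) := by
    intro s
    induction s with
    | zero => simp
    | add x y hx hy => simp only [map_add, mul_add, hx, hy,
        LinearMap.add_apply, LinearMap.add_comp, TensorProduct.map_add_right]
    | tmul α β =>
      simp only [Algebra.TensorProduct.tmul_mul_tmul, LinearMap.lTensor_tmul,
        TensorProduct.rid_tmul, counit_apply, mul_apply, one_mul,
        map_smul,
        LinearMap.smul_apply, smul_eq_mul]
      generalize comul (R := k) (1 : H) = u
      induction u with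
      | zero => simp
      | add x y hx hy => simp only [map_add, add_mul, hx, hy]
      | tmul a b => simp; ring
  rw [_root_.sourceCounit_apply, key, _root_.sourceCounit_apply]
  generalize comul (R := k) (1 : H) = u
  induction u with
  | zero => simp
  | add x y hx hy => simp only [map_add, mul_add, hx, hy]
  | tmul a b => simp [pair_comul, one_apply, mul_comm]

variable (k H) in
/-- The antipode `φ ↦ φ ∘ S` of `H*`. -/
noncomputable def antipodeMap [WeakHopfAlgebra k H] : DualGroupoid k H →ₗ[k] DualGroupoid k H :=
  toDual.symm.toLinearMap ∘ₗ
    LinearMap.lcomp k k (WeakHopfAlgebra.antipode (k := k) (H := H)) ∘ₗ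
    toDual.toLinearMap

@[simp] theorem antipodeMap_apply [WeakHopfAlgebra k H] (φ : DualGroupoid k H) (h : H) :
    toDual (antipodeMap k H φ) h = toDual φ (WeakHopfAlgebra.antipode (k := k) h) := rfl

theorem mul'_map_apply (f g : DualGroupoid k H →ₗ[k] DualGroupoid k H) (f' g' : H →ₗ[k] H)
    (hf : ∀ φ h, toDual (f φ) h = toDual φ (f' h)) (hg : ∀ φ h, toDual (g φ) h = toDual φ (g' h))
    (t : DualGroupoid k H ⊗[k] DualGroupoid k H) (h : H) :
    toDual (LinearMap.mul' k _ (TensorProduct.map f g t)) h =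
      pair t (TensorProduct.map f' g' (comul h)) := by
  induction t with
  | zero => simp
  | add x y hx hy => simp only [map_add, LinearMap.add_apply, hx, hy]
  | tmul φ ψ =>
    rw [TensorProduct.map_tmul, LinearMap.mul'_apply, mul_apply]
    generalize comul (R := k) h = u
    induction u with
    | zero => simp
    | add x y hx hy => simp only [map_add, hx, hy]
    | tmul a b => simp [hf, hg]

theorem map_rTensor_apply {V W : Type*} [AddCommGroup V] [Module k V] [AddCommGroup W] [Module k W]
    {X Y : Type*} [AddCommGroup X] [Module k X] [AddCommGroup Y] [Module k Y]
    (f : W →ₗ[k] X) (c : V →ₗ[k] W) (g : V →ₗ[k] Y) (t : V ⊗[k] V) :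
    TensorProduct.map f g (LinearMap.rTensor V c t) = TensorProduct.map (f ∘ₗ c) g t := by
  rw [LinearMap.rTensor, ← LinearMap.comp_apply, ← TensorProduct.map_comp, LinearMap.comp_id]

theorem mul_mul_one (φ ψ χ : DualGroupoid k H) : counit (R := k) (φ * ψ * χ) =
    LinearMap.mul' k k (TensorProduct.map
      (LinearMap.mul' k k ∘ₗ TensorProduct.map (toDual φ) (toDual ψ)) (toDual χ)
      (LinearMap.rTensor H comul (comul (R := k) (1 : H)))) := by
  rw [map_rTensor_apply]
  rfl

theorem counit_mulLeft_mulRight (φ χ : DualGroupoid k H) (S : Finset (H × H))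
    (hS : comul (R := k) (1 : H) = ∑ i ∈ S, i.1 ⊗ₜ i.2)
    (t : DualGroupoid k H ⊗[k] DualGroupoid k H) :
    LinearMap.mul' k k (TensorProduct.map (counit ∘ₗ LinearMap.mulLeft k φ)
      (counit ∘ₗ LinearMap.mulRight k χ) t) =
    ∑ i ∈ S, ∑ j ∈ S, toDual φ i.1 * pair t (i.2 ⊗ₜ j.1) * toDual χ j.2 := by
  induction t with
  | zero => simp
  | add x y hx hy => simp only [map_add, LinearMap.add_apply, mul_add, add_mul, hx, hy,
      Finset.sum_add_distrib]
  | tmul α β =>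
    simp only [TensorProduct.map_tmul, LinearMap.mul'_apply, LinearMap.comp_apply,
      LinearMap.mulLeft_apply, LinearMap.mulRight_apply, counit_apply, mul_apply, hS, map_sum,
      pair_tmul, Finset.sum_mul_sum]
    exact Finset.sum_congr rfl fun i _ => Finset.sum_congr rfl fun j _ => by ring

theorem counit_mulRight_mulLeft (φ χ : DualGroupoid k H) (S : Finset (H × H))
    (hS : comul (R := k) (1 : H) = ∑ i ∈ S, i.1 ⊗ₜ i.2)
    (t : DualGroupoid k H ⊗[k] DualGroupoid k H) :
    LinearMap.mul' k k (TensorProduct.map (counit ∘ₗ LinearMap.mulRight k χ)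
      (counit ∘ₗ LinearMap.mulLeft k φ) t) =
    ∑ i ∈ S, ∑ j ∈ S, toDual φ j.1 * pair t (i.1 ⊗ₜ j.2) * toDual χ i.2 := by
  induction t with
  | zero => simp
  | add x y hx hy => simp only [map_add, LinearMap.add_apply, mul_add, add_mul, hx, hy,
      Finset.sum_add_distrib]
  | tmul α β =>
    simp only [TensorProduct.map_tmul, LinearMap.mul'_apply, LinearMap.comp_apply,
      LinearMap.mulLeft_apply, LinearMap.mulRight_apply, counit_apply, mul_apply, hS, map_sum,
      pair_tmul, Finset.sum_mul_sum]
    exact Finset.sum_congr rfl fun i _ => Finset.sum_congr rfl fun j _ => by ring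

theorem pair₃_mul (s t : DualGroupoid k H ⊗[k] DualGroupoid k H) (h g f : H) :
    pair₃ ((s ⊗ₜ[k] (1 : DualGroupoid k H)) *
      (TensorProduct.assoc k _ _ _).symm ((1 : DualGroupoid k H) ⊗ₜ[k] t)) ((h ⊗ₜ g) ⊗ₜ f) =
      LinearMap.mul' k k (TensorProduct.map (pair s ∘ₗ TensorProduct.mk k H H h)
        (pair t ∘ₗ (TensorProduct.mk k H H).flip f) (comul g)) := by
  induction s with
  | zero => simp
  | add x y hx hy => simp only [map_add, TensorProduct.add_tmul, add_mul, hx, hy,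
      LinearMap.add_apply, LinearMap.add_comp, TensorProduct.map_add_left]
  | tmul α β =>
    induction t with
    | zero => simp
    | add x y hx hy => simp only [map_add, TensorProduct.tmul_add, mul_add, hx, hy,
        LinearMap.add_apply, LinearMap.add_comp, TensorProduct.map_add_right]
    | tmul γ δ =>
      simp only [TensorProduct.assoc_symm_tmul, Algebra.TensorProduct.tmul_mul_tmul, mul_one,
        one_mul, pair₃_tmul, pair_tmul, mul_apply]
      generalize comul (R := k) g = u
      induction u with
      | zero => simp
      | add x y hx hy => simp only [map_add, mul_add, add_mul, hx, hy]
      | tmul a b => simp; ring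

theorem pair₃_mul' (s t : DualGroupoid k H ⊗[k] DualGroupoid k H) (h g f : H) :
    pair₃ ((TensorProduct.assoc k _ _ _).symm ((1 : DualGroupoid k H) ⊗ₜ[k] t) *
      (s ⊗ₜ[k] (1 : DualGroupoid k H))) ((h ⊗ₜ g) ⊗ₜ f) =
      LinearMap.mul' k k (TensorProduct.map (pair t ∘ₗ (TensorProduct.mk k H H).flip f)
        (pair s ∘ₗ TensorProduct.mk k H H h) (comul g)) := by
  induction s with
  | zero => simp
  | add x y hx hy => simp only [map_add, TensorProduct.add_tmul, mul_add, hx, hy,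
      LinearMap.add_apply, LinearMap.add_comp, TensorProduct.map_add_right]
  | tmul α β =>
    induction t with
    | zero => simp
    | add x y hx hy => simp only [map_add, TensorProduct.tmul_add, add_mul, hx, hy,
        LinearMap.add_apply, LinearMap.add_comp, TensorProduct.map_add_left]
    | tmul γ δ =>
      simp only [TensorProduct.assoc_symm_tmul, Algebra.TensorProduct.tmul_mul_tmul, mul_one,
        one_mul, pair₃_tmul, pair_tmul, mul_apply]
      generalize comul (R := k) g = u
      induction u with
      | zero => simp
      | add x y hx hy => simp only [map_add, mul_add, add_mul, hx, hy]
      | tmul a b => simp; ring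

theorem pair_comul_one_mk (h : H) :
    pair (comul (R := k) (1 : DualGroupoid k H)) ∘ₗ TensorProduct.mk k H H h =
      counit ∘ₗ LinearMap.mulLeft k h := by
  ext g
  simp [pair_comul, one_apply]

theorem pair_comul_one_flip (f : H) :
    pair (comul (R := k) (1 : DualGroupoid k H)) ∘ₗ (TensorProduct.mk k H H).flip f =
      counit ∘ₗ LinearMap.mulRight k f := by
  ext g
  simp [pair_comul, one_apply]

noncomputable instance [WeakHopfAlgebra k H] : WeakHopfAlgebra k (DualGroupoid k H) where
  comul_mul φ ψ := by
    refine pair_ext fun h g => ?_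
    rw [pair_comul, LinearMap.mul'_apply, mul_apply, WeakHopfAlgebra.comul_mul, pair_mul]
    generalize comul (R := k) h = u
    generalize comul (R := k) g = v
    induction u with
    | zero => simp
    | add x y hx hy => simp only [map_add, TensorProduct.add_tmul, add_mul, hx, hy]
    | tmul a b =>
      induction v with
      | zero => simp
      | add x y hx hy => simp only [map_add, TensorProduct.tmul_add, mul_add, hx, hy]
      | tmul c d => simp [pair_comul]
  counit_mul_mul φ ψ χ := by
    obtain ⟨S, hS⟩ := TensorProduct.exists_finset (comul (R := k) (1 : H))
    rw [counit_mulLeft_mulRight φ χ S hS, mul_mul_one, WeakHopfAlgebra.comul_one, hS]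
    simp [TensorProduct.sum_tmul, TensorProduct.tmul_sum, Finset.sum_mul_sum, pair_comul]
  counit_mul_mul' φ ψ χ := by
    obtain ⟨S, hS⟩ := TensorProduct.exists_finset (comul (R := k) (1 : H))
    rw [counit_mulRight_mulLeft φ χ S hS, mul_mul_one, WeakHopfAlgebra.comul_one', hS]
    simp [TensorProduct.sum_tmul, TensorProduct.tmul_sum, Finset.sum_mul_sum, pair_comul]
  comul_one := by
    refine pair₃_ext fun h g f => ?_
    rw [pair₃_mul, pair_comul_one_mk, pair_comul_one_flip, ← WeakHopfAlgebra.counit_mul_mul]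
    refine (pair₃_rTensor _ _ _).trans ?_
    simp [pair_comul, one_apply]
  comul_one' := by
    refine pair₃_ext fun h g f => ?_
    rw [pair₃_mul', pair_comul_one_mk, pair_comul_one_flip, ← WeakHopfAlgebra.counit_mul_mul']
    refine (pair₃_rTensor _ _ _).trans ?_
    simp [pair_comul, one_apply]
  antipode := antipodeMap k H
  mul_lTensor_antipode φ := by
    ext h
    rw [LinearMap.lTensor, mul'_map_apply LinearMap.id (antipodeMap k H) LinearMap.id
      WeakHopfAlgebra.antipode (fun _ _ => rfl) (fun _ _ => rfl), pair_comul,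
      ← LinearMap.lTensor, WeakHopfAlgebra.mul_lTensor_antipode, targetCounit_apply]
  mul_rTensor_antipode φ := by
    ext h
    rw [LinearMap.rTensor, mul'_map_apply (antipodeMap k H) LinearMap.id
      WeakHopfAlgebra.antipode LinearMap.id (fun _ _ => rfl) (fun _ _ => rfl), pair_comul,
      ← LinearMap.rTensor, WeakHopfAlgebra.mul_rTensor_antipode, sourceCounit_apply]
  antipode_mul_antipode φ := by
    ext h
    rw [map_rTensor_apply, mul'_map_apply _ _
      ((LinearMap.mul' k H ∘ₗ LinearMap.rTensor H WeakHopfAlgebra.antipode) ∘ₗ comul)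
      WeakHopfAlgebra.antipode (fun φ h => ?_) (fun _ _ => rfl), pair_comul, ← map_rTensor_apply,
      WeakHopfAlgebra.antipode_mul_antipode, antipodeMap_apply]
    rw [LinearMap.comp_apply, LinearMap.comp_apply, LinearMap.rTensor,
      mul'_map_apply (antipodeMap k H) LinearMap.id
      WeakHopfAlgebra.antipode LinearMap.id (fun _ _ => rfl) (fun _ _ => rfl), pair_comul]
    rfl

theorem smul_mul_aux (t : DualGroupoid k H ⊗[k] DualGroupoid k H) (h g : H) :
    LinearMap.mul' k H (TensorProduct.map
      ((LinearMap.toSpanSingleton (DualGroupoid k H) H h).restrictScalars k)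
      ((LinearMap.toSpanSingleton (DualGroupoid k H) H g).restrictScalars k) t) =
    TensorProduct.rid k H (TensorProduct.map (LinearMap.mul' k H) (pair t)
      (TensorProduct.tensorTensorTensorComm k H H H H (comul h ⊗ₜ[k] comul g))) := by
  induction t with
  | zero => simp
  | add x y hx hy => simp only [map_add, LinearMap.add_apply, TensorProduct.map_add_right, hx, hy]
  | tmul α β =>
    simp only [TensorProduct.map_tmul, LinearMap.restrictScalars_apply,
      LinearMap.toSpanSingleton_apply, LinearMap.mul'_apply, smul_def]
    generalize comul (R := k) h = u
    generalize comul (R := k) g = v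
    induction u with
    | zero => simp
    | add x y hx hy => simp only [map_add, TensorProduct.add_tmul, add_mul, hx, hy]
    | tmul a b =>
      induction v with
      | zero => simp
      | add x y hx hy => simp only [map_add, TensorProduct.tmul_add, mul_add, hx, hy]
      | tmul c d => simp [smul_smul, mul_comm]

/-- With this action, `H` is a left `H*`-module algebra. -/
instance [WeakHopfAlgebra k H] : WeakModuleAlgebra k (DualGroupoid k H) H where
  smul_mul φ h g := by
    rw [smul_mul_aux, smul_def, WeakHopfAlgebra.comul_mul]
    generalize comul (R := k) h = u
    generalize comul (R := k) g = v
    induction u with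
    | zero => simp
    | add x y hx hy => simp only [map_add, TensorProduct.add_tmul, add_mul, hx, hy]
    | tmul a b =>
      induction v with
      | zero => simp
      | add x y hx hy => simp only [map_add, TensorProduct.tmul_add, mul_add, hx, hy]
      | tmul c d => simp [pair_comul]
  smul_one φ := by
    have h1 : ∀ t : H ⊗[k] H, LinearMap.lTensor H (toDual (targetCounit k φ)) t =
        LinearMap.lTensor H (toDual φ) (LinearMap.lTensor H (targetCounit k) t) := by
      intro t
      rw [← LinearMap.lTensor_comp_apply]
      congr 2
      ext h
      exact targetCounit_apply φ h
    rw [smul_def, smul_def, h1, WeakHopfAlgebra.lTensor_targetCounit_comul_one]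

end weak

end DualGroupoid

/-! ### Convolution of linear maps -/

/-! An element x # φ acts on H by h ↦ x(φ ⇀ h) = x h₁ φ(h₂). These maps commute with right
multiplication by H_t because Δ(hz) = Δ(h)(z ⊗ 1) for z in H_t, and the action is multiplicative by
the module algebra axiom. In finite dimension H ⊗ H* is the space of all linear maps H → H, a map f
corresponding to ∑ f(bⱼ) ⊗ bʲ, and in these terms the action sends f to h ↦ f(h₂)h₁. If the antipode
is invertible, the inverse is T ↦ (h ↦ T(h₂)S⁻¹(h₁)). In one order the composite contains S⁻¹(h₂)h₁,
an element of H_t which can be moved inside T (`actionEnd_surjective`). In the other order it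
contains h₂S⁻¹(h₁) = 1₁ε(1₂h), and the original tensor comes back modulo the relations defining the
relative tensor product (`mkQ_ofLinearMap_actionAux`).

So the isomorphism rests on the bijectivity of S (`antipode_injective`). Uniqueness of generalized
inverses for convolution shows that S is anti-multiplicative (`antipode_mul`); the same statement
for H* shows that S is anti-comultiplicative (`comul_antipode`). Now consider the trace forms λ_f(x)
= Tr(h ↦ xS²(h₁)f(h₂)). Cyclicity of the trace gives the integral identity λ_f(g(x₁)x₂S(c)) =
λ_f(xS(c₁))g(c₂) (`traceIntegral_leftTrans_mul_antipode`), and there are enough of these forms to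
recover every linear form (`sum_traceIntegral`).

Let J be the ideal of those z in H_t with λ_{f(z ·)} = 0 for all f. Since H_t is separable, J is
generated by a central idempotent e with S²(e) = e (`exists_central_idempotent`). Stability of J
under the adjoint action gives ce = ece for all c in H, and the recovery formula then forces S(e) =
0, hence J = 0 (`integralAnnihilator_eq_bot`). If S(a) = 0, the integral identity places the
S²-preimages in H_t of all coefficients ε_t(a₁)g(a₂) in J; so these coefficients vanish, and a =
ε_t(a₁)a₂ = 0.

For semisimplicity, the separability idempotent S(1₁) ⊗ 1₂ of H_t averages linear projections to
H_t-linear ones. Thus H is a finitely generated semisimple H_t-module, and its endomorphism ring is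
semisimple. -/

section Convolution

variable {k C D A B : Type*} [Field k] [AddCommGroup C] [Module k C] [Coalgebra k C]
  [AddCommGroup D] [Module k D] [Coalgebra k D]
  [Ring A] [Algebra k A] [Ring B] [Algebra k B]

/-- The convolution product `(f ⋆ g)(c) = f(c₁) g(c₂)` of linear maps from a coalgebra to an
algebra. -/
noncomputable def conv (f g : C →ₗ[k] A) : C →ₗ[k] A :=
  LinearMap.mul' k A ∘ₗ TensorProduct.map f g ∘ₗ comul

local infixl:70 " ⋆ " => conv

theorem conv_apply (f g : C →ₗ[k] A) (c : C) :
    (f ⋆ g) c = LinearMap.mul' k A (TensorProduct.map f g (comul c)) := rfl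

/-- `conv` is by definition the product of `WithConv`, whose ring structure supplies associativity.
-/
theorem conv_assoc (f g h : C →ₗ[k] A) : f ⋆ g ⋆ h = f ⋆ (g ⋆ h) :=
  congrArg WithConv.ofConv
    (mul_assoc (WithConv.toConv f) (WithConv.toConv g) (WithConv.toConv h))

theorem comp_conv (φ : A →ₗ[k] B) (hφ : ∀ a b, φ (a * b) = φ a * φ b) (f g : C →ₗ[k] A) :
    φ ∘ₗ (f ⋆ g) = (φ ∘ₗ f) ⋆ (φ ∘ₗ g) := by
  ext c
  simp only [conv, LinearMap.comp_apply]
  generalize comul (R := k) c = t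
  induction t with
  | zero => simp
  | add x y hx hy => simp only [map_add, hx, hy]
  | tmul a b => simp [hφ]

theorem conv_comp (π : D →ₗ[k] C) (hπ : ∀ d, comul (π d) = TensorProduct.map π π (comul (R := k) d))
    (f g : C →ₗ[k] A) : (f ⋆ g) ∘ₗ π = (f ∘ₗ π) ⋆ (g ∘ₗ π) := by
  ext d
  simp only [conv, LinearMap.comp_apply, hπ]
  generalize comul (R := k) d = t
  induction t with
  | zero => simp
  | add x y hx hy => simp only [map_add, hx, hy]
  | tmul a b => simp

theorem mulLeft_conv (a : A) (f g : C →ₗ[k] A) :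
    (LinearMap.mulLeft k a ∘ₗ f) ⋆ g = LinearMap.mulLeft k a ∘ₗ (f ⋆ g) := by
  ext d
  simp only [conv, LinearMap.comp_apply]
  generalize comul (R := k) d = t
  induction t with
  | zero => simp
  | add x y hx hy => simp only [map_add, hx, hy]
  | tmul a b => simp [mul_assoc]

theorem conv_mulRight (a : A) (f g : C →ₗ[k] A) :
    f ⋆ (LinearMap.mulRight k a ∘ₗ g) = LinearMap.mulRight k a ∘ₗ (f ⋆ g) := by
  ext d
  simp only [conv, LinearMap.comp_apply]
  generalize comul (R := k) d = t
  induction t with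
  | zero => simp
  | add x y hx hy => simp only [map_add, hx, hy]
  | tmul a b => simp [mul_assoc]

variable (k A) in
/-- The map `a ↦ a ⊗ 1`. -/
noncomputable def inl : A →ₗ[k] A ⊗[k] A := (TensorProduct.mk k A A).flip 1

variable (k A) in
/-- The map `a ↦ 1 ⊗ a`. -/
noncomputable def inr : A →ₗ[k] A ⊗[k] A := TensorProduct.mk k A A 1

@[simp] theorem inl_apply (a : A) : inl k A a = a ⊗ₜ 1 := rfl

@[simp] theorem inr_apply (a : A) : inr k A a = 1 ⊗ₜ a := rfl

theorem inl_mul (a b : A) : inl k A (a * b) = inl k A a * inl k A b := by simp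

theorem inr_mul (a b : A) : inr k A (a * b) = inr k A a * inr k A b := by simp

/-- In particular Δ = `inl` ⋆ `inr`, so identities for Δ inside H ⊗ H reduce to associativity of ⋆.
-/
theorem inl_conv_inr (f g : C →ₗ[k] A) :
    (inl k A ∘ₗ f) ⋆ (inr k A ∘ₗ g) = TensorProduct.map f g ∘ₗ comul := by
  ext d
  simp only [conv, LinearMap.comp_apply]
  generalize comul (R := k) d = t
  induction t with
  | zero => simp
  | add x y hx hy => simp only [map_add, hx, hy]
  | tmul a b => simp

theorem inr_conv_inl (f g : C →ₗ[k] A) :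
    (inr k A ∘ₗ f) ⋆ (inl k A ∘ₗ g) =
      TensorProduct.map g f ∘ₗ (TensorProduct.comm k C C).toLinearMap ∘ₗ comul := by
  ext d
  simp only [conv, LinearMap.comp_apply]
  generalize comul (R := k) d = t
  induction t with
  | zero => simp
  | add x y hx hy => simp only [map_add, hx, hy]
  | tmul a b => simp

end Convolution

namespace WeakHopfAlgebra

variable {k H : Type*} [Field k] [Ring H] [Algebra k H] [Coalgebra k H] [WeakHopfAlgebra k H]

local infixl:70 " ⋆ " => conv

/-! ### The counital maps -/

section counital

variable (k) in
theorem comul_one_mul_self :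
    comul (R := k) (1 : H) * comul (R := k) (1 : H) = comul (R := k) (1 : H) := by
  rw [← comul_mul, one_mul]

/-- With 1 in the middle, the second weak multiplicativity axiom reads ε(xg) = ε(x1₂)ε(1₁g), and
ε_t(g) = ε(1₁g)1₂. -/
theorem counit_mul_targetCounit (x g : H) :
    counit (R := k) (x * targetCounit k g) = counit (R := k) (x * g) := by
  have h2 := counit_mul_mul' (k := k) x 1 g
  rw [mul_one] at h2
  rw [h2, targetCounit_apply]
  generalize comul (R := k) (1 : H) = s
  induction s with
  | zero => simp
  | add x y hx hy => simp only [map_add, hx, hy, add_mul, mul_add]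
  | tmul c d => simp

theorem counit_sourceCounit_mul (x g : H) :
    counit (R := k) (sourceCounit k g * x) = counit (R := k) (g * x) := by
  have h2 := counit_mul_mul' (k := k) g 1 x
  rw [mul_one] at h2
  rw [h2, sourceCounit_apply]
  generalize comul (R := k) (1 : H) = s
  induction s with
  | zero => simp
  | add x y hx hy => simp only [map_add, hx, hy, add_mul, mul_add]
  | tmul c d => simp [mul_comm]

theorem targetCounit_mul_targetCounit (g h : H) :
    targetCounit k (g * targetCounit k h) = targetCounit k (g * h) := by
  have h2 : ∀ s : H ⊗[k] H, LinearMap.rTensor H (counit (R := k))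
      (s * (g * targetCounit k h) ⊗ₜ 1) =
      LinearMap.rTensor H counit (s * (g * h) ⊗ₜ 1) := by
    intro s
    induction s with
    | zero => simp
    | add x y hx hy => simp only [map_add, hx, hy, add_mul]
    | tmul c d => simp [counit_mul_targetCounit, ← mul_assoc]
  rw [targetCounit_apply, h2, ← targetCounit_apply]

theorem sourceCounit_sourceCounit_mul (g h : H) :
    sourceCounit k (sourceCounit k g * h) = sourceCounit k (g * h) := by
  have h2 : ∀ s : H ⊗[k] H, LinearMap.lTensor H (counit (R := k))
      (1 ⊗ₜ (sourceCounit k g * h) * s) =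
      LinearMap.lTensor H counit (1 ⊗ₜ (g * h) * s) := by
    intro s
    induction s with
    | zero => simp
    | add x y hx hy => simp only [map_add, hx, hy, mul_add]
    | tmul c d => simp [counit_sourceCounit_mul, mul_assoc]
  rw [sourceCounit_apply, h2, ← sourceCounit_apply]

variable (k) in
theorem sourceCounit_idem (h : H) : sourceCounit k (sourceCounit k h) = sourceCounit k h := by
  simpa using sourceCounit_sourceCounit_mul (k := k) h 1

variable (k) in
theorem targetCounit_one : targetCounit k (1 : H) = 1 := by
  rw [targetCounit_apply, ← Algebra.TensorProduct.one_def, mul_one]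
  simp

variable (k) in
theorem sourceCounit_one : sourceCounit k (1 : H) = 1 := by
  rw [sourceCounit_apply, ← Algebra.TensorProduct.one_def, one_mul]
  simp

/-- `(id ⊗ ε ⊗ id)(Δ ⊗ id) = id` -/
theorem rTensor_counit_rTensor_comul (t : H ⊗[k] H) :
    LinearMap.rTensor H ((TensorProduct.rid k H).toLinearMap ∘ₗ LinearMap.lTensor H counit)
      (LinearMap.rTensor H comul t) = t := by
  induction t with
  | zero => simp
  | add x y hx hy => simp only [map_add, hx, hy]
  | tmul a b => simp

theorem rTensor_comul_mul (t : H ⊗[k] H) (h : H) :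
    LinearMap.rTensor H comul (t * h ⊗ₜ 1) =
      LinearMap.rTensor H comul t * comul h ⊗ₜ[k] (1 : H) := by
  induction t with
  | zero => simp
  | add x y hx hy => simp only [map_add, add_mul, hx, hy]
  | tmul a b => simp [comul_mul]

/-- `h₁ ⊗ ε_t(h₂) = 1₁h ⊗ 1₂` -/
theorem lTensor_targetCounit_comul (h : H) :
    LinearMap.lTensor H (targetCounit k) (comul (R := k) h) = comul (R := k) (1 : H) * h ⊗ₜ 1 := by
  have h3 : ∀ s t : H ⊗[k] H, LinearMap.rTensor H ((TensorProduct.rid k H).toLinearMap ∘ₗ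
      LinearMap.lTensor H counit) ((TensorProduct.assoc k H H H).symm (1 ⊗ₜ s) * t ⊗ₜ[k] (1 : H)) =
      LinearMap.lTensor H ((TensorProduct.lid k H).toLinearMap ∘ₗ LinearMap.rTensor H counit ∘ₗ
        LinearMap.mulLeft k s ∘ₗ (TensorProduct.mk k H H).flip 1) t := by
    intro s t
    induction t with
    | zero => simp
    | add x y hx hy => simp only [map_add, TensorProduct.add_tmul, mul_add, hx, hy]
    | tmul a b =>
      induction s with
      | zero => simp
      | add x y hx hy =>
        rw [TensorProduct.tmul_add, map_add, add_mul, map_add, hx, hy]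
        simp [add_mul, TensorProduct.tmul_add]
      | tmul c d => simp [TensorProduct.smul_tmul']
  have h4 := h3 (comul (R := k) (1 : H)) (comul (R := k) h)
  -- Writing Δ(h) = Δ(1)Δ(h) produces (1 ⊗ Δ(1))(Δ(1) ⊗ 1) = (Δ ⊗ id)Δ(1), so the left side of `h4`
  -- becomes id ⊗ ε ⊗ id applied to (Δ ⊗ id)(Δ(1)(h ⊗ 1)).
  have h5 : comul (R := k) h ⊗ₜ[k] (1 : H) =
      comul (R := k) (1 : H) ⊗ₜ[k] (1 : H) * comul (R := k) h ⊗ₜ[k] (1 : H) := by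
    rw [Algebra.TensorProduct.tmul_mul_tmul, ← comul_mul, one_mul, one_mul]
  rw [h5, ← mul_assoc, ← comul_one', ← rTensor_comul_mul, rTensor_counit_rTensor_comul] at h4
  exact h4.symm

theorem mul_lTensor_comul (t : H ⊗[k] H) (h : H) :
    LinearMap.lTensor H comul ((1 : H) ⊗ₜ h * t) =
      (1 : H) ⊗ₜ[k] comul h * LinearMap.lTensor H comul t := by
  induction t with
  | zero => simp
  | add x y hx hy => simp only [map_add, mul_add, hx, hy]
  | tmul a b => simp [comul_mul]

/-- `ε_s(h₁) ⊗ h₂ = 1₁ ⊗ h1₂` -/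
theorem rTensor_sourceCounit_comul (h : H) :
    LinearMap.rTensor H (sourceCounit k) (comul (R := k) h) = 1 ⊗ₜ h * comul (R := k) (1 : H) := by
  have h3 : ∀ s t : H ⊗[k] H, LinearMap.lTensor H ((TensorProduct.lid k H).toLinearMap ∘ₗ
      LinearMap.rTensor H counit)
        ((1 : H) ⊗ₜ[k] t * TensorProduct.assoc k H H H (s ⊗ₜ[k] (1 : H))) =
      LinearMap.rTensor H ((TensorProduct.rid k H).toLinearMap ∘ₗ LinearMap.lTensor H counit ∘ₗ
        LinearMap.mulRight k s ∘ₗ TensorProduct.mk k H H 1) t := by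
    intro s t
    induction t with
    | zero => simp
    | add x y hx hy => simp only [map_add, TensorProduct.tmul_add, add_mul, hx, hy]
    | tmul a b =>
      induction s with
      | zero => simp
      | add x y hx hy =>
        rw [TensorProduct.add_tmul, map_add, mul_add, map_add, hx, hy]
        simp [mul_add, TensorProduct.add_tmul]
      | tmul c d => simp [TensorProduct.smul_tmul']
  have h4 := h3 (comul (R := k) (1 : H)) (comul (R := k) h)
  have h5 : (1 : H) ⊗ₜ[k] comul (R := k) h =
      (1 : H) ⊗ₜ[k] comul (R := k) h * (1 : H) ⊗ₜ[k] comul (R := k) (1 : H) := by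
    rw [Algebra.TensorProduct.tmul_mul_tmul, ← comul_mul, mul_one, mul_one]
  -- The reassociated form of `comul_one'`: here the comultiplication has to act on the second leg.
  have h6 : LinearMap.lTensor H comul (comul (R := k) (1 : H)) =
      (1 : H) ⊗ₜ[k] comul (R := k) (1 : H) *
        TensorProduct.assoc k H H H (comul (R := k) (1 : H) ⊗ₜ[k] (1 : H)) := by
    have h7 := congrArg (Algebra.TensorProduct.assoc k k k H H H) (comul_one' (k := k) (H := H))
    rw [map_mul] at h7
    rw [← coassoc_apply]
    refine Eq.trans h7 ?_
    congr 1
    exact (TensorProduct.assoc k H H H).apply_symm_apply _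
  have h8 : ∀ t : H ⊗[k] H, LinearMap.lTensor H ((TensorProduct.lid k H).toLinearMap ∘ₗ
      LinearMap.rTensor H counit) (LinearMap.lTensor H comul t) = t := by
    intro t
    induction t with
    | zero => simp
    | add x y hx hy => simp only [map_add, hx, hy]
    | tmul a b => simp
  rw [h5, mul_assoc, ← h6, ← mul_lTensor_comul, h8] at h4
  exact h4.symm

variable (k) in
theorem rTensor_sourceCounit_comul_one :
    LinearMap.rTensor H (sourceCounit k) (comul (R := k) (1 : H)) = comul (R := k) (1 : H) := by
  rw [rTensor_sourceCounit_comul, ← Algebra.TensorProduct.one_def, one_mul]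

end counital

end WeakHopfAlgebra

namespace WeakHopfAlgebra

variable {k H : Type*} [Field k] [Ring H] [Algebra k H] [Coalgebra k H] [WeakHopfAlgebra k H]

local infixl:70 " ⋆ " => conv

local notation "𝒮" => antipode (k := k) (H := H)

/-! ### The counital subalgebras -/

section subalgebras

/-- Comultiplying y = 1₁ε(y1₂) gives Δ(y) = 1₁ ⊗ 1₂ε(y1₃). The two product forms of (Δ ⊗ id)Δ(1)
then yield `comul_of_source` and `comul_of_source'`. -/
theorem comul_of_source_aux {y : H} (hy : sourceCounit k y = y) :
    comul (R := k) y = TensorProduct.rid k (H ⊗[k] H) (LinearMap.lTensor (H ⊗[k] H)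
        (counit ∘ₗ LinearMap.mulLeft k y)
        (LinearMap.rTensor H comul (comul (R := k) (1 : H)))) := by
  have key : ∀ t : H ⊗[k] H,
    comul (R := k) (TensorProduct.rid k H (LinearMap.lTensor H counit (1 ⊗ₜ y * t))) =
      TensorProduct.rid k (H ⊗[k] H) (LinearMap.lTensor (H ⊗[k] H)
        (counit ∘ₗ LinearMap.mulLeft k y) (LinearMap.rTensor H comul t)) := by
    intro t
    induction t with
    | zero => simp
    | add x y hx hy => simp only [map_add, mul_add, hx, hy]
    | tmul a b => simp
  rw [← key, ← sourceCounit_apply, hy]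

theorem comul_of_source {y : H} (hy : sourceCounit k y = y) :
    comul (R := k) y = 1 ⊗ₜ y * comul (R := k) (1 : H) := by
  have key : ∀ s t : H ⊗[k] H, TensorProduct.rid k (H ⊗[k] H) (LinearMap.lTensor (H ⊗[k] H)
      (counit ∘ₗ LinearMap.mulLeft k y)
        ((TensorProduct.assoc k H H H).symm (1 ⊗ₜ s) * t ⊗ₜ[k] (1 : H))) =
      1 ⊗ₜ (TensorProduct.rid k H (LinearMap.lTensor H counit (1 ⊗ₜ y * s))) * t := by
    intro s t
    induction t with
    | zero => simp
    | add x y hx hy => simp only [map_add, TensorProduct.add_tmul, mul_add, hx, hy]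
    | tmul a b =>
      induction s with
      | zero => simp
      | add x y hx hy => simp only [map_add, TensorProduct.tmul_add, add_mul, mul_add, hx, hy]
      | tmul c d => simp
  rw [comul_of_source_aux hy, comul_one', key, ← sourceCounit_apply, hy]

theorem comul_of_source' {y : H} (hy : sourceCounit k y = y) :
    comul (R := k) y = comul (R := k) (1 : H) * 1 ⊗ₜ y := by
  have key : ∀ s t : H ⊗[k] H, TensorProduct.rid k (H ⊗[k] H) (LinearMap.lTensor (H ⊗[k] H)
      (counit ∘ₗ LinearMap.mulLeft k y)
        (t ⊗ₜ[k] (1 : H) * (TensorProduct.assoc k H H H).symm (1 ⊗ₜ s))) =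
      t * 1 ⊗ₜ (TensorProduct.rid k H (LinearMap.lTensor H counit (1 ⊗ₜ y * s))) := by
    intro s t
    induction t with
    | zero => simp
    | add x y hx hy => simp only [map_add, TensorProduct.add_tmul, add_mul, hx, hy]
    | tmul a b =>
      induction s with
      | zero => simp
      | add x y hx hy => simp only [map_add, TensorProduct.tmul_add, mul_add, hx, hy]
      | tmul c d => simp
  rw [comul_of_source_aux hy, comul_one, key, ← sourceCounit_apply, hy]

theorem comul_source_mul (h : H) {y : H} (hy : sourceCounit k y = y) :
    comul (R := k) (y * h) = 1 ⊗ₜ y * comul (R := k) h := by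
  rw [comul_mul, comul_of_source hy, mul_assoc, ← comul_mul, one_mul]

theorem targetCounit_target_mul {z : H} (hz : targetCounit k z = z) (h : H) :
    targetCounit k (z * h) = z * targetCounit k h := by
  have h1 : targetCounit k (z * targetCounit k h) = z * targetCounit k h :=
    (targetSubalgebra k H).mul_mem hz (targetCounit_idem k h)
  rw [← targetCounit_mul_targetCounit, h1]

theorem source_mul_mem {x y : H} (hx : sourceCounit k x = x) (hy : sourceCounit k y = y) :
    sourceCounit k (x * y) = x * y := by
  have h1 : comul (R := k) (x * y) = 1 ⊗ₜ (x * y) * comul (R := k) (1 : H) := by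
    rw [comul_source_mul y hx, comul_of_source hy, ← mul_assoc]
    simp
  rw [sourceCounit_apply, ← h1]
  simp

theorem sourceCounit_mul_source (h : H) {y : H} (hy : sourceCounit k y = y) :
    sourceCounit k (h * y) = sourceCounit k h * y := by
  rw [← sourceCounit_sourceCounit_mul, source_mul_mem (sourceCounit_idem k h) hy]

/-- The counital subalgebras commute. -/
theorem target_mul_source {z y : H} (hz : targetCounit k z = z) (hy : sourceCounit k y = y) :
    z * y = y * z := by
  -- Both expressions for Δ(z) agree: Δ(1)(z ⊗ 1) = (z ⊗ 1)Δ(1). Applying id ⊗ ε(y ·) turns the two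
  -- sides into yz and zy.
  have h1 := (comul_of_target hz).symm.trans (comul_of_target' hz)
  have key : ∀ s : H ⊗[k] H, TensorProduct.rid k H (LinearMap.lTensor H counit
      (1 ⊗ₜ y * (s * z ⊗ₜ 1))) =
      TensorProduct.rid k H (LinearMap.lTensor H counit (1 ⊗ₜ y * s)) * z := by
    intro s
    induction s with
    | zero => simp
    | add x y hx hy => simp only [map_add, mul_add, add_mul, hx, hy]
    | tmul a b => simp
  have key' : ∀ s : H ⊗[k] H, TensorProduct.rid k H (LinearMap.lTensor H counit
      (1 ⊗ₜ y * (z ⊗ₜ 1 * s))) =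
      z * TensorProduct.rid k H (LinearMap.lTensor H counit (1 ⊗ₜ y * s)) := by
    intro s
    induction s with
    | zero => simp
    | add x y hx hy => simp only [map_add, mul_add, hx, hy]
    | tmul a b => simp
  have h2 := key (comul (R := k) (1 : H))
  have h3 := key' (comul (R := k) (1 : H))
  rw [← sourceCounit_apply, hy] at h2 h3
  rw [← h3, ← h1, h2]

theorem sourceCounit_mul_targetCounit (g h : H) :
    sourceCounit k g * targetCounit k h = targetCounit k h * sourceCounit k g :=
  (target_mul_source (targetCounit_idem k h) (sourceCounit_idem k g)).symm

end subalgebras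

/-! ### The antipode is an anti-homomorphism of algebras -/

section antipode

variable (k H) in
theorem id_conv_antipode : LinearMap.id ⋆ 𝒮 = targetCounit k := by
  ext h
  exact mul_lTensor_antipode h

variable (k H) in
theorem antipode_conv_id : 𝒮 ⋆ LinearMap.id = sourceCounit k := by
  ext h
  exact mul_rTensor_antipode h

variable (k H) in
-- The axiom S(h₁)h₂S(h₃) = S(h), read as (S ⋆ id) ⋆ S = S: the antipode is a generalized inverse of
-- the identity.
theorem sourceCounit_conv_antipode : sourceCounit k ⋆ 𝒮 = 𝒮 := by
  rw [← antipode_conv_id]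
  ext h
  refine Eq.trans ?_ (antipode_mul_antipode h)
  rw [conv_apply, ← LinearMap.comp_apply (f := LinearMap.rTensor H comul)]
  congr 1
  simp only [LinearMap.comp_apply]
  generalize comul (R := k) h = t
  induction t with
  | zero => simp
  | add x y hx hy => simp only [map_add, hx, hy]
  | tmul a b => simp [conv, LinearMap.rTensor]

variable (k H) in
theorem antipode_conv_targetCounit : 𝒮 ⋆ targetCounit k = 𝒮 := by
  rw [← id_conv_antipode, ← conv_assoc, antipode_conv_id, sourceCounit_conv_antipode]

variable (k H) in
theorem targetCounit_conv_id : targetCounit k ⋆ LinearMap.id = (LinearMap.id : H →ₗ[k] H) := by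
  ext h
  exact targetCounit_mul k h

variable (k H) in
theorem id_conv_sourceCounit : LinearMap.id ⋆ sourceCounit k = (LinearMap.id : H →ₗ[k] H) := by
  rw [← antipode_conv_id, ← conv_assoc, id_conv_antipode, targetCounit_conv_id]

/-- `ε_t(gh) = g₁ε_t(h)S(g₂)` -/
theorem targetCounit_mul_eq (g h : H) :
    targetCounit k (g * h) = (LinearMap.id ⋆ (LinearMap.mulLeft k (targetCounit k h) ∘ₗ 𝒮)) g := by
  -- Replacing h by ε_t(h) does not change the left side and makes Δ(gε_t(h)) = Δ(g)(ε_t(h) ⊗ 1)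
  -- available.
  rw [← targetCounit_mul_targetCounit, conv_apply, ← mul_lTensor_antipode (g * _),
    comul_mul_target g (targetCounit_idem k h)]
  generalize comul (R := k) g = t
  induction t with
  | zero => simp
  | add x y hx hy => simp only [map_add, add_mul, hx, hy]
  | tmul a b => simp [mul_assoc]

/-- `ε_s(gh) = S(h₁)ε_s(g)h₂` -/
theorem sourceCounit_mul_eq (g h : H) :
    sourceCounit k (g * h) = (𝒮 ⋆ (LinearMap.mulLeft k (sourceCounit k g))) h := by
  rw [← sourceCounit_sourceCounit_mul, conv_apply, ← mul_rTensor_antipode (_ * h),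
    comul_source_mul h (sourceCounit_idem k g)]
  generalize comul (R := k) h = t
  induction t with
  | zero => simp
  | add x y hx hy => simp only [map_add, mul_add, hx, hy]
  | tmul a b => simp

/-! ### Convolution of maps on H ⊗ H, and anti-multiplicativity of the antipode. -/

section tensor

theorem mul'_map_counit_counit_comul (h : H) :
    LinearMap.mul' k k (TensorProduct.map counit counit (comul (R := k) h)) =
      counit (R := k) h := by
  have h1 : ∀ t : H ⊗[k] H, LinearMap.mul' k k (TensorProduct.map counit counit t) =
      counit (R := k) (TensorProduct.lid k H (LinearMap.rTensor H counit t)) := by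
    intro t
    induction t with
    | zero => simp
    | add x y hx hy => simp only [map_add, hx, hy]
    | tmul a b => simp
  rw [h1]
  simp

variable (k H) in
/-- The projection `id ⊗ ε`. -/
noncomputable def projLeft : H ⊗[k] H →ₗ[k] H :=
  (TensorProduct.rid k H).toLinearMap ∘ₗ LinearMap.lTensor H counit

variable (k H) in
/-- The projection `ε ⊗ id`. -/
noncomputable def projRight : H ⊗[k] H →ₗ[k] H :=
  (TensorProduct.lid k H).toLinearMap ∘ₗ LinearMap.rTensor H counit

variable (k H) in
-- Holds because ε(h₁)ε(h₂) = ε(h). Through `conv_comp`, identities such as id ⋆ S = ε_t can be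
-- pulled back along the projection.
theorem comul_projLeft (t : H ⊗[k] H) : comul (projLeft k H t) =
    TensorProduct.map (projLeft k H) (projLeft k H) (comul (R := k) t) := by
  induction t with
  | zero => simp
  | add x y hx hy => simp only [map_add, hx, hy]
  | tmul a b =>
    have h1 : ∀ s t : H ⊗[k] H, TensorProduct.map (projLeft k H) (projLeft k H)
        (AlgebraTensorModule.tensorTensorTensorComm k k k k H H H H (s ⊗ₜ t)) =
        LinearMap.mul' k k (TensorProduct.map counit counit t) • s := by
      intro s t
      induction s with
      | zero => simp
      | add x y hx hy => simp only [map_add, TensorProduct.add_tmul, smul_add, hx, hy]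
      | tmul a b =>
        induction t with
        | zero => simp
        | add x y hx hy => simp only [map_add, TensorProduct.tmul_add, add_smul, hx, hy]
        | tmul c d => simp [projLeft, TensorProduct.smul_tmul', TensorProduct.tmul_smul, smul_smul,
            mul_comm]
    rw [TensorProduct.comul_tmul, h1, mul'_map_counit_counit_comul]
    simp [projLeft]

variable (k H) in
theorem comul_projRight (t : H ⊗[k] H) : comul (projRight k H t) =
    TensorProduct.map (projRight k H) (projRight k H) (comul (R := k) t) := by
  induction t with
  | zero => simp
  | add x y hx hy => simp only [map_add, hx, hy]
  | tmul b a =>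
    have h1 : ∀ s t : H ⊗[k] H, TensorProduct.map (projRight k H) (projRight k H)
        (AlgebraTensorModule.tensorTensorTensorComm k k k k H H H H (t ⊗ₜ s)) =
        LinearMap.mul' k k (TensorProduct.map counit counit t) • s := by
      intro s t
      induction s with
      | zero => simp
      | add x y hx hy => simp only [map_add, TensorProduct.tmul_add, smul_add, hx, hy]
      | tmul a b =>
        induction t with
        | zero => simp
        | add x y hx hy => simp only [map_add, TensorProduct.add_tmul, add_smul, hx, hy]
        | tmul c d => simp [projRight, TensorProduct.smul_tmul', TensorProduct.tmul_smul, smul_smul,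
            mul_comm]
    rw [TensorProduct.comul_tmul, h1, mul'_map_counit_counit_comul]
    simp [projRight]

/-- For f = g = id this presents the multiplication of H as a convolution product of the two
projections, so that computing its inverse becomes formal. -/
theorem projLeft_conv_projRight (f g : H →ₗ[k] H) :
    (f ∘ₗ projLeft k H) ⋆ (g ∘ₗ projRight k H) = LinearMap.mul' k H ∘ₗ TensorProduct.map f g := by
  ext a b
  have h1 : ∀ s t : H ⊗[k] H, LinearMap.mul' k H (TensorProduct.map
      (f ∘ₗ projLeft k H) (g ∘ₗ projRight k H)
        (AlgebraTensorModule.tensorTensorTensorComm k k k k H H H H (s ⊗ₜ t))) =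
      f (projLeft k H s) * g (projRight k H t) := by
    intro s t
    induction s with
    | zero => simp
    | add x y hx hy => simp only [map_add, TensorProduct.add_tmul, add_mul, hx, hy]
    | tmul a b =>
      induction t with
      | zero => simp
      | add x y hx hy => simp only [map_add, TensorProduct.tmul_add, mul_add, hx, hy]
      | tmul c d => simp [projLeft, projRight, smul_smul, mul_comm]
  simp only [AlgebraTensorModule.curry_apply, LinearMap.restrictScalars_self, curry_apply,
    conv_apply, TensorProduct.comul_tmul, h1]
  simp [projLeft, projRight]

theorem projRight_conv_projLeft (f g : H →ₗ[k] H) :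
    (f ∘ₗ projRight k H) ⋆ (g ∘ₗ projLeft k H) =
      LinearMap.mul' k H ∘ₗ TensorProduct.map f g ∘ₗ (TensorProduct.comm k H H).toLinearMap := by
  ext a b
  have h1 : ∀ s t : H ⊗[k] H, LinearMap.mul' k H (TensorProduct.map
      (f ∘ₗ projRight k H) (g ∘ₗ projLeft k H)
        (AlgebraTensorModule.tensorTensorTensorComm k k k k H H H H (s ⊗ₜ t))) =
      f (projLeft k H t) * g (projRight k H s) := by
    intro s t
    induction s with
    | zero => simp
    | add x y hx hy => simp only [map_add, TensorProduct.add_tmul, mul_add, hx, hy]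
    | tmul a b =>
      induction t with
      | zero => simp
      | add x y hx hy => simp only [map_add, TensorProduct.tmul_add, add_mul, hx, hy]
      | tmul c d => simp [projLeft, projRight, smul_smul, mul_comm]
  simp only [AlgebraTensorModule.curry_apply, LinearMap.restrictScalars_self, curry_apply,
    conv_apply, TensorProduct.comul_tmul, h1]
  simp [projLeft, projRight]

/-- With the second tensor factor frozen, the convolution takes place on H alone. This is how
`targetCounit_mul_eq` enters the proof of `antipode_mul`. -/
theorem projLeft_conv_apply_tmul (f : H →ₗ[k] H) (F : H ⊗[k] H →ₗ[k] H) (g h : H) :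
    ((f ∘ₗ projLeft k H) ⋆ F) (g ⊗ₜ h) = (f ⋆ (F ∘ₗ (TensorProduct.mk k H H).flip h)) g := by
  have h1 : ∀ s t : H ⊗[k] H, LinearMap.mul' k H (TensorProduct.map
      (f ∘ₗ projLeft k H) F
        (AlgebraTensorModule.tensorTensorTensorComm k k k k H H H H (s ⊗ₜ t))) =
      LinearMap.mul' k H (TensorProduct.map f (F ∘ₗ (TensorProduct.mk k H H).flip
        (projRight k H t)) s) := by
    intro s t
    induction s with
    | zero => simp
    | add x y hx hy => simp only [map_add, TensorProduct.add_tmul, hx, hy]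
    | tmul a b =>
      induction t with
      | zero => simp
      | add x y hx hy =>
        rw [TensorProduct.tmul_add, map_add, map_add, map_add, hx, hy]
        simp [TensorProduct.tmul_add]
      | tmul c d => simp [projLeft, projRight]
  simp only [conv_apply, TensorProduct.comul_tmul, h1]
  simp [projRight]

theorem projRight_conv_apply_tmul (f : H →ₗ[k] H) (F : H ⊗[k] H →ₗ[k] H) (g h : H) :
    ((f ∘ₗ projRight k H) ⋆ F) (g ⊗ₜ h) = (f ⋆ (F ∘ₗ TensorProduct.mk k H H g)) h := by
  have h1 : ∀ s t : H ⊗[k] H, LinearMap.mul' k H (TensorProduct.map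
      (f ∘ₗ projRight k H) F
        (AlgebraTensorModule.tensorTensorTensorComm k k k k H H H H (s ⊗ₜ t))) =
      LinearMap.mul' k H (TensorProduct.map f (F ∘ₗ TensorProduct.mk k H H
        (projRight k H s)) t) := by
    intro s t
    induction t with
    | zero => simp
    | add x y hx hy => simp only [map_add, TensorProduct.tmul_add, hx, hy]
    | tmul a b =>
      induction s with
      | zero => simp
      | add x y hx hy =>
        rw [TensorProduct.add_tmul, map_add, map_add, map_add, hx, hy]
        simp [mul_add]
      | tmul c d => simp [projRight, ← TensorProduct.smul_tmul']
  simp only [conv_apply, TensorProduct.comul_tmul, h1]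
  simp [projRight]

/-- Multiplication is comultiplicative since Δ(gh) = Δ(g)Δ(h). It need not preserve the counit, but
convolution does not involve the counit. -/
theorem conv_comp_mul' (f g : H →ₗ[k] H) :
    (f ∘ₗ LinearMap.mul' k H) ⋆ (g ∘ₗ LinearMap.mul' k H) = (f ⋆ g) ∘ₗ LinearMap.mul' k H := by
  ext a b
  have h1 : ∀ s t : H ⊗[k] H, LinearMap.mul' k H (TensorProduct.map
      (f ∘ₗ LinearMap.mul' k H) (g ∘ₗ LinearMap.mul' k H)
        (AlgebraTensorModule.tensorTensorTensorComm k k k k H H H H (s ⊗ₜ t))) =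
      LinearMap.mul' k H (TensorProduct.map f g (s * t)) := by
    intro s t
    induction s with
    | zero => simp
    | add x y hx hy => simp only [map_add, TensorProduct.add_tmul, add_mul, hx, hy]
    | tmul a b =>
      induction t with
      | zero => simp
      | add x y hx hy => simp only [map_add, TensorProduct.tmul_add, mul_add, hx, hy]
      | tmul c d => simp
  simp only [AlgebraTensorModule.curry_apply, LinearMap.restrictScalars_self, curry_apply,
    conv_apply, TensorProduct.comul_tmul, h1, LinearMap.comp_apply, LinearMap.mul'_apply, comul_mul]

/-- `S(gh) = S(h)S(g)` -/
theorem antipode_mul (g h : H) : 𝒮 (g * h) = 𝒮 h * 𝒮 g := by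
  set p := projLeft k H
  set q := projRight k H
  have hp : ∀ f g : H →ₗ[k] H, (f ∘ₗ p) ⋆ (g ∘ₗ p) = (f ⋆ g) ∘ₗ p := fun f g =>
    (conv_comp _ (comul_projLeft k H) f g).symm
  have hq : ∀ f g : H →ₗ[k] H, (f ∘ₗ q) ⋆ (g ∘ₗ q) = (f ⋆ g) ∘ₗ q := fun f g =>
    (conv_comp _ (comul_projRight k H) f g).symm
  have hm : LinearMap.mul' k H = (LinearMap.id ∘ₗ p) ⋆ (LinearMap.id ∘ₗ q) := by
    rw [projLeft_conv_projRight, TensorProduct.map_id, LinearMap.comp_id]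
  -- ρ is g ⊗ h ↦ S(h)S(g). Let m be the multiplication. Both S ∘ m and ρ have the products ε_t ∘ m
  -- and ε_s ∘ m with m, and both satisfy u ⋆ m ⋆ u = u; as for generalized inverses in a semigroup,
  -- this forces them to coincide.
  set ρ := (𝒮 ∘ₗ q) ⋆ (𝒮 ∘ₗ p) with hρ
  have h1 : LinearMap.mul' k H ⋆ ρ = targetCounit k ∘ₗ LinearMap.mul' k H := by
    rw [hm, hρ, conv_assoc, ← conv_assoc (LinearMap.id ∘ₗ q), hq, id_conv_antipode, ← hm]
    ext a b
    simp only [AlgebraTensorModule.curry_apply, LinearMap.restrictScalars_self, curry_apply,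
      LinearMap.comp_apply, LinearMap.mul'_apply]
    rw [projLeft_conv_apply_tmul, projRight_conv_projLeft, targetCounit_mul_eq]
    rfl
  have h2 : ρ ⋆ LinearMap.mul' k H = sourceCounit k ∘ₗ LinearMap.mul' k H := by
    rw [hm, hρ, conv_assoc, ← conv_assoc _ (LinearMap.id ∘ₗ p), hp, antipode_conv_id, ← hm]
    ext a b
    simp only [AlgebraTensorModule.curry_apply, LinearMap.restrictScalars_self, curry_apply,
      LinearMap.comp_apply, LinearMap.mul'_apply]
    rw [projRight_conv_apply_tmul, projLeft_conv_projRight, sourceCounit_mul_eq]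
    rfl
  have h3 : ρ ⋆ LinearMap.mul' k H ⋆ ρ = ρ := by
    -- The only place where the commutation of the two counital subalgebras is needed.
    have h4 : (sourceCounit k ∘ₗ p) ⋆ (targetCounit k ∘ₗ q) =
        (targetCounit k ∘ₗ q) ⋆ (sourceCounit k ∘ₗ p) := by
      rw [projLeft_conv_projRight, projRight_conv_projLeft]
      ext a b
      simp [sourceCounit_mul_targetCounit]
    rw [hm]
    calc ρ ⋆ ((LinearMap.id ∘ₗ p) ⋆ (LinearMap.id ∘ₗ q)) ⋆ ρ
        = (𝒮 ∘ₗ q) ⋆ (((𝒮 ∘ₗ p) ⋆ (LinearMap.id ∘ₗ p)) ⋆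
          ((LinearMap.id ∘ₗ q) ⋆ (𝒮 ∘ₗ q))) ⋆ (𝒮 ∘ₗ p) := by
          simp only [hρ, conv_assoc]
      _ = ((𝒮 ∘ₗ q) ⋆ (targetCounit k ∘ₗ q)) ⋆ ((sourceCounit k ∘ₗ p) ⋆ (𝒮 ∘ₗ p)) := by
          rw [hp, hq, antipode_conv_id, id_conv_antipode, h4]
          simp only [conv_assoc]
      _ = ρ := by rw [hp, hq, antipode_conv_targetCounit, sourceCounit_conv_antipode]
  have h5 : 𝒮 ∘ₗ LinearMap.mul' k H = ρ := by
    calc 𝒮 ∘ₗ LinearMap.mul' k H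
        = (sourceCounit k ∘ₗ LinearMap.mul' k H) ⋆ (𝒮 ∘ₗ LinearMap.mul' k H) := by
          rw [conv_comp_mul', sourceCounit_conv_antipode]
      _ = ρ ⋆ ((LinearMap.id ∘ₗ LinearMap.mul' k H) ⋆ (𝒮 ∘ₗ LinearMap.mul' k H)) := by
          rw [← h2, conv_assoc, LinearMap.id_comp]
      _ = ρ ⋆ (LinearMap.mul' k H ⋆ ρ) := by
          rw [conv_comp_mul', id_conv_antipode, h1]
      _ = ρ := by rw [← conv_assoc, h3]
  have h6 := LinearMap.congr_fun h5 (g ⊗ₜ h)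
  rw [hρ, projRight_conv_projLeft] at h6
  simpa using h6

end tensor

end antipode

end WeakHopfAlgebra

namespace WeakHopfAlgebra

variable {k H : Type*} [Field k] [Ring H] [Algebra k H] [Coalgebra k H] [WeakHopfAlgebra k H]

local infixl:70 " ⋆ " => conv

local notation "𝒮" => antipode (k := k) (H := H)

/-! ### The antipode on the counital subalgebras -/

/-- Since Δ(z) = 1₁z ⊗ 1₂, one gets ε_s(z) = S(1₁z)1₂ = S(z)S(1₁)1₂ = S(z). -/
theorem antipode_of_target {z : H} (hz : targetCounit k z = z) : 𝒮 z = sourceCounit k z := by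
  have h1 : ∀ t : H ⊗[k] H, LinearMap.mul' k H (LinearMap.rTensor H 𝒮 (t * z ⊗ₜ 1)) =
      𝒮 z * LinearMap.mul' k H (LinearMap.rTensor H 𝒮 t) := by
    intro t
    induction t with
    | zero => simp
    | add x y hx hy => simp only [map_add, add_mul, mul_add, hx, hy]
    | tmul a b => simp [antipode_mul, mul_assoc]
  rw [← mul_rTensor_antipode, comul_of_target hz, h1, mul_rTensor_antipode, sourceCounit_one,
    mul_one]

theorem antipode_of_source {y : H} (hy : sourceCounit k y = y) : 𝒮 y = targetCounit k y := by
  have h1 : ∀ t : H ⊗[k] H, LinearMap.mul' k H (LinearMap.lTensor H 𝒮 (1 ⊗ₜ y * t)) =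
      LinearMap.mul' k H (LinearMap.lTensor H 𝒮 t) * 𝒮 y := by
    intro t
    induction t with
    | zero => simp
    | add x y hx hy => simp only [map_add, add_mul, mul_add, hx, hy]
    | tmul a b => simp [antipode_mul, mul_assoc]
  rw [← mul_lTensor_antipode, comul_of_source hy, h1, mul_lTensor_antipode, targetCounit_one,
    one_mul]

variable (k H) in
theorem antipode_one : 𝒮 (1 : H) = 1 := by
  rw [antipode_of_target (targetCounit_one k), sourceCounit_one]

theorem antipode_source_mem {y : H} (hy : sourceCounit k y = y) :
    targetCounit k (𝒮 y) = 𝒮 y := by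
  rw [antipode_of_source hy, targetCounit_idem]

/-- The map `y ↦ ε(y1₁)1₂`. -/
noncomputable def sourceToTarget : H →ₗ[k] H :=
  projRight k H ∘ₗ LinearMap.mulRight k (comul (R := k) (1 : H)) ∘ₗ inl k H

/-- The map `z ↦ 1₁ε(1₂z)`. -/
noncomputable def targetToSource : H →ₗ[k] H :=
  projLeft k H ∘ₗ LinearMap.mulLeft k (comul (R := k) (1 : H)) ∘ₗ inr k H

theorem sourceToTarget_apply (y : H) :
    sourceToTarget (k := k) y = projRight k H (y ⊗ₜ 1 * comul (R := k) (1 : H)) := rfl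

theorem targetToSource_apply (z : H) :
    targetToSource (k := k) z = projLeft k H (comul (R := k) (1 : H) * 1 ⊗ₜ z) := rfl

theorem targetCounit_sourceToTarget (y : H) :
    targetCounit k (sourceToTarget (k := k) y) = sourceToTarget (k := k) y := by
  have h1 : ∀ t : H ⊗[k] H, targetCounit k (projRight k H (y ⊗ₜ 1 * t)) =
      projRight k H (y ⊗ₜ 1 * LinearMap.lTensor H (targetCounit k) t) := by
    intro t
    induction t with
    | zero => simp
    | add x y hx hy => simp only [map_add, mul_add, hx, hy]
    | tmul a b => simp [projRight]
  rw [sourceToTarget_apply, h1, lTensor_targetCounit_comul_one]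

theorem sourceCounit_targetToSource (z : H) :
    sourceCounit k (targetToSource (k := k) z) = targetToSource (k := k) z := by
  have h1 : ∀ t : H ⊗[k] H, sourceCounit k (projLeft k H (t * 1 ⊗ₜ z)) =
      projLeft k H (LinearMap.rTensor H (sourceCounit k) t * 1 ⊗ₜ z) := by
    intro t
    induction t with
    | zero => simp
    | add x y hx hy => simp only [map_add, add_mul, hx, hy]
    | tmul a b => simp [projLeft]
  rw [targetToSource_apply, h1, rTensor_sourceCounit_comul_one]

/-- With 1' a second copy of 1, weak multiplicativity contracts ε(1'₁1₁)ε(1₂z)1'₂ to ε(1'₁z)1'₂.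
Since S = ε_t on H_s, `targetToSource` is thereby a right inverse of S : H_s → H_t. -/
theorem targetCounit_targetToSource (z : H) :
    targetCounit k (targetToSource (k := k) z) = targetCounit k z := by
  -- The factor `LinearMap.mul' k k ∘ₗ (TensorProduct.mk k k k).flip 1` is the identity of k.
  have h1 : ∀ s t : H ⊗[k] H, projRight k H (t * projLeft k H (s * 1 ⊗ₜ z) ⊗ₜ 1) =
      TensorProduct.lid k H (LinearMap.rTensor H (LinearMap.mul' k k ∘ₗ
        ((TensorProduct.mk k k k).flip 1) ∘ₗ LinearMap.mul' k k ∘ₗ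
        TensorProduct.map counit (counit ∘ₗ LinearMap.mulRight k z)  ∘ₗ
        LinearMap.mulRight k s ∘ₗ inl k H) t) := by
    intro s t
    induction t with
    | zero => simp
    | add x y hx hy => simp only [map_add, add_mul, hx, hy]
    | tmul c d =>
      induction s with
      | zero => simp
      | add x y hx hy =>
        rw [add_mul, map_add, TensorProduct.add_tmul, mul_add, map_add, hx, hy]
        simp [mul_add, add_smul]
      | tmul a b => simp [projLeft, projRight, mul_comm]
  have h2 : ∀ x : H, LinearMap.mul' k k (TensorProduct.map counit
      (counit ∘ₗ LinearMap.mulRight k z) (x ⊗ₜ 1 * comul (R := k) (1 : H))) =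
      counit (R := k) (x * z) := by
    intro x
    have h3 := counit_mul_mul (k := k) x 1 z
    rw [mul_one] at h3
    rw [h3]
    generalize comul (R := k) (1 : H) = s
    induction s with
    | zero => simp
    | add x y hx hy => simp only [map_add, mul_add, hx, hy]
    | tmul a b => simp
  have h4 : ∀ t : H ⊗[k] H, TensorProduct.lid k H (LinearMap.rTensor H (LinearMap.mul' k k ∘ₗ
        ((TensorProduct.mk k k k).flip 1) ∘ₗ LinearMap.mul' k k ∘ₗ
        TensorProduct.map counit (counit ∘ₗ LinearMap.mulRight k z)  ∘ₗ
        LinearMap.mulRight k (comul (R := k) (1 : H)) ∘ₗ inl k H) t) =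
      TensorProduct.lid k H (LinearMap.rTensor H counit (t * z ⊗ₜ 1)) := by
    intro t
    induction t with
    | zero => simp
    | add x y hx hy => simp only [map_add, add_mul, hx, hy]
    | tmul a b => simp [h2]
  rw [targetCounit_apply, targetCounit_apply, targetToSource_apply, ← h4, ← h1]
  rfl

theorem sourceCounit_sourceToTarget (y : H) :
    sourceCounit k (sourceToTarget (k := k) y) = sourceCounit k y := by
  have h1 : ∀ s t : H ⊗[k] H, projLeft k H (1 ⊗ₜ projRight k H (y ⊗ₜ 1 * s) * t) =
      TensorProduct.rid k H (LinearMap.lTensor H (LinearMap.mul' k k ∘ₗ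
        ((TensorProduct.mk k k k).flip 1) ∘ₗ LinearMap.mul' k k ∘ₗ
        TensorProduct.map (counit ∘ₗ LinearMap.mulLeft k y) counit ∘ₗ
        LinearMap.mulLeft k s ∘ₗ inr k H) t) := by
    intro s t
    induction t with
    | zero => simp
    | add x y hx hy => simp only [map_add, mul_add, hx, hy]
    | tmul c d =>
      induction s with
      | zero => simp
      | add x y hx hy =>
        rw [mul_add, map_add, TensorProduct.tmul_add, add_mul, map_add, hx, hy]
        simp [add_mul, add_smul]
      | tmul a b => simp [projLeft, projRight, smul_smul]
  have h2 : ∀ x : H, LinearMap.mul' k k (TensorProduct.map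
      (counit ∘ₗ LinearMap.mulLeft k y) counit (comul (R := k) (1 : H) * 1 ⊗ₜ x)) =
      counit (R := k) (y * x) := by
    intro x
    have h3 := counit_mul_mul (k := k) y 1 x
    rw [mul_one] at h3
    rw [h3]
    generalize comul (R := k) (1 : H) = s
    induction s with
    | zero => simp
    | add x y hx hy => simp only [map_add, add_mul, hx, hy]
    | tmul a b => simp
  have h4 : ∀ t : H ⊗[k] H, TensorProduct.rid k H (LinearMap.lTensor H (LinearMap.mul' k k ∘ₗ
        ((TensorProduct.mk k k k).flip 1) ∘ₗ LinearMap.mul' k k ∘ₗ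
        TensorProduct.map (counit ∘ₗ LinearMap.mulLeft k y) counit ∘ₗ
        LinearMap.mulLeft k (comul (R := k) (1 : H)) ∘ₗ inr k H) t) =
      TensorProduct.rid k H (LinearMap.lTensor H counit (1 ⊗ₜ y * t)) := by
    intro t
    induction t with
    | zero => simp
    | add x y hx hy => simp only [map_add, mul_add, hx, hy]
    | tmul a b => simp [h2]
  rw [sourceCounit_apply, sourceCounit_apply, sourceToTarget_apply, ← h4, ← h1]
  rfl

theorem antipode_targetToSource {z : H} (hz : targetCounit k z = z) :
    𝒮 (targetToSource (k := k) z) = z := by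
  rw [antipode_of_source (sourceCounit_targetToSource z), targetCounit_targetToSource, hz]

theorem antipode_sourceToTarget {y : H} (hy : sourceCounit k y = y) :
    𝒮 (sourceToTarget (k := k) y) = y := by
  rw [antipode_of_target (targetCounit_sourceToTarget y), sourceCounit_sourceToTarget, hy]

/-- `S` is injective on `H_t`. -/
theorem eq_zero_of_antipode_target {z : H} (hz : targetCounit k z = z) (h0 : 𝒮 z = 0) : z = 0 := by
  have h1 : ∀ s t : H ⊗[k] H, projRight k H (projLeft k H (1 ⊗ₜ z * t) ⊗ₜ 1 * s) =
      TensorProduct.lid k H (LinearMap.rTensor H (LinearMap.mul' k k ∘ₗ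
        ((TensorProduct.mk k k k).flip 1) ∘ₗ LinearMap.mul' k k ∘ₗ
        TensorProduct.map counit (counit ∘ₗ LinearMap.mulLeft k z) ∘ₗ
        LinearMap.mulLeft k t ∘ₗ inl k H) s) := by
    intro s t
    induction s with
    | zero => simp
    | add x y hx hy => simp only [map_add, mul_add, hx, hy]
    | tmul c d =>
      induction t with
      | zero => simp
      | add x y hx hy =>
        rw [mul_add, map_add, TensorProduct.add_tmul, add_mul, map_add, hx, hy]
        simp [add_mul, add_smul]
      | tmul a b => simp [projLeft, projRight, mul_comm]
  have h2 : ∀ x : H, LinearMap.mul' k k (TensorProduct.map counit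
      (counit ∘ₗ LinearMap.mulLeft k z) (comul (R := k) (1 : H) * x ⊗ₜ 1)) =
      counit (R := k) (z * x) := by
    intro x
    have h3 := counit_mul_mul' (k := k) z 1 x
    rw [mul_one] at h3
    rw [h3]
    generalize comul (R := k) (1 : H) = s
    induction s with
    | zero => simp
    | add x y hx hy => simp only [map_add, add_mul, hx, hy]
    | tmul a b => simp
  have h4 : ∀ t : H ⊗[k] H, TensorProduct.lid k H (LinearMap.rTensor H (LinearMap.mul' k k ∘ₗ
        ((TensorProduct.mk k k k).flip 1) ∘ₗ LinearMap.mul' k k ∘ₗ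
        TensorProduct.map counit (counit ∘ₗ LinearMap.mulLeft k z)  ∘ₗ
        LinearMap.mulLeft k (comul (R := k) (1 : H)) ∘ₗ inl k H) t) =
      TensorProduct.lid k H (LinearMap.rTensor H counit (z ⊗ₜ 1 * t)) := by
    intro t
    induction t with
    | zero => simp
    | add x y hx hy => simp only [map_add, mul_add, hx, hy]
    | tmul a b => simp [h2]
  -- Here ε_s(z) = 1₁ε(z1₂), and weak multiplicativity contracts ε(1₁1'₁)ε(z1₂)1'₂ to ε(z1'₁)1'₂ =
  -- z. So `sourceToTarget` undoes S on H_t.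
  have h5 : sourceToTarget (k := k) (sourceCounit k z) = targetCounit k z := by
    rw [targetCounit_apply, sourceToTarget_apply, ← comul_of_target hz, comul_of_target' hz, ← h4,
      ← h1]
    rfl
  rw [antipode_of_target hz] at h0
  rw [← hz, ← h5, h0, map_zero]

/-- `S(z)1₁ ⊗ 1₂ = 1₁ ⊗ z1₂` for `z ∈ H_t` -/
theorem antipode_target_mul_comul_one {z : H} (hz : targetCounit k z = z) :
    𝒮 z ⊗ₜ 1 * comul (R := k) (1 : H) = 1 ⊗ₜ z * comul (R := k) (1 : H) := by
  -- ε_s ⊗ id is evaluated on Δ(z) = z1₁ ⊗ 1₂ in two ways: ε_s(z1₁) = ε_s(z)1₁ because 1₁ lies in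
  -- H_s, while ε_s(z₁) ⊗ z₂ = 1₁ ⊗ z1₂.
  have h1 : ∀ t : H ⊗[k] H, LinearMap.rTensor H (sourceCounit k)
      (z ⊗ₜ 1 * LinearMap.rTensor H (sourceCounit k) t) =
      sourceCounit k z ⊗ₜ 1 * LinearMap.rTensor H (sourceCounit k) t := by
    intro t
    induction t with
    | zero => simp
    | add x y hx hy => simp only [map_add, mul_add, hx, hy]
    | tmul a b => simp [sourceCounit_mul_source _ (sourceCounit_idem k a)]
  have h2 := h1 (comul (R := k) 1)
  rw [rTensor_sourceCounit_comul_one, ← comul_of_target' hz, rTensor_sourceCounit_comul] at h2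
  rw [antipode_of_target hz, h2]

/-- `S(z)h₁ ⊗ h₂ = h₁ ⊗ zh₂` for `z ∈ H_t` -/
theorem antipode_target_mul_comul {z : H} (hz : targetCounit k z = z) (h : H) :
    𝒮 z ⊗ₜ 1 * comul (R := k) h = 1 ⊗ₜ z * comul (R := k) h := by
  rw [← one_mul h, comul_mul, ← mul_assoc, antipode_target_mul_comul_one hz, mul_assoc]

/-- `1₁y ⊗ 1₂ = 1₁ ⊗ 1₂S(y)` for `y ∈ H_s` -/
theorem comul_one_mul_antipode_source {y : H} (hy : sourceCounit k y = y) :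
    comul (R := k) (1 : H) * y ⊗ₜ 1 = comul (R := k) (1 : H) * 1 ⊗ₜ 𝒮 y := by
  have h1 : ∀ t : H ⊗[k] H, LinearMap.lTensor H (targetCounit k)
      (LinearMap.lTensor H (targetCounit k) t * 1 ⊗ₜ y) =
      LinearMap.lTensor H (targetCounit k) t * 1 ⊗ₜ targetCounit k y := by
    intro t
    induction t with
    | zero => simp
    | add x y hx hy => simp only [map_add, add_mul, hx, hy]
    | tmul a b => simp [targetCounit_target_mul (targetCounit_idem k b)]
  have h2 := h1 (comul (R := k) 1)
  rw [lTensor_targetCounit_comul_one, ← comul_of_source' hy, lTensor_targetCounit_comul] at h2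
  rw [antipode_of_source hy, h2]

/-- `h₁y ⊗ h₂ = h₁ ⊗ h₂S(y)` for `y ∈ H_s` -/
theorem comul_mul_antipode_source {y : H} (hy : sourceCounit k y = y) (h : H) :
    comul (R := k) h * y ⊗ₜ 1 = comul (R := k) h * 1 ⊗ₜ 𝒮 y := by
  rw [← mul_one h, comul_mul, mul_assoc, comul_one_mul_antipode_source hy, mul_assoc]

/-! ### The antipode is an anti-homomorphism of coalgebras -/

section finite

variable [FiniteDimensional k H]

/-- In finite dimension the forms f ⊗ g span the dual of H ⊗ H. -/
theorem eq_of_forall_map_dual {s t : H ⊗[k] H}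
    (hst : ∀ f g : Module.Dual k H, LinearMap.mul' k k (TensorProduct.map f g s) =
      LinearMap.mul' k k (TensorProduct.map f g t)) : s = t := by
  rw [← sub_eq_zero, ← Module.forall_dual_apply_eq_zero_iff k]
  intro F
  obtain ⟨u, rfl⟩ := (TensorProduct.dualDistribEquiv k H H).surjective F
  have h1 : ∀ (f g : Module.Dual k H) (v : H ⊗[k] H),
      TensorProduct.dualDistribEquiv k H H (f ⊗ₜ g) v =
        LinearMap.mul' k k (TensorProduct.map f g v) := by
    intro f g v
    induction v with
    | zero => simp
    | add x y hx hy => simp only [map_add, hx, hy]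
    | tmul a b => rfl
  induction u with
  | zero => simp
  | add x y hx hy => simp only [map_add, LinearMap.add_apply, hx, hy, add_zero]
  | tmul f g => rw [h1, map_sub, map_sub, hst, sub_self]

/-- The map `a ⊗ b ↦ S(b) ⊗ S(a)`. -/
noncomputable def antipodeFlip : H ⊗[k] H →ₗ[k] H ⊗[k] H :=
  TensorProduct.map 𝒮 𝒮 ∘ₗ (TensorProduct.comm k H H).toLinearMap

@[simp] theorem antipodeFlip_tmul (a b : H) :
    antipodeFlip (k := k) (a ⊗ₜ b) = 𝒮 b ⊗ₜ[k] 𝒮 a := rfl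

theorem antipodeFlip_mul (s t : H ⊗[k] H) :
    antipodeFlip (k := k) (s * t) = antipodeFlip (k := k) t * antipodeFlip (k := k) s := by
  induction s with
  | zero => simp
  | add x y hx hy => simp only [map_add, mul_add, add_mul, hx, hy]
  | tmul a b =>
    induction t with
    | zero => simp
    | add x y hx hy => simp only [map_add, mul_add, add_mul, hx, hy]
    | tmul c d => simp [antipode_mul]

/-- `Δ(S(h)) = S(h₂) ⊗ S(h₁)` -/
theorem comul_antipode (h : H) : comul (R := k) (𝒮 h) =
    antipodeFlip (k := k) (comul (R := k) h) := by
  refine eq_of_forall_map_dual fun f g => ?_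
  -- Anti-multiplicativity holds for the antipode φ ↦ φ ∘ S of H* as well. The product of H* is dual
  -- to Δ, so evaluation at h is the claim paired with f ⊗ g.
  have h1 := congrArg (fun χ => DualGroupoid.toDual χ h) (antipode_mul (k := k)
    (DualGroupoid.toDual.symm f : DualGroupoid k H) (DualGroupoid.toDual.symm g))
  refine Eq.trans h1 ?_
  change LinearMap.mul' k k (TensorProduct.map (g ∘ₗ 𝒮) (f ∘ₗ 𝒮) (comul (R := k) h)) = _
  generalize comul (R := k) h = t
  induction t with
  | zero => simp
  | add x y hx hy => simp only [map_add, hx, hy]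
  | tmul a b => simp [mul_comm]

variable (k H) in
theorem antipodeFlip_comul_one :
    antipodeFlip (k := k) (comul (R := k) (1 : H)) = comul (R := k) (1 : H) := by
  rw [← comul_antipode, antipode_one]

variable (k H) in
theorem comul_comp_antipode : comul (R := k) ∘ₗ 𝒮 = (inr k H ∘ₗ 𝒮) ⋆ (inl k H ∘ₗ 𝒮) := by
  rw [inr_conv_inl]
  ext h
  exact comul_antipode h

/-- `ε_t(h₁) ⊗ h₂ = S(1₁) ⊗ 1₂h` -/
theorem rTensor_targetCounit_comul (h : H) :
    LinearMap.rTensor H (targetCounit k) (comul (R := k) h) =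
      LinearMap.rTensor H 𝒮 (comul (R := k) (1 : H)) * 1 ⊗ₜ h := by
  -- Writing Δ(1) = S(1₂) ⊗ S(1₁) in the definition of ε_t gives S(1₁) ⊗ ε(S(1₂)h₁)h₂. As 1₂ lies in
  -- H_t, the factor S(1₂) on h₁ can be traded for 1₂ on h₂.
  have h1 : ∀ t : H ⊗[k] H, LinearMap.rTensor H ((TensorProduct.lid k H).toLinearMap ∘ₗ
      LinearMap.rTensor H counit ∘ₗ LinearMap.mulLeft k
        (antipodeFlip (k := k) (LinearMap.lTensor H (targetCounit k) t)) ∘ₗ inl k H)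
          (comul (R := k) h) =
      LinearMap.rTensor H 𝒮 (LinearMap.lTensor H (targetCounit k) t) * 1 ⊗ₜ h := by
    intro t
    induction t with
    | zero =>
      simp only [map_zero, zero_mul, LinearMap.mulLeft_zero_eq_zero, LinearMap.zero_comp,
        LinearMap.comp_zero, LinearMap.rTensor_zero, LinearMap.zero_apply]
    | add x y hx hy =>
      rw [map_add, map_add, map_add, add_mul, ← hx, ← hy, ← LinearMap.add_apply,
        ← LinearMap.rTensor_add]
      congr 2
      ext
      simp [add_mul]
    | tmul a b =>
      have h2 : ∀ s : H ⊗[k] H, LinearMap.rTensor H ((TensorProduct.lid k H).toLinearMap ∘ₗ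
          LinearMap.rTensor H counit ∘ₗ LinearMap.mulLeft k
          (𝒮 (targetCounit k b) ⊗ₜ[k] 𝒮 a) ∘ₗ inl k H) s =
          𝒮 a ⊗ₜ projRight k H (𝒮 (targetCounit k b) ⊗ₜ 1 * s) := by
        intro s
        induction s with
        | zero => simp
        | add x y hx hy => simp only [map_add, mul_add, TensorProduct.tmul_add, hx, hy]
        | tmul a b => simp [projRight, TensorProduct.smul_tmul']
      have h3 : ∀ s : H ⊗[k] H, projRight k H (1 ⊗ₜ targetCounit k b * s) =
          targetCounit k b * projRight k H s := by
        intro s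
        induction s with
        | zero => simp
        | add x y hx hy => simp only [map_add, mul_add, hx, hy]
        | tmul a b => simp [projRight]
      rw [LinearMap.lTensor_tmul, antipodeFlip_tmul, h2,
        antipode_target_mul_comul (targetCounit_idem k b), h3]
      simp [projRight]
  have h4 := h1 (comul (R := k) 1)
  rw [lTensor_targetCounit_comul_one, antipodeFlip_comul_one] at h4
  exact h4

/-- `h₁ ⊗ ε_s(h₂) = h1₁ ⊗ S(1₂)` -/
theorem lTensor_sourceCounit_comul (h : H) :
    LinearMap.lTensor H (sourceCounit k) (comul (R := k) h) =
      h ⊗ₜ 1 * LinearMap.lTensor H 𝒮 (comul (R := k) (1 : H)) := by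
  have h1 : ∀ t : H ⊗[k] H, LinearMap.lTensor H ((TensorProduct.rid k H).toLinearMap ∘ₗ
      LinearMap.lTensor H counit ∘ₗ LinearMap.mulRight k
        (antipodeFlip (k := k) (LinearMap.rTensor H (sourceCounit k) t)) ∘ₗ inr k H)
          (comul (R := k) h) =
      h ⊗ₜ 1 * LinearMap.lTensor H 𝒮 (LinearMap.rTensor H (sourceCounit k) t) := by
    intro t
    induction t with
    | zero =>
      simp only [map_zero, mul_zero, LinearMap.mulRight_zero_eq_zero, LinearMap.zero_comp,
        LinearMap.comp_zero, LinearMap.lTensor_zero, LinearMap.zero_apply]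
    | add x y hx hy =>
      rw [map_add, map_add, map_add, mul_add, ← hx, ← hy, ← LinearMap.add_apply,
        ← LinearMap.lTensor_add]
      congr 2
      ext
      simp [mul_add]
    | tmul a b =>
      have h2 : ∀ s : H ⊗[k] H, LinearMap.lTensor H ((TensorProduct.rid k H).toLinearMap ∘ₗ
          LinearMap.lTensor H counit ∘ₗ LinearMap.mulRight k
          (𝒮 b ⊗ₜ[k] 𝒮 (sourceCounit k a)) ∘ₗ inr k H) s =
          projLeft k H (s * 1 ⊗ₜ 𝒮 (sourceCounit k a)) ⊗ₜ 𝒮 b := by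
        intro s
        induction s with
        | zero => simp
        | add x y hx hy => simp only [map_add, add_mul, TensorProduct.add_tmul, hx, hy]
        | tmul a b => simp [projLeft, TensorProduct.smul_tmul']
      have h3 : ∀ s : H ⊗[k] H, projLeft k H (s * sourceCounit k a ⊗ₜ 1) =
          projLeft k H s * sourceCounit k a := by
        intro s
        induction s with
        | zero => simp
        | add x y hx hy => simp only [map_add, add_mul, hx, hy]
        | tmul a b => simp [projLeft]
      rw [LinearMap.rTensor_tmul, antipodeFlip_tmul, h2,
        ← comul_mul_antipode_source (sourceCounit_idem k a), h3]
      simp [projLeft]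
  have h4 := h1 (comul (R := k) 1)
  rw [rTensor_sourceCounit_comul_one, antipodeFlip_comul_one] at h4
  exact h4

/-- `Δ(S(h₁))(h₂ ⊗ 1) = Δ(1)(1 ⊗ S(h))` -/
theorem comul_antipode_conv_inl (h : H) :
    ((comul (R := k) ∘ₗ 𝒮) ⋆ inl k H) h = comul (R := k) (1 : H) * 1 ⊗ₜ 𝒮 h := by
  -- Δ(S(h₁))(h₂ ⊗ 1) = S(h₂)h₃ ⊗ S(h₁) = ε_s(h₂) ⊗ S(h₁) = S(1₂) ⊗ S(h1₁), and S(1₂) ⊗ S(1₁) =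
  -- Δ(1).
  have h1 : (inl k H ∘ₗ 𝒮) ⋆ inl k H = inl k H ∘ₗ sourceCounit k := by
    rw [← antipode_conv_id, comp_conv _ inl_mul, LinearMap.comp_id]
  have h2 : ∀ t : H ⊗[k] H, TensorProduct.map (sourceCounit k) 𝒮 (TensorProduct.comm k H H t) =
      TensorProduct.comm k H H
        (LinearMap.rTensor H 𝒮 (LinearMap.lTensor H (sourceCounit k) t)) := by
    intro t
    induction t with
    | zero => simp
    | add x y hx hy => simp only [map_add, hx, hy]
    | tmul a b => simp
  have h3 : ∀ t : H ⊗[k] H, TensorProduct.comm k H H (LinearMap.rTensor H 𝒮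
      (h ⊗ₜ 1 * LinearMap.lTensor H 𝒮 t)) = antipodeFlip (k := k) t * 1 ⊗ₜ 𝒮 h := by
    intro t
    induction t with
    | zero => simp
    | add x y hx hy => simp only [map_add, mul_add, add_mul, hx, hy]
    | tmul a b => simp [antipode_mul]
  rw [comul_comp_antipode, conv_assoc, h1, inr_conv_inl, LinearMap.comp_apply,
    LinearMap.comp_apply, LinearEquiv.coe_coe, h2, lTensor_sourceCounit_comul, h3,
    antipodeFlip_comul_one]

/-- `(1 ⊗ h₁)Δ(S(h₂)) = (S(h) ⊗ 1)Δ(1)` -/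
theorem inr_conv_comul_antipode (h : H) :
    (inr k H ⋆ (comul (R := k) ∘ₗ 𝒮)) h = 𝒮 h ⊗ₜ 1 * comul (R := k) (1 : H) := by
  have h1 : inr k H ⋆ (inr k H ∘ₗ 𝒮) = inr k H ∘ₗ targetCounit k := by
    rw [← id_conv_antipode, comp_conv _ inr_mul, LinearMap.comp_id]
  have h2 : ∀ t : H ⊗[k] H, TensorProduct.map 𝒮 (targetCounit k) (TensorProduct.comm k H H t) =
      TensorProduct.comm k H H
        (LinearMap.lTensor H 𝒮 (LinearMap.rTensor H (targetCounit k) t)) := by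
    intro t
    induction t with
    | zero => simp
    | add x y hx hy => simp only [map_add, hx, hy]
    | tmul a b => simp
  have h3 : ∀ t : H ⊗[k] H, TensorProduct.comm k H H (LinearMap.lTensor H 𝒮
      (LinearMap.rTensor H 𝒮 t * 1 ⊗ₜ h)) = 𝒮 h ⊗ₜ 1 * antipodeFlip (k := k) t := by
    intro t
    induction t with
    | zero => simp
    | add x y hx hy => simp only [map_add, mul_add, add_mul, hx, hy]
    | tmul a b => simp [antipode_mul]
  rw [comul_comp_antipode, ← conv_assoc, h1, inr_conv_inl, LinearMap.comp_apply,
    LinearMap.comp_apply, LinearEquiv.coe_coe, h2, rTensor_targetCounit_comul, h3,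
    antipodeFlip_comul_one]

/-- `(S²(h₂) ⊗ 1)Δ(S(h₁)) = (1 ⊗ S(h))Δ(1)` -/
theorem antipode_antipode_mul_comul_antipode (h : H) :
    LinearMap.mul' k (H ⊗[k] H) (TensorProduct.map (inl k H ∘ₗ 𝒮 ∘ₗ 𝒮) (comul (R := k) ∘ₗ 𝒮)
      (TensorProduct.comm k H H (comul (R := k) h))) = 1 ⊗ₜ 𝒮 h * comul (R := k) (1 : H) := by
  -- The claim is the image of Δ(h₁)(1 ⊗ S(h₂)) = h₁ ⊗ ε_t(h₂) = Δ(1)(h ⊗ 1) under the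
  -- anti-multiplicative map a ⊗ b ↦ S(b) ⊗ S(a).
  have h1 : comul (R := k) ⋆ (inr k H ∘ₗ 𝒮) = LinearMap.mulLeft k (comul (R := k) (1 : H)) ∘ₗ
      inl k H := by
    have h2 : (comul (R := k) : H →ₗ[k] H ⊗[k] H) = inl k H ⋆ inr k H := by
      have h3 := inl_conv_inr (k := k) (LinearMap.id : H →ₗ[k] H) LinearMap.id
      rw [LinearMap.comp_id, LinearMap.comp_id, TensorProduct.map_id, LinearMap.id_comp] at h3
      exact h3.symm
    have h4 : inr k H ⋆ (inr k H ∘ₗ 𝒮) = inr k H ∘ₗ targetCounit k := by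
      rw [← id_conv_antipode, comp_conv _ inr_mul, LinearMap.comp_id]
    have h5 := inl_conv_inr (k := k) (LinearMap.id : H →ₗ[k] H) (targetCounit k)
    rw [LinearMap.comp_id] at h5
    conv_lhs => rw [h2, conv_assoc, h4, h5]
    ext h
    exact lTensor_targetCounit_comul h
  have h6 : ∀ t : H ⊗[k] H, LinearMap.mul' k (H ⊗[k] H)
      (TensorProduct.map (inl k H ∘ₗ 𝒮 ∘ₗ 𝒮) (comul (R := k) ∘ₗ 𝒮) (TensorProduct.comm k H H t)) =
      antipodeFlip (k := k) (LinearMap.mul' k (H ⊗[k] H)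
        (TensorProduct.map (comul (R := k)) (inr k H ∘ₗ 𝒮) t)) := by
    intro t
    induction t with
    | zero => simp
    | add x y hx hy => simp only [map_add, hx, hy]
    | tmul a b => simp [antipodeFlip_mul, comul_antipode, antipode_one]
  rw [h6, ← conv_apply, h1]
  simp [antipodeFlip_mul, antipodeFlip_comul_one, antipode_one]

end finite

end WeakHopfAlgebra

namespace WeakHopfAlgebra

variable {k H : Type*} [Field k] [Ring H] [Algebra k H] [Coalgebra k H] [WeakHopfAlgebra k H]

local infixl:70 " ⋆ " => conv

local notation "𝒮" => antipode (k := k) (H := H)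

/-! ### Translation operators -/

section translation

/-- The operator `h ↦ h₁f(h₂)`. -/
noncomputable def rightTrans : Module.Dual k H →ₗ[k] H →ₗ[k] H where
  toFun f := (TensorProduct.rid k H).toLinearMap ∘ₗ LinearMap.lTensor H f ∘ₗ comul
  map_add' f g := by ext h; simp [LinearMap.lTensor_add]
  map_smul' c f := by ext h; simp [LinearMap.lTensor_smul]

/-- The operator `h ↦ f(h₁)h₂`. -/
noncomputable def leftTrans : Module.Dual k H →ₗ[k] H →ₗ[k] H where
  toFun f := (TensorProduct.lid k H).toLinearMap ∘ₗ LinearMap.rTensor H f ∘ₗ comul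
  map_add' f g := by ext h; simp [LinearMap.rTensor_add]
  map_smul' c f := by ext h; simp [LinearMap.rTensor_smul]

theorem rightTrans_apply (f : Module.Dual k H) (h : H) :
    rightTrans f h = TensorProduct.rid k H (LinearMap.lTensor H f (comul h)) := rfl

theorem leftTrans_apply (f : Module.Dual k H) (h : H) :
    leftTrans f h = TensorProduct.lid k H (LinearMap.rTensor H f (comul h)) := rfl

theorem rightTrans_rightTrans (f g : Module.Dual k H) (h : H) :
    rightTrans f (rightTrans g h) = rightTrans (f ⋆ g) h :=
  (DualGroupoid.mul_act (DualGroupoid.toDual.symm f) (DualGroupoid.toDual.symm g) h).symm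

/-- By coassociativity both sides are g(h₁)h₂f(h₃). -/
theorem rightTrans_leftTrans (f g : Module.Dual k H) (h : H) :
    rightTrans f (leftTrans g h) = leftTrans g (rightTrans f h) := by
  have h1 : ∀ t : H ⊗[k] H, rightTrans f (TensorProduct.lid k H (LinearMap.rTensor H g t)) =
      TensorProduct.lid k H (TensorProduct.map g
        ((TensorProduct.rid k H).toLinearMap ∘ₗ LinearMap.lTensor H f)
        (LinearMap.lTensor H comul t)) := by
    intro t
    induction t with
    | zero => simp
    | add x y hx hy => simp only [map_add, hx, hy]
    | tmul a b => simp [rightTrans_apply]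
  have h2 : ∀ t : H ⊗[k] H, leftTrans g (TensorProduct.rid k H (LinearMap.lTensor H f t)) =
      TensorProduct.rid k H (TensorProduct.map
        ((TensorProduct.lid k H).toLinearMap ∘ₗ LinearMap.rTensor H g) f
        (LinearMap.rTensor H comul t)) := by
    intro t
    induction t with
    | zero => simp
    | add x y hx hy => simp only [map_add, hx, hy]
    | tmul a b => simp [leftTrans_apply]
  rw [leftTrans_apply, h1, rightTrans_apply, h2, ← coassoc_apply]
  generalize LinearMap.rTensor H comul (comul (R := k) h) = u
  induction u with
  | zero => simp
  | add x y hx hy => simp only [map_add, hx, hy]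
  | tmul s b =>
    induction s with
    | zero => simp
    | add x y hx hy => simp only [map_add, TensorProduct.add_tmul, hx, hy]
    | tmul c d => simp [smul_smul]

/-- Coordinates turn Sweedler sums into finite sums of operators in h, whose traces can then be
taken. -/
theorem sum_rightTrans_tmul {ι : Type*} [Fintype ι] (b : Module.Basis ι k H) (h : H) :
    ∑ j, rightTrans (b.coord j) h ⊗ₜ b j = comul (R := k) h := by
  simp only [rightTrans_apply]
  generalize comul (R := k) h = t
  induction t with
  | zero => simp
  | add x y hx hy => simp only [map_add, TensorProduct.add_tmul, Finset.sum_add_distrib, hx, hy]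
  | tmul x y =>
    simp only [LinearMap.lTensor_tmul, TensorProduct.rid_tmul, Module.Basis.coord_apply,
      TensorProduct.smul_tmul, ← TensorProduct.tmul_sum, b.sum_repr]

/-- `g(h₁)h₂f(h₃) = (id ⊗ f)((g(h₁) ⊗ 1)Δ(h₂))` -/
theorem conv_rightTrans (g : H →ₗ[k] H) (f : Module.Dual k H) (h : H) :
    (g ⋆ rightTrans f) h =
      TensorProduct.rid k H (LinearMap.lTensor H f (((inl k H ∘ₗ g) ⋆ comul (R := k)) h)) := by
  rw [conv_apply, conv_apply]
  generalize comul (R := k) h = t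
  induction t with
  | zero => simp
  | add x y hx hy => simp only [map_add, hx, hy]
  | tmul a b =>
    simp only [TensorProduct.map_tmul, LinearMap.mul'_apply, rightTrans_apply,
      LinearMap.comp_apply, inl_apply]
    generalize comul (R := k) b = s
    induction s with
    | zero => simp
    | add x y hx hy => simp only [map_add, mul_add, hx, hy]
    | tmul c d => simp

/-- `S(h₁)h₂f(h₃) = 1₁f(h1₂)` -/
theorem antipode_conv_rightTrans (f : Module.Dual k H) (h : H) :
    (𝒮 ⋆ rightTrans f) h =
      TensorProduct.rid k H (LinearMap.lTensor H f (1 ⊗ₜ h * comul (R := k) (1 : H))) := by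
  have h1 : (comul (R := k) : H →ₗ[k] H ⊗[k] H) = inl k H ⋆ inr k H := by
    have h3 := inl_conv_inr (k := k) (LinearMap.id : H →ₗ[k] H) LinearMap.id
    rw [LinearMap.comp_id, LinearMap.comp_id, TensorProduct.map_id, LinearMap.id_comp] at h3
    exact h3.symm
  have h2 : (inl k H ∘ₗ 𝒮) ⋆ inl k H = inl k H ∘ₗ sourceCounit k := by
    rw [← antipode_conv_id, comp_conv _ inl_mul, LinearMap.comp_id]
  have h3 := inl_conv_inr (k := k) (sourceCounit k) (LinearMap.id : H →ₗ[k] H)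
  rw [LinearMap.comp_id] at h3
  have h4 : (inl k H ∘ₗ 𝒮) ⋆ comul (R := k) = TensorProduct.map (sourceCounit k) LinearMap.id ∘ₗ
      comul := by
    rw [← h3, ← h2, conv_assoc, ← h1]
  rw [conv_rightTrans, h4, ← rTensor_sourceCounit_comul]
  rfl

theorem rid_lTensor_comp_mulLeft (f : Module.Dual k H) (a : H) (t : H ⊗[k] H) :
    TensorProduct.rid k H (LinearMap.lTensor H (f ∘ₗ LinearMap.mulLeft k a) t) =
      TensorProduct.rid k H (LinearMap.lTensor H f (1 ⊗ₜ a * t)) := by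
  induction t with
  | zero => simp
  | add x y hx hy => simp only [map_add, mul_add, hx, hy]
  | tmul c d => simp

theorem rid_lTensor_mul (f : Module.Dual k H) (a : H) (t : H ⊗[k] H) :
    TensorProduct.rid k H (LinearMap.lTensor H f (a ⊗ₜ 1 * t)) =
      a * TensorProduct.rid k H (LinearMap.lTensor H f t) := by
  induction t with
  | zero => simp
  | add x y hx hy => simp only [map_add, mul_add, hx, hy]
  | tmul c d => simp

/-- `S(z)h₁f(h₂) = h₁f(zh₂)` for `z ∈ H_t` -/
theorem rightTrans_comp_mulLeft {z : H} (hz : targetCounit k z = z) (f : Module.Dual k H) (h : H) :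
    rightTrans (f ∘ₗ LinearMap.mulLeft k z) h = 𝒮 z * rightTrans f h := by
  rw [rightTrans_apply, rid_lTensor_comp_mulLeft, ← antipode_target_mul_comul hz, rid_lTensor_mul,
    rightTrans_apply]

variable [FiniteDimensional k H]

/-- `h₁f(S(g)h₂) = S²(g₂)(S(g₁)h)₁f((S(g₁)h)₂)` -/
theorem rightTrans_comp_mulLeft_antipode (f : Module.Dual k H) (g h : H) :
    rightTrans (f ∘ₗ LinearMap.mulLeft k (𝒮 g)) h = ∑ i ∈ (ℛ k g).index,
      𝒮 (𝒮 ((ℛ k g).right i)) * rightTrans f (𝒮 ((ℛ k g).left i) * h) := by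
  -- Inserting Δ(1) gives (1 ⊗ S(g))Δ(h) = (S²(g₂) ⊗ 1)Δ(S(g₁)h), to which id ⊗ f is applied.
  have h1 := antipode_antipode_mul_comul_antipode (k := k) g
  rw [← (ℛ k g).eq] at h1
  simp only [map_sum, TensorProduct.comm_tmul, TensorProduct.map_tmul, LinearMap.mul'_apply,
    LinearMap.comp_apply, inl_apply] at h1
  rw [rightTrans_apply, rid_lTensor_comp_mulLeft]
  have h2 : comul (R := k) h = comul (R := k) (1 : H) * comul (R := k) h := by
    rw [← comul_mul, one_mul]
  rw [h2, ← mul_assoc, ← h1, Finset.sum_mul, map_sum, map_sum]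
  refine Finset.sum_congr rfl fun i _ => ?_
  rw [mul_assoc, ← comul_mul, rid_lTensor_mul, rightTrans_apply]

/-- `g(x₁)x₂S(c) = g((xS(c₁))₁c₂)(xS(c₁))₂` -/
theorem leftTrans_mul_antipode {ι : Type*} [Fintype ι] (b : Module.Basis ι k H)
    (g : Module.Dual k H) (x c : H) : leftTrans g x * 𝒮 c =
      ∑ j, leftTrans (g ∘ₗ LinearMap.mulRight k (b j)) (x * 𝒮 (rightTrans (b.coord j) c)) := by
  have h1 := comul_antipode_conv_inl (k := k) c
  rw [conv_apply, ← sum_rightTrans_tmul b c] at h1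
  simp only [map_sum, TensorProduct.map_tmul, LinearMap.mul'_apply, LinearMap.comp_apply,
    inl_apply] at h1
  have h2 : ∀ t : H ⊗[k] H, TensorProduct.lid k H (LinearMap.rTensor H g (t * 1 ⊗ₜ 𝒮 c)) =
      TensorProduct.lid k H (LinearMap.rTensor H g t) * 𝒮 c := by
    intro t
    induction t with
    | zero => simp
    | add x y hx hy => simp only [map_add, add_mul, hx, hy]
    | tmul c d => simp
  have h3 : ∀ (a : H) (t : H ⊗[k] H), TensorProduct.lid k H
      (LinearMap.rTensor H (g ∘ₗ LinearMap.mulRight k a) t) =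
      TensorProduct.lid k H (LinearMap.rTensor H g (t * a ⊗ₜ 1)) := by
    intro a t
    induction t with
    | zero => simp
    | add x y hx hy => simp only [map_add, add_mul, hx, hy]
    | tmul c d => simp
  -- Inserting Δ(1) gives Δ(x)(1 ⊗ S(c)) = Δ(xS(c₁))(c₂ ⊗ 1), to which g ⊗ id is applied.
  have h4 : comul (R := k) x = comul (R := k) x * comul (R := k) (1 : H) := by
    rw [← comul_mul, mul_one]
  rw [leftTrans_apply, ← h2, h4, mul_assoc, ← h1, Finset.mul_sum, map_sum, map_sum]
  refine Finset.sum_congr rfl fun j _ => ?_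
  rw [leftTrans_apply, h3, comul_mul, mul_assoc]

/-- `(S(u₂)v)₁g(u₁(S(u₂)v)₂) = S(u)v₁g(v₂)` -/
theorem sum_rightTrans_antipode_leftTrans {ι : Type*} [Fintype ι] (b : Module.Basis ι k H)
    (g : Module.Dual k H) (u v : H) :
    ∑ j, rightTrans (b.coord j) (𝒮 (leftTrans (g ∘ₗ LinearMap.mulRight k (b j)) u) * v) =
      𝒮 u * rightTrans g v := by
  have h1 := inr_conv_comul_antipode (k := k) u
  rw [conv_apply] at h1
  have h2 : ∀ a w : H, ∑ j, g (a * b j) • rightTrans (b.coord j) w =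
      TensorProduct.rid k H (LinearMap.lTensor H g (1 ⊗ₜ a * comul (R := k) w)) := by
    intro a w
    rw [← sum_rightTrans_tmul b w]
    simp [Finset.mul_sum]
  have h3 : ∀ t : H ⊗[k] H, ∑ j, rightTrans (b.coord j) (𝒮 (TensorProduct.lid k H
      (LinearMap.rTensor H (g ∘ₗ LinearMap.mulRight k (b j)) t)) * v) =
      TensorProduct.rid k H (LinearMap.lTensor H g (LinearMap.mul' k (H ⊗[k] H)
        (TensorProduct.map (inr k H) (comul (R := k) ∘ₗ 𝒮) t) * comul (R := k) v)) := by
    intro t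
    induction t with
    | zero => simp
    | add x y hx hy => simp only [map_add, add_mul, Finset.sum_add_distrib, hx, hy]
    | tmul c d => simp [h2, mul_assoc, comul_mul]
  simp only [leftTrans_apply, h3, h1]
  rw [mul_assoc, ← comul_mul, one_mul, rid_lTensor_mul, rightTrans_apply]

end translation

/-! ### Integrals obtained from traces -/

section integral

/-- The linear form `x ↦ Tr(h ↦ xS²(h₁)f(h₂))`; it is a left integral of the dual. -/
noncomputable def traceIntegral : Module.Dual k H →ₗ[k] H →ₗ[k] k :=
  LinearMap.mk₂ k (fun f x => LinearMap.trace k H (LinearMap.mulLeft k x ∘ₗ 𝒮 ∘ₗ 𝒮 ∘ₗ rightTrans f))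
    (fun f g x => by simp only [map_add, LinearMap.comp_add])
    (fun c f x => by simp only [map_smul, LinearMap.comp_smul])
    (fun f x y => by
      rw [← map_add, ← LinearMap.add_comp]
      congr 2
      ext
      simp [add_mul])
    (fun c f x => by
      rw [← map_smul, ← LinearMap.smul_comp]
      congr 2
      ext
      simp)

theorem traceIntegral_apply (f : Module.Dual k H) (x : H) : traceIntegral f x =
    LinearMap.trace k H (LinearMap.mulLeft k x ∘ₗ 𝒮 ∘ₗ 𝒮 ∘ₗ rightTrans f) := rfl

/-- Since h₁f(zh₂) = S(z)h₁f(h₂), applying S² produces the left factor S³(z). A change of f by H_t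
thus becomes a change of the argument. -/
theorem traceIntegral_mul_antipode_target {z : H} (hz : targetCounit k z = z)
    (f : Module.Dual k H) (x : H) : traceIntegral f (x * 𝒮 (𝒮 (𝒮 z))) =
      traceIntegral (f ∘ₗ LinearMap.mulLeft k z) x := by
  rw [traceIntegral_apply, traceIntegral_apply]
  congr 1
  ext h
  simp [rightTrans_comp_mulLeft hz, antipode_mul]

variable [FiniteDimensional k H]

/-- By `rightTrans_comp_mulLeft_antipode` the operator is a sum of terms that begin with left
multiplication by S(g₁); cyclicity of the trace moves it to the other end. -/
theorem traceIntegral_comp_mulLeft_antipode (f : Module.Dual k H) (g x : H) :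
    traceIntegral (f ∘ₗ LinearMap.mulLeft k (𝒮 g)) x = ∑ i ∈ (ℛ k g).index,
      traceIntegral f (𝒮 ((ℛ k g).left i) * x * 𝒮 (𝒮 (𝒮 (𝒮 ((ℛ k g).right i))))) := by
  have h1 : LinearMap.mulLeft k x ∘ₗ 𝒮 ∘ₗ 𝒮 ∘ₗ rightTrans (f ∘ₗ LinearMap.mulLeft k (𝒮 g)) =
      ∑ i ∈ (ℛ k g).index, (LinearMap.mulLeft k (x * 𝒮 (𝒮 (𝒮 (𝒮 ((ℛ k g).right i))))) ∘ₗ 𝒮 ∘ₗ 𝒮 ∘ₗ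
        rightTrans f) ∘ₗ LinearMap.mulLeft k (𝒮 ((ℛ k g).left i)) := by
    ext h
    simp [rightTrans_comp_mulLeft_antipode, antipode_mul, LinearMap.sum_apply]
  rw [traceIntegral_apply, h1, map_sum]
  refine Finset.sum_congr rfl fun i _ => ?_
  rw [LinearMap.trace_comp_comm', traceIntegral_apply]
  congr 1
  ext h
  simp [mul_assoc]

/-- A linear form is recovered from its integrals. -/
theorem sum_traceIntegral {ι : Type*} [Fintype ι] (b : Module.Basis ι k H) (f : Module.Dual k H)
    (x : H) : ∑ j, traceIntegral (b.coord j) (x * 𝒮 (rightTrans f (b j))) = f x := by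
  simp only [traceIntegral_apply, ← map_sum]
  obtain ⟨s, hs⟩ := TensorProduct.exists_finset (comul (R := k) (1 : H))
  -- Since S(b)S²(a) = S(S(a)b), the sum over j collapses to h ↦ xS(S(h₁)h₂f(h₃)) = xS(1₁)f(h1₂).
  -- This is a sum of rank one operators, with total trace f(xS(1₁)1₂) = f(x).
  have h1 : ∑ j, LinearMap.mulLeft k (x * 𝒮 (rightTrans f (b j))) ∘ₗ 𝒮 ∘ₗ 𝒮 ∘ₗ
      rightTrans (b.coord j) =
      ∑ i ∈ s, (f ∘ₗ LinearMap.mulRight k i.2).smulRight (x * 𝒮 i.1) := by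
    ext h
    have h2 := congrArg 𝒮 (antipode_conv_rightTrans f h)
    rw [conv_apply, ← sum_rightTrans_tmul b h, hs] at h2
    simp only [map_sum, TensorProduct.map_tmul, LinearMap.mul'_apply, antipode_mul,
      Finset.mul_sum, Algebra.TensorProduct.tmul_mul_tmul, one_mul, LinearMap.lTensor_tmul,
      TensorProduct.rid_tmul, map_smul] at h2
    have h3 := congrArg (fun y => x * y) h2
    simp only [Finset.mul_sum] at h3
    simpa [LinearMap.sum_apply, mul_assoc] using h3
  rw [h1, map_sum]
  simp only [LinearMap.trace_smulRight, LinearMap.comp_apply, LinearMap.mulRight_apply]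
  have h4 := mul_rTensor_antipode (k := k) (1 : H)
  rw [sourceCounit_one, hs] at h4
  simp only [map_sum, LinearMap.rTensor_tmul, LinearMap.mul'_apply] at h4
  rw [← map_sum]
  simp only [mul_assoc, ← Finset.mul_sum, h4, mul_one]

/-- `λ(x₂S(b))g(x₁) = λ(xS(b₁))g(b₂)` for the integrals `λ` obtained from traces. -/
theorem traceIntegral_leftTrans_mul_antipode (f g : Module.Dual k H) (x c : H) :
    traceIntegral f (leftTrans g x * 𝒮 c) = traceIntegral f (x * 𝒮 (rightTrans g c)) := by
  let b := Module.finBasis k H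
  -- Let Aⱼ be left translation by g(· bⱼ) and R right translation by f. The maps Mⱼ are chosen so
  -- that the two operators are ∑ AⱼMⱼR and ∑ MⱼRAⱼ, which have equal traces; the second form uses
  -- that R and Aⱼ commute.
  let M : Fin (Module.finrank k H) → H →ₗ[k] H := fun j =>
    LinearMap.mulLeft k x ∘ₗ 𝒮 ∘ₗ rightTrans (b.coord j) ∘ₗ LinearMap.mulRight k c ∘ₗ 𝒮
  have h1 : LinearMap.mulLeft k (leftTrans g x * 𝒮 c) ∘ₗ 𝒮 ∘ₗ 𝒮 ∘ₗ rightTrans f =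
      ∑ j, leftTrans (g ∘ₗ LinearMap.mulRight k (b j)) ∘ₗ M j ∘ₗ rightTrans f := by
    ext h
    simp only [LinearMap.comp_apply, LinearMap.mulLeft_apply, LinearMap.sum_apply, M,
      LinearMap.mulRight_apply]
    rw [mul_assoc, ← antipode_mul, leftTrans_mul_antipode b]
  have h2 : LinearMap.mulLeft k (x * 𝒮 (rightTrans g c)) ∘ₗ 𝒮 ∘ₗ 𝒮 ∘ₗ rightTrans f =
      ∑ j, (M j ∘ₗ rightTrans f) ∘ₗ leftTrans (g ∘ₗ LinearMap.mulRight k (b j)) := by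
    ext h
    simp only [LinearMap.comp_apply, LinearMap.mulLeft_apply, LinearMap.sum_apply, M,
      LinearMap.mulRight_apply, rightTrans_leftTrans]
    rw [← Finset.mul_sum, ← map_sum, sum_rightTrans_antipode_leftTrans b, antipode_mul, mul_assoc]
  rw [traceIntegral_apply, traceIntegral_apply, h1, h2, map_sum, map_sum]
  exact Finset.sum_congr rfl fun j _ => LinearMap.trace_comp_comm' _ _

end integral

end WeakHopfAlgebra

namespace WeakHopfAlgebra

variable {k H : Type*} [Field k] [Ring H] [Algebra k H] [Coalgebra k H] [WeakHopfAlgebra k H]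

local infixl:70 " ⋆ " => conv

local notation "𝒮" => antipode (k := k) (H := H)

/-! ### Separability of the target counital subalgebra -/

section separable

variable (k H) in
-- The restrictions of S to H_t → H_s and H_s → H_t have explicit right inverses, available before S
-- is known to be injective on H.
theorem antipode_antipode_surjective_target {z : H} (hz : targetCounit k z = z) :
    ∃ w : H, targetCounit k w = w ∧ 𝒮 (𝒮 w) = z := by
  refine ⟨sourceToTarget (k := k) (targetToSource (k := k) z), targetCounit_sourceToTarget _, ?_⟩
  rw [antipode_sourceToTarget (sourceCounit_targetToSource z), antipode_targetToSource hz]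

variable (k H) in
/-- The element `S(1₁) ⊗ 1₂` is a separability idempotent of `H_t`. -/
theorem exists_separability : ∃ (s : Finset (H × H)) (p q : H × H → H),
    (∀ i, targetCounit k (p i) = p i) ∧ (∀ i, targetCounit k (q i) = q i) ∧
    (∑ i ∈ s, p i * q i = 1) ∧ (∑ i ∈ s, counit (R := k) (q i) • p i = 1) ∧
    (∀ z, targetCounit k z = z →
      ∑ i ∈ s, (z * p i) ⊗ₜ[k] q i = ∑ i ∈ s, p i ⊗ₜ[k] (q i * z)) ∧
    (∀ z, targetCounit k z = z →
      ∑ i ∈ s, p i ⊗ₜ[k] (z * q i) = ∑ i ∈ s, (p i * 𝒮 (𝒮 z)) ⊗ₜ[k] q i) := by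
  obtain ⟨s, hs⟩ := TensorProduct.exists_finset (comul (R := k) (1 : H))
  -- In this form the two legs lie in H_s and H_t term by term, so S(1₁) and 1₂ are in H_t for each
  -- summand.
  have h1 : comul (R := k) (1 : H) = ∑ i ∈ s, sourceCounit k i.1 ⊗ₜ[k] targetCounit k i.2 := by
    conv_lhs => rw [← lTensor_targetCounit_comul_one, ← rTensor_sourceCounit_comul_one, hs]
    simp
  refine ⟨s, fun i => 𝒮 (sourceCounit k i.1), fun i => targetCounit k i.2,
    fun i => antipode_source_mem (sourceCounit_idem k _), fun i => targetCounit_idem k _,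
    ?_, ?_, fun z hz => ?_, fun z hz => ?_⟩
  · have h2 := mul_rTensor_antipode (k := k) (1 : H)
    rw [sourceCounit_one, h1] at h2
    simpa using h2
  · have h2 := congrArg 𝒮 (congrArg (TensorProduct.rid k H)
      (lTensor_counit_comul (R := k) (1 : H)))
    rw [h1] at h2
    simpa [antipode_one] using h2
  -- Write z = S(y) with y in H_s and apply S ⊗ id to 1₁y ⊗ 1₂ = 1₁ ⊗ 1₂S(y).
  · have h2 := congrArg (LinearMap.rTensor H 𝒮)
      (comul_one_mul_antipode_source (sourceCounit_targetToSource (k := k) z))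
    rw [antipode_targetToSource hz, h1] at h2
    simpa [Finset.sum_mul, antipode_mul, antipode_targetToSource hz] using h2
  · have h2 := congrArg (LinearMap.rTensor H 𝒮) (antipode_target_mul_comul_one hz)
    rw [h1] at h2
    simpa [Finset.mul_sum, antipode_mul] using h2.symm

/-- A two-sided ideal of `H_t` is generated by a central idempotent fixed by `S²`. -/
theorem exists_central_idempotent (J : Submodule k H) (hJ : ∀ z ∈ J, targetCounit k z = z)
    (hl : ∀ z ∈ J, ∀ w, targetCounit k w = w → w * z ∈ J)
    (hr : ∀ z ∈ J, ∀ w, targetCounit k w = w → z * w ∈ J) :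
    ∃ e ∈ J, (∀ z ∈ J, e * z = z) ∧ 𝒮 (𝒮 e) = e := by
  obtain ⟨s, p, q, hp, hq, hpq, hε, hz, hz'⟩ := exists_separability k H
  obtain ⟨P, hP⟩ := J.subtype.exists_leftInverse_of_injective (Submodule.ker_subtype J)
  have hP' : ∀ z ∈ J, (P z : H) = z := fun z hzJ =>
    congrArg Subtype.val (LinearMap.congr_fun hP ⟨z, hzJ⟩)
  have bal : ∀ (F G : H →ₗ[k] H) (z : H), z ∈ J →
      ∑ i ∈ s, F (z * p i) * G (q i) = ∑ i ∈ s, F (p i) * G (q i * z) := by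
    intro F G z hzJ
    simpa using congrArg (LinearMap.mul' k H ∘ₗ TensorProduct.map F G) (hz z (hJ z hzJ))
  -- P is a linear projection onto J. The relation zp ⊗ q = p ⊗ qz makes its average e a left unit
  -- of J.
  set e : H := ∑ i ∈ s, (P (p i) : H) * q i with he
  have heJ : e ∈ J := J.sum_mem fun i _ => hr _ (P (p i)).2 _ (hq i)
  have hez : ∀ z ∈ J, e * z = z := by
    intro z hzJ
    have h1 := bal (J.subtype ∘ₗ P) LinearMap.id z hzJ
    simp only [LinearMap.comp_apply, Submodule.subtype_apply, LinearMap.id_apply] at h1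
    rw [he, Finset.sum_mul]
    simp only [mul_assoc]
    rw [← h1]
    calc ∑ i ∈ s, (P (z * p i) : H) * q i = ∑ i ∈ s, z * (p i * q i) :=
          Finset.sum_congr rfl fun i _ => by rw [hP' _ (hr z hzJ _ (hp i)), mul_assoc]
      _ = z := by rw [← Finset.mul_sum, hpq, mul_one]
  have hze : ∀ z ∈ J, z * e = z := by
    intro z hzJ
    -- The defect u lies in J and satisfies uJ = 0. The sum ∑ u pᵢ e qᵢ vanishes because pᵢe is in
    -- J; balanced to the other side it is ∑ pᵢ e qᵢ u = u.
    set u := z - z * e with hu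
    have huJ : u ∈ J := J.sub_mem hzJ (hr z hzJ e (hJ e heJ))
    have hu0 : ∀ w ∈ J, u * w = 0 := by
      intro w hw
      rw [hu, sub_mul, mul_assoc, hez w hw, sub_self]
    have h1 := bal (LinearMap.mulRight k e) LinearMap.id u huJ
    simp only [LinearMap.mulRight_apply, LinearMap.id_apply] at h1
    have h2 : ∑ i ∈ s, u * p i * e * q i = 0 := Finset.sum_eq_zero fun i _ => by
      rw [mul_assoc u, hu0 _ (hl e heJ _ (hp i)), zero_mul]
    have h3 : ∑ i ∈ s, p i * e * (q i * u) = u := by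
      calc ∑ i ∈ s, p i * e * (q i * u) = ∑ i ∈ s, p i * q i * u :=
            Finset.sum_congr rfl fun i _ => by
              rw [mul_assoc, hez _ (hl u huJ _ (hq i)), mul_assoc]
        _ = u := by rw [← Finset.sum_mul, hpq, one_mul]
    have h4 : u = 0 := by rw [← h3, ← h1, h2]
    exact (sub_eq_zero.1 h4).symm
  have hcomm : ∀ w, targetCounit k w = w → w * e = e * w := by
    intro w hw
    rw [← hez _ (hl e heJ w hw), ← mul_assoc, hze _ (hr e heJ w hw)]
  refine ⟨e, heJ, hez, ?_⟩
  -- The relation defining S² on the idempotent is compared with the balance relation for the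
  -- central element e. Applying id ⊗ ε and using ∑ ε(qᵢ)pᵢ = 1 then extracts S²(e) = e.
  have h1 : ∑ i ∈ s, (p i * 𝒮 (𝒮 e)) ⊗ₜ[k] q i = ∑ i ∈ s, (p i * e) ⊗ₜ[k] q i := by
    rw [← hz' e (hJ e heJ)]
    calc ∑ i ∈ s, p i ⊗ₜ[k] (e * q i) = ∑ i ∈ s, p i ⊗ₜ[k] (q i * e) :=
          Finset.sum_congr rfl fun i _ => by rw [hcomm _ (hq i)]
      _ = ∑ i ∈ s, (e * p i) ⊗ₜ[k] q i := (hz e (hJ e heJ)).symm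
      _ = ∑ i ∈ s, (p i * e) ⊗ₜ[k] q i :=
          Finset.sum_congr rfl fun i _ => by rw [hcomm _ (hp i)]
  have h2 := congrArg (projLeft k H) h1
  simp only [projLeft, map_sum, LinearMap.comp_apply, LinearMap.lTensor_tmul, LinearEquiv.coe_coe,
    TensorProduct.rid_tmul, ← smul_mul_assoc] at h2
  rwa [← Finset.sum_mul, ← Finset.sum_mul, hε, one_mul, one_mul] at h2

end separable

/-! ### Bijectivity of the antipode -/

section bijective

variable (k H) in
/-- The elements `z` of `H_t` such that all the forms `traceIntegral (f(z ·))` vanish. -/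
noncomputable def integralAnnihilator : Submodule k H where
  carrier := {z | targetCounit k z = z ∧
    ∀ (f : Module.Dual k H) (x : H), traceIntegral (f ∘ₗ LinearMap.mulLeft k z) x = 0}
  add_mem' := by
    rintro z w ⟨hz, hz'⟩ ⟨hw, hw'⟩
    refine ⟨by rw [map_add, hz, hw], fun f x => ?_⟩
    have h1 : f ∘ₗ LinearMap.mulLeft k (z + w) =
        f ∘ₗ LinearMap.mulLeft k z + f ∘ₗ LinearMap.mulLeft k w := by
      ext
      simp [add_mul]
    rw [h1, map_add, LinearMap.add_apply, hz', hw', add_zero]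
  zero_mem' := by
    refine ⟨map_zero _, fun f x => ?_⟩
    rw [LinearMap.mulLeft_zero_eq_zero, LinearMap.comp_zero, map_zero, LinearMap.zero_apply]
  smul_mem' := by
    rintro c z ⟨hz, hz'⟩
    refine ⟨by rw [map_smul, hz], fun f x => ?_⟩
    have h1 : f ∘ₗ LinearMap.mulLeft k (c • z) = c • (f ∘ₗ LinearMap.mulLeft k z) := by
      ext
      simp
    rw [h1, map_smul, LinearMap.smul_apply, hz', smul_zero]

theorem comp_mulLeft_mul (f : Module.Dual k H) (a b : H) :
    f ∘ₗ LinearMap.mulLeft k (a * b) = (f ∘ₗ LinearMap.mulLeft k a) ∘ₗ LinearMap.mulLeft k b := by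
  ext
  simp

variable [FiniteDimensional k H]

/-- Here ε_t(hz) = h₁zS(h₂). `traceIntegral_comp_mulLeft_antipode` removes S(h₂) from the form at
the cost of changing the argument, and what remains has the shape f'(z ·). -/
theorem adjoint_mem_integralAnnihilator {z : H} (hz : z ∈ integralAnnihilator k H) (h : H) :
    targetCounit k (h * z) ∈ integralAnnihilator k H := by
  refine ⟨targetCounit_idem k _, fun f x => ?_⟩
  have h1 : targetCounit k (h * z) =
      ∑ i ∈ (ℛ k h).index, (ℛ k h).left i * z * 𝒮 ((ℛ k h).right i) := by
    rw [targetCounit_mul_eq, hz.1, conv_apply, ← (ℛ k h).eq]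
    simp [mul_assoc]
  have h2 : f ∘ₗ LinearMap.mulLeft k (targetCounit k (h * z)) = ∑ i ∈ (ℛ k h).index,
      f ∘ₗ LinearMap.mulLeft k ((ℛ k h).left i * z * 𝒮 ((ℛ k h).right i)) := by
    ext x
    simp [h1, Finset.sum_mul, LinearMap.sum_apply, mul_assoc]
  rw [h2, map_sum, LinearMap.sum_apply]
  refine Finset.sum_eq_zero fun i _ => ?_
  rw [comp_mulLeft_mul, traceIntegral_comp_mulLeft_antipode]
  refine Finset.sum_eq_zero fun j _ => ?_
  rw [comp_mulLeft_mul]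
  exact hz.2 _ _

variable (k H) in
-- The generating idempotent e satisfies λ_f(xS(e)) = λ_f(xS³(e)) = λ_{f(e ·)}(x) = 0. As all linear
-- forms are recovered from the λ_f, this is enough to force S(e) = 0, and S is injective on H_t.
theorem integralAnnihilator_eq_bot : integralAnnihilator k H = ⊥ := by
  obtain ⟨e, heJ, hez, hee⟩ := exists_central_idempotent (integralAnnihilator k H)
    (fun z hz => hz.1)
    (fun z hz w hw => ⟨(targetSubalgebra k H).mul_mem hw hz.1, fun f x => by
      rw [comp_mulLeft_mul]
      exact hz.2 _ _⟩)
    (fun z hz w hw => ⟨(targetSubalgebra k H).mul_mem hz.1 hw, fun f x => by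
      rw [comp_mulLeft_mul, ← traceIntegral_mul_antipode_target hw]
      exact hz.2 _ _⟩)
  have h1 : ∀ (f : Module.Dual k H) (x : H), traceIntegral f (x * 𝒮 e) = 0 := by
    intro f x
    have h2 := traceIntegral_mul_antipode_target heJ.1 f x
    rwa [hee, heJ.2] at h2
  -- One has ce = c₁eS(c₂)c₃ = ε_t(c₁e)c₂, where ε_t(c₁e) lies in J and is therefore fixed by left
  -- multiplication by e.
  have h2 : ∀ c : H, c * e = e * (c * e) := by
    intro c
    have h3 : ∀ y : H, sourceCounit k y * e = e * sourceCounit k y := fun y =>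
      (target_mul_source heJ.1 (sourceCounit_idem k y)).symm
    have h4 : c * e = LinearMap.mul' k H (TensorProduct.map
        (targetCounit k ∘ₗ LinearMap.mulRight k e) LinearMap.id (comul (R := k) c)) := by
      have h5 : targetCounit k ∘ₗ LinearMap.mulRight k e =
          LinearMap.id ⋆ (LinearMap.mulLeft k e ∘ₗ 𝒮) := by
        ext a
        rw [LinearMap.comp_apply, LinearMap.mulRight_apply, targetCounit_mul_eq, heJ.1]
      have h6 : (LinearMap.id ⋆ (LinearMap.mulLeft k e ∘ₗ 𝒮)) ⋆ LinearMap.id =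
          LinearMap.mulRight k e := by
        have h7 : LinearMap.mulLeft k e ∘ₗ sourceCounit k =
            LinearMap.mulRight k e ∘ₗ sourceCounit k := by
          ext y
          simp [h3]
        rw [conv_assoc, mulLeft_conv, antipode_conv_id, h7, conv_mulRight, id_conv_sourceCounit,
          LinearMap.comp_id]
      rw [← conv_apply, h5, h6, LinearMap.mulRight_apply]
    have h8 : ∀ t : H ⊗[k] H, e * LinearMap.mul' k H (TensorProduct.map
        (targetCounit k ∘ₗ LinearMap.mulRight k e) LinearMap.id t) =
        LinearMap.mul' k H (TensorProduct.map
        (targetCounit k ∘ₗ LinearMap.mulRight k e) LinearMap.id t) := by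
      intro t
      induction t with
      | zero => simp
      | add x y hx hy => simp only [map_add, mul_add, hx, hy]
      | tmul a b =>
        simp only [TensorProduct.map_tmul, LinearMap.mul'_apply, LinearMap.comp_apply,
          LinearMap.mulRight_apply, ← mul_assoc, hez _ (adjoint_mem_integralAnnihilator heJ a)]
    rw [h4, h8]
  have h3 : 𝒮 e = 0 := by
    rw [← Module.forall_dual_apply_eq_zero_iff k]
    intro f
    rw [← sum_traceIntegral (Module.finBasis k H) f (𝒮 e)]
    refine Finset.sum_eq_zero fun j _ => ?_
    -- S(e)S(y) = S(ye) = S(e(ye)) = S(ye)S(e) ends in S(e), so `h1` applies.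
    rw [← antipode_mul, h2, antipode_mul]
    exact h1 _ _
  have h4 := eq_zero_of_antipode_target heJ.1 h3
  rw [eq_bot_iff]
  intro z hz
  rw [← hez z hz, h4, zero_mul]
  exact Submodule.zero_mem _

variable (k H) in
/-- The antipode of a finite quantum groupoid is injective. -/
theorem antipode_injective : Function.Injective 𝒮 := by
  rw [injective_iff_map_eq_zero]
  intro a ha
  let b := Module.finBasis k H
  -- By the integral identity this is λ_f(g(x₁)x₂S(a)).
  have h1 : ∀ (f g : Module.Dual k H) (x : H), traceIntegral f (x * 𝒮 (rightTrans g a)) = 0 := by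
    intro f g x
    rw [← traceIntegral_leftTrans_mul_antipode, ha, mul_zero, map_zero]
  -- For a' = a₁g(a₂) one has S(ε_t(a')) = S²(a'₂)S(a'₁), so `h1` gives λ_f(xS(ε_t(a'))) = 0.
  -- Writing ε_t(a') = S²(w) with w in H_t puts w in the annihilator, which is zero.
  have h2 : ∀ g : Module.Dual k H, targetCounit k (rightTrans g a) = 0 := by
    intro g
    obtain ⟨w, hw, hwz⟩ := antipode_antipode_surjective_target k H
      (targetCounit_idem k (rightTrans g a))
    have h3 : ∀ (f : Module.Dual k H) (x : H),
        traceIntegral f (x * 𝒮 (targetCounit k (rightTrans g a))) = 0 := by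
      intro f x
      rw [← mul_lTensor_antipode, ← sum_rightTrans_tmul b]
      simp only [map_sum, LinearMap.lTensor_tmul, LinearMap.mul'_apply, antipode_mul,
        Finset.mul_sum, ← mul_assoc, rightTrans_rightTrans]
      exact Finset.sum_eq_zero fun j _ => h1 _ _ _
    have h4 : w ∈ integralAnnihilator k H := by
      refine ⟨hw, fun f x => ?_⟩
      rw [← traceIntegral_mul_antipode_target hw, hwz]
      exact h3 f x
    rw [integralAnnihilator_eq_bot, Submodule.mem_bot] at h4
    rw [← hwz, h4, map_zero, map_zero]
  rw [← targetCounit_mul k a, ← sum_rightTrans_tmul b a]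
  simp [h2]

variable (k H) in
/-- The antipode as a linear equivalence. -/
noncomputable def antipodeEquiv : H ≃ₗ[k] H :=
  LinearEquiv.ofInjectiveEndo 𝒮 (antipode_injective k H)

theorem antipode_antipodeEquiv_symm (h : H) : 𝒮 ((antipodeEquiv k H).symm h) = h :=
  (antipodeEquiv k H).apply_symm_apply h

/-- `h₂S⁻¹(h₁) = 1₁ε(1₂h)` -/
theorem mul_comm_antipodeEquiv_symm (h : H) :
    LinearMap.mul' k H (TensorProduct.map LinearMap.id (antipodeEquiv k H).symm.toLinearMap
      (TensorProduct.comm k H H (comul (R := k) h))) = targetToSource (k := k) h := by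
  -- S sends h₂S⁻¹(h₁) to h₁S(h₂) = ε_t(h), and it sends 1₁ε(1₂h) to the same element.
  apply antipode_injective k H
  rw [antipode_of_source (sourceCounit_targetToSource h), targetCounit_targetToSource,
    ← mul_lTensor_antipode]
  generalize comul (R := k) h = t
  induction t with
  | zero => simp
  | add x y hx hy => simp only [map_add, hx, hy]
  | tmul a b => simp [antipode_mul, antipode_antipodeEquiv_symm]

/-- `S⁻¹(h₂)h₁ = ε(h1₁)1₂` -/
theorem antipodeEquiv_symm_mul_comm (h : H) :
    LinearMap.mul' k H (TensorProduct.map (antipodeEquiv k H).symm.toLinearMap LinearMap.id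
      (TensorProduct.comm k H H (comul (R := k) h))) = sourceToTarget (k := k) h := by
  apply antipode_injective k H
  rw [antipode_of_target (targetCounit_sourceToTarget h), sourceCounit_sourceToTarget,
    ← mul_rTensor_antipode]
  generalize comul (R := k) h = t
  induction t with
  | zero => simp
  | add x y hx hy => simp only [map_add, hx, hy]
  | tmul a b => simp [antipode_mul, antipode_antipodeEquiv_symm]

end bijective

end WeakHopfAlgebra

namespace WeakHopfAlgebra

variable {k H : Type*} [Field k] [Ring H] [Algebra k H] [Coalgebra k H] [WeakHopfAlgebra k H]

local notation "𝒮" => antipode (k := k) (H := H)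

/-! ### Semisimplicity -/

section semisimple

theorem target_op_smul (z : (targetSubalgebra k H).op) (h : H) :
    z • h = h * MulOpposite.unop (z : Hᵐᵒᵖ) := rfl

/-- Every right `H_t`-submodule of `H` is a direct summand. -/
theorem isSemisimpleModule_target_op : IsSemisimpleModule (targetSubalgebra k H).op H := by
  refine (isSemisimpleModule_iff _ _).2 ⟨fun N => ?_⟩
  obtain ⟨s, p, q, hp, hq, hpq, -, hz, -⟩ := exists_separability k H
  obtain ⟨P, hP⟩ := (N.restrictScalars k).subtype.exists_leftInverse_of_injective
    (Submodule.ker_subtype _)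
  have hP' : ∀ z ∈ N, (P z : H) = z := fun z hzN =>
    congrArg Subtype.val (LinearMap.congr_fun hP ⟨z, hzN⟩)
  have hN : ∀ n ∈ N, ∀ z, targetCounit k z = z → n * z ∈ N := fun n hn z hz =>
    N.smul_mem (⟨MulOpposite.op z, hz⟩ : (targetSubalgebra k H).op) hn
  -- Maschke-type averaging of the linear projection P; the relation zp ⊗ q = p ⊗ qz makes Q linear
  -- over H_t.
  let Q : H →ₗ[(targetSubalgebra k H).op] N :=
    { toFun := fun h => ⟨∑ i ∈ s, (P (h * p i) : H) * q i,
        N.sum_mem fun i _ => hN _ (P (h * p i)).2 _ (hq i)⟩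
      map_add' := fun x y => by
        ext
        simp [add_mul, Finset.sum_add_distrib]
      map_smul' := fun z x => by
        ext
        have h1 := congrArg (LinearMap.mul' k H ∘ₗ TensorProduct.map
          ((N.restrictScalars k).subtype ∘ₗ P ∘ₗ LinearMap.mulLeft k x) LinearMap.id)
          (hz (MulOpposite.unop (z : Hᵐᵒᵖ)) z.2)
        simp only [map_sum, LinearMap.comp_apply, TensorProduct.map_tmul, LinearMap.mul'_apply,
          LinearMap.mulLeft_apply, LinearMap.id_apply, Submodule.subtype_apply] at h1
        simp only [target_op_smul, RingHom.id_apply, Submodule.coe_smul, Finset.sum_mul, mul_assoc]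
        exact h1 }
  refine ⟨LinearMap.ker Q, LinearMap.isCompl_of_proj fun n => ?_⟩
  ext
  change ∑ i ∈ s, (P ((n : H) * p i) : H) * q i = n
  calc ∑ i ∈ s, (P ((n : H) * p i) : H) * q i = ∑ i ∈ s, (n : H) * (p i * q i) :=
        Finset.sum_congr rfl fun i _ => by rw [hP' _ (hN _ n.2 _ (hp i)), mul_assoc]
    _ = n := by rw [← Finset.mul_sum, hpq, mul_one]

theorem isSemisimpleRing_end_target_op [FiniteDimensional k H] :
    IsSemisimpleRing (Module.End (targetSubalgebra k H).op H) := by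
  have := isSemisimpleModule_target_op (k := k) (H := H)
  have : Module.Finite (targetSubalgebra k H).op H := Module.Finite.of_restrictScalars_finite k _ _
  exact IsSemisimpleRing.moduleEnd _ _

end semisimple

/-! ### Convolution in the opposite order -/

section opposite

variable {A : Type*} [Ring A] [Algebra k A]

/-- The product `h ↦ f(h₂)g(h₁)`. -/
noncomputable def convOp (f g : H →ₗ[k] A) : H →ₗ[k] A :=
  LinearMap.mul' k A ∘ₗ TensorProduct.map f g ∘ₗ (TensorProduct.comm k H H).toLinearMap ∘ₗ comul

local infixl:70 " ⋆ᵒ " => convOp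

theorem convOp_apply (f g : H →ₗ[k] A) (h : H) : (f ⋆ᵒ g) h =
    LinearMap.mul' k A (TensorProduct.map f g (TensorProduct.comm k H H (comul (R := k) h))) := rfl

theorem convOp_assoc (f g u : H →ₗ[k] A) : f ⋆ᵒ g ⋆ᵒ u = f ⋆ᵒ (g ⋆ᵒ u) := by
  -- With values in the opposite algebra, ⋆ᵒ is ordinary convolution with the factors exchanged.
  have h1 : ∀ f g : H →ₗ[k] A, (MulOpposite.opLinearEquiv k).toLinearMap ∘ₗ (f ⋆ᵒ g) =
      conv ((MulOpposite.opLinearEquiv k).toLinearMap ∘ₗ g)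
        ((MulOpposite.opLinearEquiv k).toLinearMap ∘ₗ f) := by
    intro f g
    ext h
    simp only [LinearMap.comp_apply, convOp_apply, conv_apply]
    generalize comul (R := k) h = t
    induction t with
    | zero => simp
    | add x y hx hy => simp only [map_add, hx, hy]
    | tmul a b => simp
  ext h
  apply (MulOpposite.opLinearEquiv k).injective
  have h2 := conv_assoc ((MulOpposite.opLinearEquiv k).toLinearMap ∘ₗ u)
    ((MulOpposite.opLinearEquiv k).toLinearMap ∘ₗ g)
    ((MulOpposite.opLinearEquiv k).toLinearMap ∘ₗ f)
  rw [← h1, ← h1, ← h1, ← h1] at h2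
  exact (LinearMap.congr_fun h2 h).symm

/-- `h₂ε(h₁1₁)1₂ = h` -/
theorem id_convOp_sourceToTarget :
    LinearMap.id ⋆ᵒ sourceToTarget (k := k) = (LinearMap.id : H →ₗ[k] H) := by
  ext h
  -- The sum h₂ε(h₁1₁)1₂ is (ε ⊗ id)(Δ(h)Δ(1)).
  have h1 : ∀ s t : H ⊗[k] H, LinearMap.mul' k H (TensorProduct.map LinearMap.id
      (projRight k H ∘ₗ LinearMap.mulRight k s ∘ₗ inl k H) (TensorProduct.comm k H H t)) =
      projRight k H (t * s) := by
    intro s t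
    induction t with
    | zero => simp
    | add x y hx hy => simp only [map_add, add_mul, hx, hy]
    | tmul a b =>
      induction s with
      | zero => simp
      | add x y hx hy =>
        rw [mul_add, map_add, ← hx, ← hy]
        simp [mul_add]
      | tmul c d => simp [projRight]
  refine (h1 _ _).trans ?_
  rw [← comul_mul, mul_one]
  simp [projRight]

end opposite

end WeakHopfAlgebra

/-! ### The action of the smash product on the module algebra -/

namespace SmashProduct

section action

variable (k : Type*) {H A : Type*} [Field k] [Ring H] [Algebra k H] [Coalgebra k H]
  [Ring A] [Algebra k A] [Module H A] [IsScalarTower k H A]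

/-- The map `x ⊗ h ↦ (y ↦ x(h • y))`. -/
noncomputable def actionAux : A ⊗[k] H →ₗ[k] Module.End k A :=
  LinearMap.mul' k (Module.End k A) ∘ₗ
    TensorProduct.map (LinearMap.mul k A) (Algebra.lsmul k k A).toLinearMap

@[simp] theorem actionAux_tmul (x : A) (h : H) (y : A) :
    actionAux k (x ⊗ₜ[k] h) y = x * h • y := rfl

theorem actionAux_mulAux [WeakHopfAlgebra k H] [WeakModuleAlgebra k H A] (a b : A ⊗[k] H) :
    actionAux k (mulAux k a b) = actionAux k a * actionAux k b := by
  induction a with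
  | zero => simp
  | add a b ha hb => simp only [map_add, LinearMap.add_apply, add_mul, ha, hb]
  | tmul x h =>
    induction b with
    | zero => simp
    | add a b ha hb => simp only [map_add, mul_add, ha, hb]
    | tmul y g =>
      ext w
      rw [mulAux_tmul, Module.End.mul_apply, diag_tmul, Module.End.mul_apply, actionAux_tmul,
        actionAux_tmul, WeakModuleAlgebra.smul_mul_eq k]
      generalize comul (R := k) h = s
      induction s with
      | zero => simp
      | add a b ha hb => simp only [map_add, LinearMap.add_apply, mul_add, ha, hb]
      | tmul c d => simp [mul_smul, mul_assoc]

theorem relations_le_ker_actionAux [WeakHopfAlgebra k H] [WeakModuleAlgebra k H A] :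
    relations k H A ≤ LinearMap.ker (actionAux k) := by
  refine Submodule.span_le.2 ?_
  rintro _ ⟨x, z, h, hz, rfl⟩
  rw [SetLike.mem_coe, LinearMap.mem_ker, map_sub, sub_eq_zero]
  ext y
  rw [actionAux_tmul, actionAux_tmul, mul_smul, WeakModuleAlgebra.target_smul k hz (h • y),
    mul_assoc]

end action

end SmashProduct

/-! ### The action of H # H* on H and its inversion by means of S⁻¹. -/

section SmashAction

open WeakHopfAlgebra

variable {k H : Type*} [Field k] [Ring H] [Algebra k H] [Coalgebra k H]
    [FiniteDimensional k H] [WeakHopfAlgebra k H]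

namespace DualGroupoid

theorem smul_eq_rightTrans (φ : DualGroupoid k H) (h : H) : φ • h = rightTrans (toDual φ) h := rfl

/-- The map `x ⊗ φ ↦ (h ↦ x(φ ⇀ h))` takes values in the right `H_t`-linear maps. -/
noncomputable def actionEnd : H ⊗[k] DualGroupoid k H →ₗ[k]
    Module.End (targetSubalgebra k H).op H where
  toFun t :=
    { SmashProduct.actionAux k t with
      map_smul' := fun z h => by
        change SmashProduct.actionAux k t (h * MulOpposite.unop (z : Hᵐᵒᵖ)) =
          SmashProduct.actionAux k t h * MulOpposite.unop (z : Hᵐᵒᵖ)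
        induction t with
        | zero => simp
        | add a b ha hb => simp only [map_add, LinearMap.add_apply, add_mul, ha, hb]
        | tmul x φ =>
          rw [SmashProduct.actionAux_tmul, SmashProduct.actionAux_tmul, smul_eq_rightTrans,
            smul_eq_rightTrans, rightTrans_apply, rightTrans_apply,
            comul_mul_target h z.2, mul_assoc]
          congr 1
          generalize comul (R := k) h = s
          induction s with
          | zero => simp
          | add a b ha hb => simp only [map_add, add_mul, ha, hb]
          | tmul c d => simp }
  map_add' a b := by
    ext h
    change SmashProduct.actionAux k (a + b) h = _
    rw [map_add]
    rfl
  map_smul' c a := by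
    ext h
    change SmashProduct.actionAux k (c • a) h = _
    rw [map_smul]
    rfl

theorem actionEnd_apply (t : H ⊗[k] DualGroupoid k H) (h : H) :
    actionEnd t h = SmashProduct.actionAux k t h := rfl

/-- The element `∑ f(bⱼ) ⊗ bʲ` of `H ⊗ H*` corresponding to a linear map `f`. -/
noncomputable def ofLinearMap : (H →ₗ[k] H) →ₗ[k] H ⊗[k] DualGroupoid k H where
  toFun f := ∑ j, f (Module.finBasis k H j) ⊗ₜ toDual.symm ((Module.finBasis k H).coord j)
  map_add' f g := by simp [TensorProduct.add_tmul, Finset.sum_add_distrib]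
  map_smul' c f := by simp [TensorProduct.smul_tmul', Finset.smul_sum]

theorem ofLinearMap_smulRight (f : Module.Dual k H) (x : H) :
    ofLinearMap (f.smulRight x) = x ⊗ₜ[k] (toDual.symm f : DualGroupoid k H) := by
  simp only [ofLinearMap, LinearMap.coe_mk, AddHom.coe_mk, LinearMap.smulRight_apply,
    TensorProduct.smul_tmul]
  rw [← TensorProduct.tmul_sum]
  congr 1
  apply toDual.injective
  rw [map_sum, LinearEquiv.apply_symm_apply]
  conv_rhs => rw [← (Module.finBasis k H).sum_dual_apply_smul_coord f]
  simp

/-- The sum ∑ f(bⱼ)h₁bʲ(h₂) equals f(h₂)h₁. Acting on H is thus ⋆ᵒ-multiplication by id on the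
right, to be undone by ⋆ᵒ-multiplication by S⁻¹. -/
theorem actionAux_ofLinearMap (f : H →ₗ[k] H) :
    SmashProduct.actionAux k (ofLinearMap f : H ⊗[k] DualGroupoid k H) = convOp f LinearMap.id := by
  ext h
  rw [convOp_apply, ← sum_rightTrans_tmul (Module.finBasis k H) h]
  simp [ofLinearMap, LinearMap.sum_apply, smul_eq_rightTrans]

variable (k H) in
-- The preimage of T comes from h ↦ T(h₂)S⁻¹(h₁). It acts as h ↦ T(h₃)S⁻¹(h₂)h₁, where S⁻¹(h₂)h₁
-- lies in H_t and moves inside T, leaving T(h₂ε(h₁1₁)1₂) = T(h).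
theorem actionEnd_surjective : Function.Surjective (actionEnd (k := k) (H := H)) := by
  intro T
  let T' : H →ₗ[k] H := T.restrictScalars k
  refine ⟨ofLinearMap (convOp T' (antipodeEquiv k H).symm.toLinearMap), ?_⟩
  ext h
  have h1 : convOp (antipodeEquiv k H).symm.toLinearMap LinearMap.id =
      sourceToTarget (k := k) (H := H) := LinearMap.ext antipodeEquiv_symm_mul_comm
  have h2 : ∀ t : H ⊗[k] H, LinearMap.mul' k H (TensorProduct.map T' (sourceToTarget (k := k)) t) =
      T' (LinearMap.mul' k H (TensorProduct.map LinearMap.id (sourceToTarget (k := k)) t)) := by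
    intro t
    induction t with
    | zero => simp
    | add x y hx hy => simp only [map_add, hx, hy]
    | tmul a b => exact (end_apply_mul T a _ (targetCounit_sourceToTarget b)).symm
  rw [actionEnd_apply, actionAux_ofLinearMap, convOp_assoc, h1, convOp_apply, h2, ← convOp_apply,
    id_convOp_sourceToTarget]
  rfl

/-- For t = x ⊗ φ the map is h ↦ xφ(h₃)h₂S⁻¹(h₁) = x1₁φ(1₂h), which corresponds to x1₁ ⊗ φ(1₂ ·).
Now φ(1₂ ·) = ξφ with ξ = ε(1₂ ·) in (H*)_t; moving ξ across the tensor sign gives x1₁1'₁ε(1₂1'₂) ⊗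
φ, which is x ⊗ φ since Δ(1)² = Δ(1). -/
theorem mkQ_ofLinearMap_actionAux (t : H ⊗[k] DualGroupoid k H) :
    (SmashProduct.relations k (DualGroupoid k H) H).mkQ (ofLinearMap
      (convOp (SmashProduct.actionAux k t) (antipodeEquiv k H).symm.toLinearMap)) =
    (SmashProduct.relations k (DualGroupoid k H) H).mkQ t := by
  have hadd : ∀ f g u : H →ₗ[k] H, convOp (f + g) u = convOp f u + convOp g u := by
    intro f g u
    ext h
    simp [convOp, TensorProduct.map_add_left]
  induction t with
  | zero => simp [convOp]
  | add a b ha hb => simp only [map_add, hadd, ha, hb]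
  | tmul x φ =>
    obtain ⟨s, hs⟩ := TensorProduct.exists_finset (comul (R := k) (1 : H))
    have hs' : comul (R := k) (1 : H) = ∑ i ∈ s, i.1 ⊗ₜ[k] targetCounit k i.2 := by
      conv_lhs => rw [← lTensor_targetCounit_comul_one, hs]
      simp
    have h1 : convOp LinearMap.id (antipodeEquiv k H).symm.toLinearMap =
        targetToSource (k := k) (H := H) := LinearMap.ext mul_comm_antipodeEquiv_symm
    have h2 : SmashProduct.actionAux k (x ⊗ₜ[k] φ) = LinearMap.mulLeft k x ∘ₗ
        convOp (Algebra.linearMap k H ∘ₗ toDual φ) LinearMap.id := by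
      ext h
      rw [SmashProduct.actionAux_tmul, smul_eq_rightTrans, rightTrans_apply, LinearMap.comp_apply,
        convOp_apply, LinearMap.mulLeft_apply]
      congr 1
      generalize comul (R := k) h = u
      induction u with
      | zero => simp
      | add a b ha hb => simp only [map_add, ha, hb]
      | tmul c d => simp [Algebra.smul_def]
    have h3 : ∀ f g : H →ₗ[k] H, convOp (LinearMap.mulLeft k x ∘ₗ f) g =
        LinearMap.mulLeft k x ∘ₗ convOp f g := by
      intro f g
      ext h
      simp only [convOp_apply, LinearMap.comp_apply]
      generalize comul (R := k) h = u
      induction u with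
      | zero => simp
      | add a b ha hb => simp only [map_add, ha, hb]
      | tmul c d => simp [mul_assoc]
    have h4 : convOp (Algebra.linearMap k H ∘ₗ toDual φ) (targetToSource (k := k)) =
        ∑ i ∈ s, (toDual φ ∘ₗ LinearMap.mulLeft k (targetCounit k i.2)).smulRight i.1 := by
      ext h
      have h5 : ∀ u : H ⊗[k] H, LinearMap.mul' k H (TensorProduct.map
          (Algebra.linearMap k H ∘ₗ toDual φ) (targetToSource (k := k))
          (TensorProduct.comm k H H u)) = ∑ i ∈ s, toDual φ (projRight k H
          (targetCounit k i.2 ⊗ₜ 1 * u)) • i.1 := by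
        intro u
        induction u with
        | zero => simp
        | add a b ha hb => simp only [map_add, mul_add, add_smul, Finset.sum_add_distrib, ha, hb]
        | tmul c d =>
          rw [TensorProduct.comm_tmul, TensorProduct.map_tmul, LinearMap.mul'_apply,
            targetToSource_apply, hs', Finset.sum_mul, map_sum, Finset.mul_sum]
          refine Finset.sum_congr rfl fun i _ => ?_
          simp [projLeft, projRight, Algebra.algebraMap_eq_smul_one, smul_smul]
      rw [convOp_apply, h5, LinearMap.sum_apply]
      refine Finset.sum_congr rfl fun i _ => ?_
      rw [← comul_target_mul h (targetCounit_idem k _)]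
      simp [projRight]
    have h6 : ∀ i : H × H, (SmashProduct.relations k (DualGroupoid k H) H).mkQ ((x * i.1) ⊗ₜ[k]
        toDual.symm (toDual φ ∘ₗ LinearMap.mulLeft k (targetCounit k i.2))) =
        (SmashProduct.relations k (DualGroupoid k H) H).mkQ ((x * (i.1 * projLeft k H
          (1 ⊗ₜ targetCounit k i.2 * comul (R := k) (1 : H)))) ⊗ₜ[k] φ) := by
      intro i
      let ξ : DualGroupoid k H :=
        toDual.symm (counit ∘ₗ LinearMap.mulLeft k (targetCounit k i.2))
      -- The map ε_t of H* is the transpose of that of H, and ε(zε_t(h)) = ε(zh).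
      have hξ : targetCounit k ξ = ξ := by
        ext h
        rw [targetCounit_apply]
        exact counit_mul_targetCounit _ _
      have h7 : toDual.symm (toDual φ ∘ₗ LinearMap.mulLeft k (targetCounit k i.2)) = ξ * φ := by
        ext h
        have h8 : ∀ u : H ⊗[k] H, LinearMap.mul' k k (TensorProduct.map (toDual ξ) (toDual φ) u) =
            toDual φ (projRight k H (targetCounit k i.2 ⊗ₜ 1 * u)) := by
          intro u
          induction u with
          | zero => simp
          | add a b ha hb => simp only [map_add, mul_add, ha, hb]
          | tmul c d => simp [projRight, ξ]
        rw [mul_apply, h8, ← comul_target_mul h (targetCounit_idem k _)]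
        simp [projRight]
      have h9 : ξ • (1 : H) =
          projLeft k H (1 ⊗ₜ targetCounit k i.2 * comul (R := k) (1 : H)) :=
        rid_lTensor_comp_mulLeft _ _ _
      rw [h7, ← SmashProduct.mkQ_relations k _ hξ, h9, mul_assoc]
    have h10 : ∑ i ∈ s, i.1 * projLeft k H
        (1 ⊗ₜ targetCounit k i.2 * comul (R := k) (1 : H)) = 1 := by
      have h11 : ∀ (a : H) (u : H ⊗[k] H), a * projLeft k H u = projLeft k H (a ⊗ₜ 1 * u) :=
        fun a u => (rid_lTensor_mul _ _ _).symm
      simp only [h11, ← mul_assoc, Algebra.TensorProduct.tmul_mul_tmul, mul_one, one_mul]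
      rw [← map_sum, ← Finset.sum_mul, ← hs', comul_one_mul_self]
      simp [projLeft]
    have h12 : LinearMap.mulLeft k x ∘ₗ ∑ i ∈ s, (toDual φ ∘ₗ
        LinearMap.mulLeft k (targetCounit k i.2)).smulRight i.1 = ∑ i ∈ s, (toDual φ ∘ₗ
        LinearMap.mulLeft k (targetCounit k i.2)).smulRight (x * i.1) := by
      ext h
      simp [LinearMap.sum_apply]
    rw [h2, h3, convOp_assoc, h1, h4, h12, map_sum, map_sum]
    simp only [ofLinearMap_smulRight, h6]
    rw [← map_sum, ← TensorProduct.sum_tmul, ← Finset.mul_sum, h10, mul_one]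

/-- A tensor is determined modulo the relations by its action, by `mkQ_ofLinearMap_actionAux`;
conversely the relations act as zero. -/
theorem ker_actionEnd : LinearMap.ker (actionEnd (k := k) (H := H)) =
    SmashProduct.relations k (DualGroupoid k H) H := by
  refine le_antisymm (fun t ht => ?_) (fun t ht => ?_)
  · have h1 : SmashProduct.actionAux k t = 0 := by
      ext h
      exact LinearMap.congr_fun (LinearMap.mem_ker.1 ht) h
    have h2 := mkQ_ofLinearMap_actionAux t
    rw [h1] at h2
    rw [← Submodule.ker_mkQ (SmashProduct.relations k (DualGroupoid k H) H), LinearMap.mem_ker,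
      ← h2]
    simp [convOp]
  · rw [LinearMap.mem_ker]
    ext h
    exact LinearMap.congr_fun (LinearMap.mem_ker.1
      (SmashProduct.relations_le_ker_actionAux k ht)) h

/-- The action of `H # H*` on `H` by right `H_t`-linear maps. -/
noncomputable def smashAction : SmashProduct k (DualGroupoid k H) H →ₗ[k]
    Module.End (targetSubalgebra k H).op H :=
  (SmashProduct.relations k (DualGroupoid k H) H).liftQ actionEnd ker_actionEnd.ge

theorem smashAction_proj (t : H ⊗[k] DualGroupoid k H) :
    smashAction (SmashProduct.proj k (DualGroupoid k H) H t) = actionEnd t := rfl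

/-- The action of `H # H*` on `H` as a homomorphism of algebras. -/
noncomputable def smashActionHom : SmashProduct k (DualGroupoid k H) H →ₐ[k]
    Module.End (targetSubalgebra k H).op H :=
  AlgHom.ofLinearMap smashAction
    (by
      ext h
      rw [SmashProduct.one_def, SmashProduct.mk, smashAction_proj, actionEnd_apply]
      simp)
    (fun a b => by
      obtain ⟨a, rfl⟩ := SmashProduct.proj_surjective k a
      obtain ⟨b, rfl⟩ := SmashProduct.proj_surjective k b
      ext h
      rw [SmashProduct.mul_def, SmashProduct.mulMap_proj, smashAction_proj, actionEnd_apply,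
        SmashProduct.actionAux_mulAux]
      rfl)

variable (k H) in
theorem smashActionHom_bijective : Function.Bijective (smashActionHom (k := k) (H := H)) := by
  refine ⟨(injective_iff_map_eq_zero _).2 fun a ha => ?_, fun T => ?_⟩
  · obtain ⟨t, rfl⟩ := SmashProduct.proj_surjective k a
    have h1 : t ∈ SmashProduct.relations k (DualGroupoid k H) H := by
      rw [← ker_actionEnd]
      exact ha
    exact (Submodule.Quotient.mk_eq_zero _).2 h1
  · obtain ⟨t, rfl⟩ := actionEnd_surjective k H T
    exact ⟨SmashProduct.proj k (DualGroupoid k H) H t, rfl⟩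

end DualGroupoid

end SmashAction

theorem mainTheorem2 {k H : Type*} [Field k] [Ring H] [Algebra k H] [Coalgebra k H]
    [FiniteDimensional k H] [WeakHopfAlgebra k H] :
    Nonempty (SmashProduct k (DualGroupoid k H) H ≃ₐ[k]
      Module.End (WeakHopfAlgebra.targetSubalgebra k H).op H) ∧
    IsSemisimpleRing (SmashProduct k (DualGroupoid k H) H) := by
  have := WeakHopfAlgebra.isSemisimpleRing_end_target_op (k := k) (H := H)
  have e := AlgEquiv.ofBijective _ (DualGroupoid.smashActionHom_bijective k H)
  exact ⟨⟨e⟩, e.symm.toRingEquiv.isSemisimpleRing⟩
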